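/- Let $(\mathcal C,\wedge,S)$ be a closed symmetric monoidal stable topological model category with homotopy category $h\mathcal C$. For a cofibrant object $V$ and any $Y$ write $\pi_V(Y)=[V,Y]$ for the morphisms $V\to Y$ in $h\mathcal C$ (for $V$ a cofibrant model of the sphere $S^n$ this is $\pi_n(Y)$; replacing $V$ by $\Sigma V$ raises the stem by one). A filtered object is a tower of fibrations $X=X_0\leftarrow X_1\leftarrow X_2\leftarrow\cdots$ of fibrant objects; put $X_f=X_0$ for $f<0$. Let $X_f\xrightarrow{p}X_f/X_{f+1}\xrightarrow{\kappa}\Sigma X_{f+1}$ be the (homotopy) cofiber sequence of $X_{f+1}\to X_f$. For $r\ge1$ the $E_r$-page of its spectral sequence is $E_r^{V,f}(X)=Z_r/B_r$, where $Z_r\subseteq\pi_V(X_f/X_{f+1})$ consists of the $x$ for which $\kappa(x)$ lifts to $[V,\Sigma X_{f+r}]$, and $B_r$ consists of the images under $p$ of $\ker(\pi_V(X_f)\to\pi_V(X_{f-r+1}))$. The differential $d_r:E_r^{\Sigma W,f}(X)\to E_r^{W,f+r}(X)$ sends the class of $x$ to the class of $p(y)$, where $y\in\pi_W(X_{f+r})$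 is such that the suspension of the image of $y$ in $\pi_W(X_{f+1})$ is $\kappa(x)$. An element of $E_r^{V,f}(X)$ is a permanent cycle that converges to (detects) $\alpha\in\pi_V(X)$ if it is represented by $p(\tilde\alpha)$ for some $\tilde\alpha\in\pi_V(X_f)$ with image $\alpha$ in $\pi_V(X)$. Let $X,X',X''$ be filtered objects with pairings $\mu:X'_i\wedge X_j\to X_{i+j}$, $\mu':X''_i\wedge X'_j\to X'_{i+j}$, $\mu'':X''_i\wedge X_j\to X_{i+j}$, natural in $i$ and $j$ (compatible with the filtrations) and associative, $\mu(\mu'\wedge 1)=\mu''(1\wedge\mu)$ as maps $X''_i\wedge X'_j\wedge X_k\to X_{i+j+k}$. They induce products of homotopy classes and of $E_r$-pages; the product of $\alpha\in\pi_T(X)$ and $\alpha'\in\pi_{T'}(X')$ is written $\alpha\alpha'\in\pi_{T'\wedge T}(X)$, and similarly for the other pairings and for the pages. Fix $r\ge 1$, cofibrant objects $T,T',T''$, and classes $\alpha\in\pi_T(X)$, $\alpha'\in\pi_{T'}(X')$, $\alpha''\in\pi_{T''}(X'')$ with $\alpha\alpha'=0$ and $\alpha'\alpha''=0$. Let $a\in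 E_r^{T,l}(X)$, $a'\in E_r^{T',m}(X')$, $a''\in E_r^{T'',n}(X'')$ (with $l,m,n\ge0$) be permanent cycles that detect $\alpha,\alpha',\alpha''$, and suppose that $aa'$ and $a'a''$ are hit by $d_r$, i.e. they are zero in $E_{r+1}$. Assume the crossing differential hypothesis at the $E_r$-page in the degrees of $aa'$ and $a'a''$: for $0\le i\le l+m-r-1$ every element of $E_{l+m-i+1}^{\Sigma(T'\wedge T),\,i}(X)$ is a permanent cycle, and for $0\le i\le m+n-r-1$ every element of $E_{m+n-i+1}^{\Sigma(T''\wedge T'),\,i}(X')$ is a permanent cycle. Let $W=T''\wedge T'\wedge T$. The Toda bracket $\langle\alpha,\alpha',\alpha''\rangle\subseteq\pi_{\Sigma W}(X)$ is the set of the classes of the maps $\Sigma W\simeq CW\cup_W CW\to X$ that are given by $\mu(F\wedge\alpha)$ on the first cone and by $\mu''(\alpha''\wedge G)$ on the second, for representatives of $\alpha,\alpha',\alpha''$ and null homotopies $F:C(T''\wedge T')\to X'$ of $\alpha'\alpha''$ and $G:C(T'\wedge T)\to X$ of $\alpha\alpha'$. The Massey product is $$\langle a,a',a''\rangle=\{[ab'-ba'']\;:\;d_r(b')=a'a'',\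 d_r(b)=aa'\}\subseteq E_{r+1}^{\Sigma W,\,l+m+n-r}(X).$$ (Here $\Sigma(T''\wedge T')\wedge T$ and $T''\wedge\Sigma(T'\wedge T)$ are identified with $\Sigma W$ by the canonical isomorphisms, which account for the signs in non-zero degrees.) Then the Massey product $\langle a,a',a''\rangle$ contains a permanent cycle that converges to an element of the Toda bracket $\langle\alpha,\alpha',\alpha''\rangle$. -/

import Mathlib

open CategoryTheory Limits MonoidalCategory HomotopicalAlgebra Opposite

universe v u

noncomputable section

namespace TodaMassey

/-! ### Spaces -/

/-- The cartesian monoidal structure on the (convenient) category of Delta-generated spaces. -/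
instance cartesianDeltaGenerated : CartesianMonoidalCategory DeltaGenerated.{v} :=
  .ofHasFiniteProducts

instance braidedDeltaGenerated : BraidedCategory DeltaGenerated.{v} :=
  .ofCartesianMonoidalCategory

/-- Serre fibrations of Delta-generated spaces: the singular simplicial set of the map has the
right lifting property against all horn inclusions. -/
def serreFibrations : MorphismProperty DeltaGenerated.{v} :=
  SSet.modelCategoryQuillen.J.rlp.inverseImage
    (DeltaGenerated.deltaGeneratedToTop ⋙ TopCat.toSSet)

/-- Serre fibrations which are weak homotopy equivalences: the singular simplicial set of the map
has the right lifting property against all boundary inclusions. -/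
def trivialSerreFibrations : MorphismProperty DeltaGenerated.{v} :=
  SSet.modelCategoryQuillen.I.rlp.inverseImage
    (DeltaGenerated.deltaGeneratedToTop ⋙ TopCat.toSSet)

/-- The cofibrations of the Quillen model structure on spaces. -/
def serreCofibrations : MorphismProperty DeltaGenerated.{v} := trivialSerreFibrations.llp

/-- The trivial cofibrations of the Quillen model structure on spaces. -/
def trivialSerreCofibrations : MorphismProperty DeltaGenerated.{v} := serreFibrations.llp

instance deltaGeneratedSpace_interval : DeltaGeneratedSpace (ULift.{v} unitInterval) :=
  (show Topology.IsQuotientMap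
      (fun x : Fin 1 → ℝ => ULift.up.{v} (Set.projIcc (0 : ℝ) 1 zero_le_one (x 0))) from
    Topology.IsQuotientMap.of_inverse
      (g := fun x : Fin 1 → ℝ => ULift.up.{v} (Set.projIcc (0 : ℝ) 1 zero_le_one (x 0)))
      (f := fun t : ULift.{v} unitInterval => fun _ : Fin 1 => (t.down : ℝ))
      (continuous_pi fun _ => continuous_subtype_val.comp continuous_uliftDown)
      (continuous_uliftUp.comp (continuous_projIcc.comp (continuous_apply 0)))
      (fun t => by simp)).isGeneratedBy

/-- The unit interval. -/
def interval : DeltaGenerated.{v} := DeltaGenerated.of (ULift.{v} unitInterval)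

/-- The point of the unit interval with parameter `t`. -/
def intervalPt (t : unitInterval) : 𝟙_ DeltaGenerated.{v} ⟶ interval.{v} :=
  ConcreteCategory.ofHom (ContinuousMap.const _ (ULift.up t))

/-- The reflection `t ↦ 1 - t` of the unit interval. -/
def intervalRev : interval.{v} ⟶ interval.{v} :=
  ConcreteCategory.ofHom (X := DeltaGenerated.of (ULift.{v} unitInterval))
    (Y := DeltaGenerated.of (ULift.{v} unitInterval))
    ⟨fun t => ULift.up (unitInterval.symm t.down),
      continuous_uliftUp.comp (unitInterval.continuous_symm.comp continuous_uliftDown)⟩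

lemma intervalPt_rev (t : unitInterval) :
    intervalPt.{v} t ≫ intervalRev = intervalPt (unitInterval.symm t) := rfl

/-! ### Symmetric monoidal stable topological model categories -/

section ModelCategories

variable (C : Type u) [Category.{v} C] [ModelCategory C]

/-- The homotopy category: the localization at the weak equivalences. -/
abbrev Ho := (weakEquivalences C).Localization

/-- The localization functor to the homotopy category. -/
abbrev toHo : C ⥤ Ho C := (weakEquivalences C).Q

variable [MonoidalCategory C] [SymmetricCategory C]

/-- The pushout-product axiom and the unit axiom, for a model structure and a symmetric monoidal
structure on the same category. -/
class SymmetricMonoidalModelCategory : Prop where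
  cofibration_pushoutProduct {A B X Y : C} (i : A ⟶ B) (j : X ⟶ Y)
    [Cofibration i] [Cofibration j] :
    Cofibration ((Arrow.pushoutProduct.obj (Arrow.mk i)).obj (Arrow.mk j)).hom
  weakEquivalence_pushoutProduct {A B X Y : C} (i : A ⟶ B) (j : X ⟶ Y)
    [Cofibration i] [Cofibration j] (h : WeakEquivalence i ∨ WeakEquivalence j) :
    WeakEquivalence ((Arrow.pushoutProduct.obj (Arrow.mk i)).obj (Arrow.mk j)).hom
  weakEquivalence_unit {Q X : C} (q : Q ⟶ 𝟙_ C) [IsCofibrant Q] [WeakEquivalence q]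
    [IsCofibrant X] : WeakEquivalence (q ▷ X)

/-- The structure of a topological (symmetric monoidal) model category. The functor
`spaces` is `K ↦ K₊ ∧ S`, where `S` is the unit object. It is a left adjoint and strong symmetric
monoidal, the tensor of a space `K` with an object `X` is `spaces.obj K ⊗ X`, the mapping space
`Map (X, Y)` is the value at the internal hom of `X` and `Y` of the right adjoint of `spaces`,
and the last two axioms say that tensoring objects with spaces is a left Quillen bifunctor. -/
class TopologicalStructure where
  spaces : DeltaGenerated.{v} ⥤ C
  isLeftAdjoint : spaces.IsLeftAdjoint
  braided : spaces.Braided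
  cofibration_pushoutProduct {K L : DeltaGenerated.{v}} (k : K ⟶ L) {X Y : C} (j : X ⟶ Y)
    (hk : serreCofibrations k) [Cofibration j] :
    Cofibration ((Arrow.pushoutProduct.obj (Arrow.mk (spaces.map k))).obj (Arrow.mk j)).hom
  weakEquivalence_pushoutProduct {K L : DeltaGenerated.{v}} (k : K ⟶ L) {X Y : C} (j : X ⟶ Y)
    (hk : serreCofibrations k) [Cofibration j]
    (h : trivialSerreCofibrations k ∨ WeakEquivalence j) :
    WeakEquivalence ((Arrow.pushoutProduct.obj (Arrow.mk (spaces.map k))).obj (Arrow.mk j)).hom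

attribute [instance] TopologicalStructure.isLeftAdjoint TopologicalStructure.braided

variable [HasZeroMorphisms C] [TopologicalStructure C]

/-- The cone `C S = ([0,1] ⊗ S) / ({1} ⊗ S)` on the unit object `S`. -/
def unitCone : C :=
  cokernel ((TopologicalStructure.spaces (C := C)).map (intervalPt 1))

/-- The projection `[0,1] ⊗ S ⟶ C S`. -/
def toUnitCone : (TopologicalStructure.spaces (C := C)).obj interval ⟶ unitCone C :=
  cokernel.π _

/-- The inclusion `S ⟶ C S` of the base `{0} ⊗ S` of the cone. -/
def unitConeBase : 𝟙_ C ⟶ unitCone C :=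
  Functor.LaxMonoidal.ε (TopologicalStructure.spaces (C := C)) ≫
    (TopologicalStructure.spaces (C := C)).map (intervalPt 0) ≫ toUnitCone C

/-- The suspension `C S / S` of the unit object `S`. -/
def unitSusp : C := cokernel (unitConeBase C)

/-- The projection `C S ⟶ C S / S`. -/
def unitConeToSusp : unitCone C ⟶ unitSusp C := cokernel.π _

lemma spaces_one_toUnitCone :
    (TopologicalStructure.spaces (C := C)).map (intervalPt 1) ≫ toUnitCone C = 0 :=
  cokernel.condition _

lemma unitConeBase_toSusp : unitConeBase C ≫ unitConeToSusp C = 0 :=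
  cokernel.condition _

lemma spaces_zero_toUnitCone_toSusp :
    (TopologicalStructure.spaces (C := C)).map (intervalPt 0) ≫ toUnitCone C ≫
      unitConeToSusp C = 0 := by
  rw [← cancel_epi (Functor.LaxMonoidal.ε (TopologicalStructure.spaces (C := C)))]
  simpa [unitConeBase] using unitConeBase_toSusp C

/-- The projection `C S ⟶ C S / S` with reversed cone coordinate: on `[0,1] ⊗ S` it is
`t ↦ 1 - t` followed by the projection to `C S / S`. -/
def unitConeToSuspRev : unitCone C ⟶ unitSusp C :=
  cokernel.desc _ ((TopologicalStructure.spaces (C := C)).map intervalRev ≫ toUnitCone C ≫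
    unitConeToSusp C) (by
      rw [← Functor.map_comp_assoc, intervalPt_rev, unitInterval.symm_one]
      exact spaces_zero_toUnitCone_toSusp C)

lemma unitConeBase_toSuspRev : unitConeBase C ≫ unitConeToSuspRev C = 0 := by
  have h : toUnitCone C ≫ unitConeToSuspRev C =
      (TopologicalStructure.spaces (C := C)).map intervalRev ≫ toUnitCone C ≫
        unitConeToSusp C := cokernel.π_desc _ _ _
  simp only [unitConeBase, Category.assoc, h]
  rw [← Functor.map_comp_assoc, intervalPt_rev, unitInterval.symm_zero,
    reassoc_of% (spaces_one_toUnitCone C), zero_comp, comp_zero]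

/-- A model category is stable if it is pointed and suspension is an equivalence on the homotopy
category. Here `susp` is the derived suspension functor: it is computed by `X ↦ C S / S ⊗ X`
on cofibrant objects, which determines it up to isomorphism. -/
class StableStructure [HasZeroObject C] where
  susp : Ho C ⥤ Ho C
  suspIso : CofibrantObject.ι ⋙ toHo C ⋙ susp ≅
    CofibrantObject.ι ⋙ tensorLeft (unitSusp C) ⋙ toHo C
  isEquivalence : susp.IsEquivalence

end ModelCategories

section

variable {C : Type u} [Category.{v} C] [ModelCategory C] [MonoidalCategory C]
  [SymmetricCategory C] [MonoidalClosed C] [HasZeroObject C] [HasZeroMorphisms C]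

lemma whiskerLeft_zero_eq {C : Type u} [Category.{v} C] [MonoidalCategory C] [MonoidalClosed C]
    [HasZeroObject C] [HasZeroMorphisms C] (X : C) {Y Z : C} : X ◁ (0 : Y ⟶ Z) = 0 :=
  (tensorLeft X).map_zero Y Z

lemma zero_whiskerRight_eq {C : Type u} [Category.{v} C] [MonoidalCategory C]
    [SymmetricCategory C] [MonoidalClosed C] [HasZeroObject C] [HasZeroMorphisms C] {Y Z : C} (X : C) : (0 : Y ⟶ Z) ▷ X = 0 := by
  rw [← cancel_mono (β_ Z X).hom, BraidedCategory.braiding_naturality_left,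
    whiskerLeft_zero_eq, comp_zero, zero_comp]

instance isCofibrant_tensor [SymmetricMonoidalModelCategory C] (A B : C)
    [IsCofibrant A] [IsCofibrant B] : IsCofibrant (A ⊗ B) := by
  have h := SymmetricMonoidalModelCategory.cofibration_pushoutProduct
    (initial.to A) (initial.to B)
  have h0 : IsZero (⊥_ C) := (isZero_zero C).of_iso
    (initialIsInitial.uniqueUpToIso HasZeroObject.zeroIsInitial)
  have hl : IsZero ((⊥_ C) ⊗ B) := by
    rw [IsZero.iff_id_eq_zero, ← id_whiskerRight, (IsZero.iff_id_eq_zero _).1 h0,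
      zero_whiskerRight_eq]
  have hr : IsZero (A ⊗ (⊥_ C)) := by
    rw [IsZero.iff_id_eq_zero, ← whiskerLeft_id, (IsZero.iff_id_eq_zero _).1 h0,
      whiskerLeft_zero_eq]
  have hp : IsZero ((Arrow.pushoutProduct.obj (Arrow.mk (initial.to A))).obj
      (Arrow.mk (initial.to B))).left := by
    rw [IsZero.iff_id_eq_zero]
    apply pushout.hom_ext
    · exact hr.eq_of_src _ _
    · exact hl.eq_of_src _ _
  rw [isCofibrant_iff_of_isInitial _ hp.isInitial]
  exact h

variable [TopologicalStructure C]

/-! ### Cones and suspensions -/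

/-- The cone `C S ⊗ X` on `X`. -/
abbrev Cone (X : C) : C := unitCone C ⊗ X

/-- The inclusion of `X` as the base of its cone. -/
def coneBase (X : C) : X ⟶ Cone X := (λ_ X).inv ≫ unitConeBase C ▷ X

/-- The suspension of `X`, the quotient of the cone on `X` by its base. -/
abbrev Susp (X : C) : C := unitSusp C ⊗ X

/-- The projection from the cone to the suspension. -/
def coneToSusp (X : C) : Cone X ⟶ Susp X := unitConeToSusp C ▷ X

/-- The projection from the cone to the suspension, with reversed cone coordinate. -/
def coneToSuspRev (X : C) : Cone X ⟶ Susp X := unitConeToSuspRev C ▷ X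

lemma coneBase_toSusp (X : C) : coneBase X ≫ coneToSusp X = 0 := by
  simp only [coneBase, coneToSusp, Category.assoc]
  rw [← comp_whiskerRight, unitConeBase_toSusp, zero_whiskerRight_eq, comp_zero]

lemma coneBase_toSuspRev (X : C) : coneBase X ≫ coneToSuspRev X = 0 := by
  simp only [coneBase, coneToSuspRev, Category.assoc]
  rw [← comp_whiskerRight, unitConeBase_toSuspRev, zero_whiskerRight_eq, comp_zero]

/-- Two cones on `X` glued along their bases. -/
abbrev DoubleCone (X : C) : C := pushout (coneBase X) (coneBase X)

/-- The identification (in the homotopy category) of two cones glued along their bases with the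
suspension: the second cone is collapsed. -/
def doubleConeToSusp (X : C) : DoubleCone X ⟶ Susp X :=
  pushout.desc (coneToSusp X) 0 (by rw [coneBase_toSusp, comp_zero])

/-- `C (X ⊗ Y) ≅ C X ⊗ Y`. -/
def coneTensorRight (X Y : C) : Cone (X ⊗ Y) ⟶ Cone X ⊗ Y := (α_ _ X Y).inv

/-- `C (X ⊗ Y) ≅ X ⊗ C Y`. -/
def coneTensorLeft (X Y : C) : Cone (X ⊗ Y) ⟶ X ⊗ Cone Y :=
  (α_ _ X Y).inv ≫ (β_ (unitCone C) X).hom ▷ Y ≫ (α_ X _ Y).hom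

/-- `Σ (X ⊗ Y) ≅ Σ X ⊗ Y`. -/
def suspTensorRight (X Y : C) : Susp (X ⊗ Y) ⟶ Susp X ⊗ Y := (α_ _ X Y).inv

/-- `Σ (X ⊗ Y) ≅ X ⊗ Σ Y`. -/
def suspTensorLeft (X Y : C) : Susp (X ⊗ Y) ⟶ X ⊗ Susp Y :=
  (α_ _ X Y).inv ≫ (β_ (unitSusp C) X).hom ▷ Y ≫ (α_ X _ Y).hom

end

/-! ### Homotopy classes of maps -/

section

variable {C : Type u} [Category.{v} C] [ModelCategory C]

/-- Homotopy classes of maps, i.e. morphisms in the homotopy category. -/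
abbrev HoHom (V Y : C) := (toHo C).obj V ⟶ (toHo C).obj Y

instance isIso_toHo_map {V Y : C} (f : V ⟶ Y) [h : WeakEquivalence f] :
    IsIso ((toHo C).map f) :=
  Localization.inverts (toHo C) (weakEquivalences C) f ((weakEquivalence_iff f).1 h)

/-- The zero class. -/
def hoZero [HasZeroMorphisms C] (V Y : C) : HoHom V Y := (toHo C).map 0

/-- `z = x + y` for classes of maps from a cofibrant object `V` of a stable model category: `z` is
the composition of the diagonal `V ⟶ V ∨ V`, where the coproduct `V ∨ V` is also a product
in the homotopy category, with the map `(x, y)` on `V ∨ V`. -/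
def IsSum [HasZeroMorphisms C] {V Y : C} (x y z : HoHom V Y) : Prop :=
  ∃ (δ : HoHom V (V ⨿ V)) (h : HoHom (V ⨿ V) Y),
    δ ≫ (toHo C).map (coprod.desc (𝟙 V) 0) = 𝟙 _ ∧
    δ ≫ (toHo C).map (coprod.desc 0 (𝟙 V)) = 𝟙 _ ∧
    (toHo C).map coprod.inl ≫ h = x ∧ (toHo C).map coprod.inr ≫ h = y ∧ δ ≫ h = z

/-- `w` is the (derived) smash product of the classes `x` and `y`, for cofibrant `V`, `W`, `Y`, `Z`.
It is computed by representing `x` and `y` by maps to fibrant replacements of `Y` and `Z`. -/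
def IsSmash [MonoidalCategory C] {V W Y Z : C} (x : HoHom V Y) (y : HoHom W Z)
    (w : HoHom (V ⊗ W) (Y ⊗ Z)) : Prop :=
  ∃ (Y' Z' : C) (i : Y ⟶ Y') (j : Z ⟶ Z') (x' : V ⟶ Y') (y' : W ⟶ Z'),
    IsFibrant Y' ∧ IsFibrant Z' ∧ Cofibration i ∧ WeakEquivalence i ∧
    Cofibration j ∧ WeakEquivalence j ∧
    (toHo C).map x' = x ≫ (toHo C).map i ∧ (toHo C).map y' = y ≫ (toHo C).map j ∧
    w ≫ (toHo C).map (i ⊗ₘ j) = (toHo C).map (x' ⊗ₘ y')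

end

/-! ### Homotopy cofibers -/

section Cofiber

variable {C : Type u} [Category.{v} C] [ModelCategory C]

/-- A cofibrant replacement of the source of a morphism. -/
def cofSrc (P : C) : C := CofibrantObject.HoCat.resolutionObj P

/-- The trivial fibration from the cofibrant replacement. -/
def cofSrcProj (P : C) : cofSrc P ⟶ P := CofibrantObject.HoCat.pResolutionObj P

instance (P : C) : IsCofibrant (cofSrc P) :=
  inferInstanceAs (IsCofibrant (CofibrantObject.HoCat.resolutionObj P))

instance (P : C) : WeakEquivalence (cofSrcProj P) :=
  inferInstanceAs (WeakEquivalence (CofibrantObject.HoCat.pResolutionObj P))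

variable {P R : C} (g : P ⟶ R)

/-- A factorization of `cofSrc P ⟶ P ⟶ R` as a cofibration followed by a trivial fibration. -/
def cofFac : MorphismProperty.MapFactorizationData (cofibrations C) (trivialFibrations C)
    (cofSrcProj P ≫ g) :=
  MorphismProperty.factorizationData _ _ _

/-- A cofibrant replacement of the target of `g`, under the one of the source. -/
def cofTgt : C := (cofFac g).Z

/-- The cofibration between cofibrant objects which replaces `g`. -/
def cofIncl : cofSrc P ⟶ cofTgt g := (cofFac g).i

/-- The trivial fibration from the cofibrant replacement of the target. -/
def cofTgtProj : cofTgt g ⟶ R := (cofFac g).p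

instance : WeakEquivalence (cofTgtProj g) :=
  inferInstanceAs (WeakEquivalence (cofFac g).p)

variable [HasZeroMorphisms C]

/-- The homotopy cofiber of `g`, as the quotient of a cofibration between cofibrant objects
that replaces `g`. -/
def Quo : C := cokernel (cofIncl g)

/-- The projection to the quotient. -/
def quoProj : cofTgt g ⟶ Quo g := cokernel.π _

variable [MonoidalCategory C] [SymmetricCategory C] [TopologicalStructure C]

/-- The homotopy cofiber of `g`, as a mapping cone. -/
def Cofib : C := pushout (cofIncl g) (coneBase (cofSrc P))

/-- The map from the target of `g` to the homotopy cofiber, in the homotopy category. -/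
def hoToCofib : HoHom R (Cofib g) :=
  inv ((toHo C).map (cofTgtProj g)) ≫ (toHo C).map (pushout.inl _ _)

/-- The comparison map (a weak equivalence) between the two models of the homotopy cofiber:
collapse the cone. -/
def cofibToQuo : Cofib g ⟶ Quo g :=
  pushout.desc (quoProj g) 0 (by rw [comp_zero]; exact cokernel.condition _)

variable [MonoidalClosed C] [HasZeroObject C]

/-- Collapse of the target in the mapping cone. The cone coordinate is reversed, so that for a map
of pairs `(C W, W) ⟶ (R, P)` the class on `Σ W` that it defines is mapped to the suspension of its
restriction to `W`. -/
def cofibToSusp : Cofib g ⟶ Susp (cofSrc P) :=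
  pushout.desc 0 (coneToSuspRev _) (by rw [coneBase_toSuspRev, comp_zero])

variable [StableStructure C]

/-- The suspension of a class of maps from a cofibrant object. -/
def hoSusp {V Y : C} [IsCofibrant V] (y : HoHom V Y) :
    (toHo C).obj (Susp V) ⟶ (StableStructure.susp (C := C)).obj ((toHo C).obj Y) :=
  (StableStructure.suspIso (C := C)).inv.app (CofibrantObject.mk V) ≫
    (StableStructure.susp (C := C)).map y

/-- The connecting morphism `κ` from the homotopy cofiber of `g : P ⟶ R` to the suspension of
`P`. -/
def hoConn : (toHo C).obj (Cofib g) ⟶ (StableStructure.susp (C := C)).obj ((toHo C).obj P) :=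
  (toHo C).map (cofibToSusp g) ≫ hoSusp ((toHo C).map (cofSrcProj P))

end Cofiber

/-! ### Filtered objects and their spectral sequences -/

section Filtered

variable (C : Type u) [Category.{v} C] [ModelCategory C]

/-- A tower of fibrations `X₀ ← X₁ ← X₂ ← ⋯` of fibrant objects. -/
structure FilteredObject where
  tower : ℕᵒᵖ ⥤ C
  isFibrant : IsFibrant (tower.obj (op 0))
  fibration (n : ℕ) : Fibration (tower.map (homOfLE n.le_succ).op)

variable {C}

namespace FilteredObject

variable (X : FilteredObject C)

/-- The `n`th stage, extended to all integers by `Xₙ = X₀` for `n ≤ 0`. -/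
def obj (n : ℤ) : C := X.tower.obj (op n.toNat)

/-- The structure map `Xₙ ⟶ Xₘ` for `m ≤ n`. -/
def map {m n : ℤ} (h : m ≤ n) : X.obj n ⟶ X.obj m :=
  X.tower.map (homOfLE (Int.toNat_le_toNat h)).op

/-- The structure map `X_f ⟶ X₀`. -/
def toBase (f : ℤ) : X.obj f ⟶ X.obj 0 :=
  X.tower.map (homOfLE (show (0 : ℤ).toNat ≤ f.toNat from Nat.zero_le _)).op

/-- The map `X_{f+1} ⟶ X_f`. -/
def step (f : ℤ) : X.obj (f + 1) ⟶ X.obj f := X.map (by lia)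

variable [HasZeroMorphisms C] [MonoidalCategory C] [SymmetricCategory C] [TopologicalStructure C]

/-- The layer `X_{f,1} = X_f / X_{f+1}` (a homotopy cofiber). -/
def layer (f : ℤ) : C := Cofib (X.step f)

/-- The projection `p : X_f ⟶ X_{f,1}`. -/
def p (f : ℤ) : HoHom (X.obj f) (X.layer f) := hoToCofib (X.step f)

/-- The `d_{r-1}`-boundaries (the union of the images of `d₁, …, d_{r-1}`) in `π (X_{f,1})`:
the classes that lift to a class in the kernel of `π (X_f) ⟶ π (X_{f-r+1})`. -/
def boundaries (V : C) (f : ℤ) (r : ℕ) : Set (HoHom V (X.layer f)) :=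
  {x | ∃ (h : f - r + 1 ≤ f) (y : HoHom V (X.obj f)),
    y ≫ (toHo C).map (X.map h) = hoZero _ _ ∧ y ≫ X.p f = x}

variable [MonoidalClosed C] [HasZeroObject C] [StableStructure C]

/-- The connecting morphism `κ : X_{f,1} ⟶ Σ X_{f+1}`. -/
def κ (f : ℤ) : (toHo C).obj (X.layer f) ⟶
    (StableStructure.susp (C := C)).obj ((toHo C).obj (X.obj (f + 1))) := hoConn (X.step f)

/-- The `d_{r-1}`-cycles in `π (X_{f,1})`: the classes `x` such that `κ x` lifts to `Σ X_{f+r}`. -/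
def cycles (V : C) (f : ℤ) (r : ℕ) : Set (HoHom V (X.layer f)) :=
  {x | ∃ (h : f + 1 ≤ f + r)
    (y : (toHo C).obj V ⟶ (StableStructure.susp (C := C)).obj ((toHo C).obj (X.obj (f + r)))),
    y ≫ (StableStructure.susp (C := C)).map ((toHo C).map (X.map h)) = x ≫ X.κ f}

/-- The page `E_r` in filtration `f` (for `r ≥ 1`), for homotopy classes of maps from the cofibrant
object `V`: the cycles modulo the boundaries. -/
def Page (V : C) (f : ℤ) (r : ℕ) : Type (max u v) :=
  Quot (fun x y : X.cycles V f r => ∃ b ∈ X.boundaries V f r, IsSum y.1 b x.1)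

variable {X}

namespace Page

variable {V : C} {f : ℤ} {r : ℕ}

/-- `e` is the class of the element `x` of `π (X_{f,1})`. -/
def IsClassOf (e : X.Page V f r) (x : HoHom V (X.layer f)) : Prop :=
  ∃ h : x ∈ X.cycles V f r, e = Quot.mk _ ⟨x, h⟩

/-- `e` detects `α ∈ π (X₀)`: some lift of `α` to `π (X_f)` projects to a representative of `e`. In
other words, `e` is a permanent cycle that converges to `α`. -/
def Detects (e : X.Page V f r) (α : HoHom V (X.obj 0)) : Prop :=
  ∃ y : HoHom V (X.obj f), y ≫ (toHo C).map (X.toBase f) = α ∧ e.IsClassOf (y ≫ X.p f)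

/-- `e` is a permanent cycle: it is represented by a class that lifts to `π (X_f)`. -/
def IsPermanent (e : X.Page V f r) : Prop :=
  ∃ y : HoHom V (X.obj f), e.IsClassOf (y ≫ X.p f)

/-- `d_r e = e'`. For a representative `x` of `e`, the class `κ x` is (the suspension of) the image
in `π (X_{f+1})` of some `y ∈ π (X_{f+r})`, and `e'` is the class of the projection of `y`. -/
def IsDiff {W : C} [IsCofibrant W] {k : ℤ} (e : X.Page (Susp W) f r) (e' : X.Page W k r) : Prop :=
  k = f + r ∧ ∃ (h : f + 1 ≤ k) (x : HoHom (Susp W) (X.layer f)) (y : HoHom W (X.obj k)),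
    e.IsClassOf x ∧ x ≫ X.κ f = hoSusp (y ≫ (toHo C).map (X.map h)) ∧ e'.IsClassOf (y ≫ X.p k)

end Page

/-- The crossing differential hypothesis at the `E_r`-page in filtration `f` and in the stem of `W`:
for `0 ≤ m ≤ f - r - 1`, all elements of `E_{f-m+1}` in filtration `m`, one stem above that
of `W`, are permanent cycles. -/
def CrossingHypothesis (X : FilteredObject C) (W : C) (f : ℕ) (r : ℕ) : Prop :=
  ∀ m : ℕ, m + r + 1 ≤ f → ∀ e : X.Page (Susp W) m (f - m + 1), e.IsPermanent

end FilteredObject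

/-! ### Pairings -/

variable [MonoidalCategory C]

/-- A pairing `X' ⊗ X ⟶ Y` of filtered objects. -/
structure Pairing (X' X Y : FilteredObject C) where
  app (m n : ℕ) : X'.tower.obj (op m) ⊗ X.tower.obj (op n) ⟶ Y.tower.obj (op (m + n))
  naturality {m m' n n' : ℕ} (hm : m ≤ m') (hn : n ≤ n') :
    (X'.tower.map (homOfLE hm).op ⊗ₘ X.tower.map (homOfLE hn).op) ≫ app m n =
      app m' n' ≫ Y.tower.map (homOfLE (add_le_add hm hn)).op

/-- Associativity `μ (μ' ⊗ 1) = μ'' (1 ⊗ μ)` of pairings `μ : X' ⊗ X ⟶ X`,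
`μ' : X'' ⊗ X' ⟶ X'` and `μ'' : X'' ⊗ X ⟶ X`. -/
def Pairing.IsAssociative {X X' X'' : FilteredObject C} (μ : Pairing X' X X)
    (μ' : Pairing X'' X' X') (μ'' : Pairing X'' X X) : Prop :=
  ∀ k m n : ℕ,
    μ'.app k m ▷ X.tower.obj (op n) ≫ μ.app (k + m) n =
      (α_ _ _ _).hom ≫ X''.tower.obj (op k) ◁ μ.app m n ≫ μ''.app k (m + n) ≫
        X.tower.map (homOfLE (add_assoc k m n).le).op

namespace Pairing

variable {X' X Y : FilteredObject C} (μ : Pairing X' X Y)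

/-- The induced map `X'_m ⊗ X_n ⟶ Y_k` for integers `k ≤ m + n`. -/
def app' {m n k : ℤ} (h : k ≤ m + n) : X'.obj m ⊗ X.obj n ⟶ Y.obj k :=
  μ.app m.toNat n.toNat ≫ Y.tower.map (homOfLE (by lia)).op

/-- `γ` is the product in `π (Y_k)` of `α' ∈ π (X'_m)` and `α ∈ π (X_n)`, the class of
`V' ⊗ V ⟶ X'_m ⊗ X_n ⟶ Y_k`, for cofibrant `V'` and `V`. -/
def IsProd {V' V : C} {m n k : ℤ} (h : k ≤ m + n) (α' : HoHom V' (X'.obj m))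
    (α : HoHom V (X.obj n)) (γ : HoHom (V' ⊗ V) (Y.obj k)) : Prop :=
  ∃ (x' : V' ⟶ X'.obj m) (x : V ⟶ X.obj n),
    (toHo C).map x' = α' ∧ (toHo C).map x = α ∧ (toHo C).map ((x' ⊗ₘ x) ≫ μ.app' h) = γ

variable [HasZeroMorphisms C]

/-- `ν` is a pairing `X'_m / X'_{m+1} ⊗ X_n / X_{n+1} ⟶ Y_k / Y_{k+1}` induced by `μ`: for the
cofibrations `A' ⟶ B'`, `A ⟶ B`, `A'' ⟶ B''` that replace `X'_{m+1} ⟶ X'_m`,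
`X_{n+1} ⟶ X_n`, `Y_{k+1} ⟶ Y_k`, it comes from a map `B' ⊗ B ⟶ B''` over `μ` with a compatible map
`A' ⊗ B ∪ B' ⊗ A ⟶ A''` over `μ`. -/
def IsQuoPairing {m n k : ℤ} (h : k ≤ m + n)
    (ν : Quo (X'.step m) ⊗ Quo (X.step n) ⟶ Quo (Y.step k)) : Prop :=
  ∃ (b : cofTgt (X'.step m) ⊗ cofTgt (X.step n) ⟶ cofTgt (Y.step k))
    (a₁ : cofSrc (X'.obj (m + 1)) ⊗ cofTgt (X.step n) ⟶ cofSrc (Y.obj (k + 1)))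
    (a₂ : cofTgt (X'.step m) ⊗ cofSrc (X.obj (n + 1)) ⟶ cofSrc (Y.obj (k + 1))),
    b ≫ cofTgtProj (Y.step k) =
      (cofTgtProj (X'.step m) ⊗ₘ cofTgtProj (X.step n)) ≫ μ.app' h ∧
    a₁ ≫ cofSrcProj (Y.obj (k + 1)) =
      (cofSrcProj (X'.obj (m + 1)) ⊗ₘ cofTgtProj (X.step n)) ≫ μ.app' (by lia) ∧
    a₂ ≫ cofSrcProj (Y.obj (k + 1)) =
      (cofTgtProj (X'.step m) ⊗ₘ cofSrcProj (X.obj (n + 1))) ≫ μ.app' (by lia) ∧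
    a₁ ≫ cofIncl (Y.step k) = cofIncl (X'.step m) ▷ _ ≫ b ∧
    a₂ ≫ cofIncl (Y.step k) = _ ◁ cofIncl (X.step n) ≫ b ∧
    _ ◁ cofIncl (X.step n) ≫ a₁ = cofIncl (X'.step m) ▷ _ ≫ a₂ ∧
    (quoProj (X'.step m) ⊗ₘ quoProj (X.step n)) ≫ ν = b ≫ quoProj (Y.step k)

variable [SymmetricCategory C] [TopologicalStructure C]

/-- `z ∈ π (Y_{k,1})` is the product of `x' ∈ π (X'_{m,1})` and `x ∈ π (X_{n,1})`. -/
def IsLayerProd {V' V : C} {m n k : ℤ} (h : k ≤ m + n) (x' : HoHom V' (X'.layer m))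
    (x : HoHom V (X.layer n)) (z : HoHom (V' ⊗ V) (Y.layer k)) : Prop :=
  ∃ (ν : Quo (X'.step m) ⊗ Quo (X.step n) ⟶ Quo (Y.step k))
    (w : HoHom (V' ⊗ V) (Quo (X'.step m) ⊗ Quo (X.step n))),
    μ.IsQuoPairing h ν ∧
    IsSmash (x' ≫ (toHo C).map (cofibToQuo (X'.step m)))
      (x ≫ (toHo C).map (cofibToQuo (X.step n))) w ∧
    z ≫ (toHo C).map (cofibToQuo (Y.step k)) = w ≫ (toHo C).map ν

variable [MonoidalClosed C] [HasZeroObject C] [StableStructure C]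

/-- The element `e` of the `E_r`-page of `Y` is the product of the elements `a'` and `a` of the
`E_r`-pages of `X'` and `X`. -/
def IsPageProd {V' V : C} {m n k : ℤ} {r : ℕ} (h : k = m + n) (a' : X'.Page V' m r)
    (a : X.Page V n r) (e : Y.Page (V' ⊗ V) k r) : Prop :=
  ∃ (x' : HoHom V' (X'.layer m)) (x : HoHom V (X.layer n))
    (z : HoHom (V' ⊗ V) (Y.layer k)),
    a'.IsClassOf x' ∧ a.IsClassOf x ∧ μ.IsLayerProd h.le x' x z ∧ e.IsClassOf z

end Pairing

/-! ### Brackets -/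

section Brackets

variable [HasZeroMorphisms C] [SymmetricCategory C] [TopologicalStructure C]
  [MonoidalClosed C] [HasZeroObject C]
  {X X' X'' : FilteredObject C} (μ : Pairing X' X X) (μ' : Pairing X'' X' X')
  (μ'' : Pairing X'' X X) {T T' T'' : C}

/-- The Toda bracket `⟨α, α', α''⟩ ⊆ π (X₀)` of classes in `π (X₀)`, `π (X'₀)`, `π (X''₀)`, in the
degrees of `T`, `T'`, `T''`. For representatives `x`, `x'`, `x''` and null homotopies
`F` of `x' x'' : T'' ⊗ T' ⟶ X'₀` and `G` of `x x' : T' ⊗ T ⟶ X₀`, the map `φ` is given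
by `x F` on the first cone and by `G x''` on the second cone on `T'' ⊗ T' ⊗ T`. -/
def TodaBracket (α : HoHom T (X.obj 0)) (α' : HoHom T' (X'.obj 0)) (α'' : HoHom T'' (X''.obj 0)) :
    Set (HoHom (Susp ((T'' ⊗ T') ⊗ T)) (X.obj 0)) :=
  {ζ | ∃ (x : T ⟶ X.obj 0) (x' : T' ⟶ X'.obj 0) (x'' : T'' ⟶ X''.obj 0)
      (F : Cone (T'' ⊗ T') ⟶ X'.obj 0) (G : Cone (T' ⊗ T) ⟶ X.obj 0)
      (φ : DoubleCone ((T'' ⊗ T') ⊗ T) ⟶ X.obj 0),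
    (toHo C).map x = α ∧ (toHo C).map x' = α' ∧ (toHo C).map x'' = α'' ∧
    coneBase _ ≫ F = (x'' ⊗ₘ x') ≫ μ'.app' le_rfl ∧
    coneBase _ ≫ G = (x' ⊗ₘ x) ≫ μ.app' le_rfl ∧
    pushout.inl _ _ ≫ φ = coneTensorRight (T'' ⊗ T') T ≫ (F ⊗ₘ x) ≫ μ.app' le_rfl ∧
    pushout.inr _ _ ≫ φ = unitCone C ◁ (α_ T'' T' T).hom ≫ coneTensorLeft T'' (T' ⊗ T) ≫
      (x'' ⊗ₘ G) ≫ μ''.app' le_rfl ∧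
    (toHo C).map (doubleConeToSusp _) ≫ ζ = (toHo C).map φ}

variable [SymmetricMonoidalModelCategory C] [StableStructure C]
  [IsCofibrant T] [IsCofibrant T'] [IsCofibrant T'']

/-- The product `a' a` in the `E_r`-page is hit by `d_r` (i.e. it is zero in the `E_{r+1}`-page). -/
def Pairing.ProdIsHit {Y : FilteredObject C} (ν : Pairing X' X Y) {m n : ℤ} {r : ℕ}
    (a' : X'.Page T' m r) (a : X.Page T n r) : Prop :=
  ∃ (e : Y.Page (T' ⊗ T) (m + n) r) (b : Y.Page (Susp (T' ⊗ T)) (m + n - r) r),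
    ν.IsPageProd rfl a' a e ∧ b.IsDiff e

/-- The Massey product `⟨a, a', a''⟩ ⊆ E_{r+1} (X)`: the classes of `a b' - b a''`, where
`d_r b' = a' a''` and `d_r b = a a'` in the `E_r`-pages. Here `u` represents the product of
`b'` and `a`, and `v` represents the product of `a''` and `b`. -/
def MasseyProduct {l m n : ℤ} {r : ℕ} (a : X.Page T l r) (a' : X'.Page T' m r)
    (a'' : X''.Page T'' n r) :
    Set (X.Page (Susp ((T'' ⊗ T') ⊗ T)) (l + m + n - r) (r + 1)) :=
  {c | ∃ (b' : X'.Page (Susp (T'' ⊗ T')) (n + m - r) r) (b : X.Page (Susp (T' ⊗ T)) (m + l - r) r)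
      (e' : X'.Page (T'' ⊗ T') (n + m) r) (e : X.Page (T' ⊗ T) (m + l) r)
      (u : HoHom (Susp (T'' ⊗ T') ⊗ T) (X.layer (l + m + n - r)))
      (v : HoHom (T'' ⊗ Susp (T' ⊗ T)) (X.layer (l + m + n - r)))
      (w : HoHom (Susp ((T'' ⊗ T') ⊗ T)) (X.layer (l + m + n - r))),
    μ'.IsPageProd rfl a'' a' e' ∧ b'.IsDiff e' ∧ μ.IsPageProd rfl a' a e ∧ b.IsDiff e ∧
    (∃ p : X.Page _ (l + m + n - r) r, μ.IsPageProd (by lia) b' a p ∧ p.IsClassOf u) ∧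
    (∃ p : X.Page _ (l + m + n - r) r, μ''.IsPageProd (by lia) a'' b p ∧ p.IsClassOf v) ∧
    IsSum w ((toHo C).map (unitSusp C ◁ (α_ T'' T' T).hom ≫ suspTensorLeft T'' (T' ⊗ T)) ≫ v)
      ((toHo C).map (suspTensorRight (T'' ⊗ T') T) ≫ u) ∧
    c.IsClassOf w}

end Brackets

end Filtered

end TodaMassey

end

noncomputable section

set_option linter.unusedSectionVars false

open Simplicial

namespace TodaMassey

section

/-! ### Paths and Serre fibrations of Delta-generated spaces -/

/-! Represent `a`, `a'`, `a''` by maps `x`, `x'`, `x''` into `X_l`, `X'_m`, `X''_n` lying over `α`,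
`α'`, `α''`. The point is to find the null homotopies of the Toda bracket as high in the towers as
the differentials allow: `G` of the product of `x'` and `x` in `X_{m+l-r}`, and `F` of the product
of `x''` and `x'` in `X'_{n+m-r}`. Read as maps of pairs from (cone, base) to two consecutive
stages, `G` and `F` define classes `b` and `b'` in the layers. The connecting map sends such a class
to the suspension of its restriction to the base (`IsPairMap.comp_hoConn`), so `d_r b = aa'` and
`d_r b' = a'a''`. By associativity, the products of `F` with `x` and of `x''` with `G` agree on the
base and glue to a map from a double cone to `X_{l+m+n-r}`. Its image in `X_0` lies in the Toda
bracket. Its projection to the layer is the difference of the classes of the two cones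
(`IsPairMap.toHo_map_doubleCone`), which represents `ab' - ba''`.

That the null homotopies exist so high is `FilteredObject.Page.IsDiff.comp_mapNat_eq_zero`. Let `z`
in filtration `f` vanish in `X_0` and represent an element hit by `d_r`. The differential provides
`y` with the same class on the page and with zero image in `X_{f-r}`. After changing `z` by a class
that vanishes in `X_{f-r+1}`, the difference comes from some `δ` in `X_{f+1}`, which is zero in
`X_0`. If `δ` is zero in `X_i`, a null homotopy gives a cycle in filtration `i` whose image under
`κ` is the suspended image of `δ` in `X_{i+1}`. The crossing hypothesis makes it a permanent cycle,
so this image vanishes too, and one climbs up to `X_{f-r}`.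

The remaining work derives the homotopy theory from the axioms. Stability turns the comultiplication
of suspensions into a preadditive structure on `Ho C`. Rotating a double cone
(`toHo_map_doubleConeToSuspRev`) gives the counit law, the formula for `κ` and the Puppe exactness
`exists_lift_of_comp_hoToCofib_eq_zero`. The pushout-product axiom gives the pairings of layers
(`Pairing.exists_isQuoPairing`). -/

/-- The singular `1`-simplex of a path. -/
def pathSimplex {X : TopCat.{v}} (γ : C(unitInterval, X)) : Δ[1] ⟶ TopCat.toSSet.obj X :=
  SSet.yonedaEquiv.symm ((X.toSSetObjEquiv (op ⦋1⦌)).symm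
    (γ.comp ⟨stdSimplexHomeomorphUnitInterval, stdSimplexHomeomorphUnitInterval.continuous⟩))

/-- The path of a singular `1`-simplex. -/
def simplexPath {X : TopCat.{v}} (s : Δ[1] ⟶ TopCat.toSSet.obj X) : C(unitInterval, X) :=
  (X.toSSetObjEquiv (op ⦋1⦌) (SSet.yonedaEquiv s)).comp
    ⟨stdSimplexHomeomorphUnitInterval.symm, stdSimplexHomeomorphUnitInterval.symm.continuous⟩

/-- The singular `0`-simplex of a point. -/
def ptSimplex {X : TopCat.{v}} (x : X) : Δ[0] ⟶ TopCat.toSSet.obj X :=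
  SSet.yonedaEquiv.symm ((X.toSSetObjEquiv (op ⦋0⦌)).symm (ContinuousMap.const _ x))

lemma simplexPath_pathSimplex {X : TopCat.{v}} (γ : C(unitInterval, X)) :
    simplexPath (pathSimplex γ) = γ := by
  ext t
  simp [simplexPath, pathSimplex]

lemma simplexPath_comp {X Y : TopCat.{v}} (s : Δ[1] ⟶ TopCat.toSSet.obj X) (p : X ⟶ Y)
    (t : unitInterval) :
    simplexPath (s ≫ TopCat.toSSet.map p) t = p (simplexPath s t) := rfl

lemma ptSimplex_comp {X Y : TopCat.{v}} (x : X) (p : X ⟶ Y) :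
    ptSimplex x ≫ TopCat.toSSet.map p = ptSimplex (p x) := by
  apply SSet.yonedaEquiv.injective
  simp [ptSimplex]
  rfl

lemma ptSimplex_injective {X : TopCat.{v}} {x y : X} (h : ptSimplex x = ptSimplex y) : x = y := by
  have := (X.toSSetObjEquiv (op ⦋0⦌)).symm.injective (SSet.yonedaEquiv.symm.injective h)
  exact ContinuousMap.congr_fun this default

/-- The face `δ 1` omits the vertex `1`, so it picks out the vertex `0`, which corresponds to the
parameter `0` of the interval. -/
lemma simplexPath_zero {X : TopCat.{v}} (s : Δ[1] ⟶ TopCat.toSSet.obj X) :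
    SSet.stdSimplex.δ 1 ≫ s = ptSimplex (simplexPath s 0) := by
  apply SSet.yonedaEquiv.injective
  apply (X.toSSetObjEquiv (op ⦋0⦌)).injective
  ext z
  obtain rfl := Subsingleton.elim z (stdSimplex.vertex (S := ℝ) (0 : Fin 1))
  have h : stdSimplexHomeomorphUnitInterval.symm 0 = stdSimplex.vertex (S := ℝ) (0 : Fin 2) := by
    rw [Homeomorph.symm_apply_eq]; rfl
  simp only [ptSimplex, simplexPath, Equiv.apply_symm_apply, ContinuousMap.const_apply,
    ContinuousMap.comp_apply, ContinuousMap.coe_mk, h]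
  refine Eq.trans ?_ (congrArg (X.toSSetObjEquiv (op ⦋1⦌) (SSet.yonedaEquiv s))
    (stdSimplex.map_vertex (S := ℝ) (SimplexCategory.δ (1 : Fin 2)).toOrderHom (0 : Fin 1)))
  have := SSet.yonedaEquiv_naturality (SimplexCategory.δ (1 : Fin 2)) s
  exact congrArg (fun z => X.toSSetObjEquiv (op ⦋0⦌) z (stdSimplex.vertex (0 : Fin 1))) this.symm

lemma simplexPath_one {X : TopCat.{v}} (s : Δ[1] ⟶ TopCat.toSSet.obj X) :
    SSet.stdSimplex.δ 0 ≫ s = ptSimplex (simplexPath s 1) := by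
  apply SSet.yonedaEquiv.injective
  apply (X.toSSetObjEquiv (op ⦋0⦌)).injective
  ext z
  obtain rfl := Subsingleton.elim z (stdSimplex.vertex (S := ℝ) (0 : Fin 1))
  have h : stdSimplexHomeomorphUnitInterval.symm 1 = stdSimplex.vertex (S := ℝ) (1 : Fin 2) := by
    rw [Homeomorph.symm_apply_eq]; rfl
  simp only [ptSimplex, simplexPath, Equiv.apply_symm_apply, ContinuousMap.const_apply,
    ContinuousMap.comp_apply, ContinuousMap.coe_mk, h]
  refine Eq.trans ?_ (congrArg (X.toSSetObjEquiv (op ⦋1⦌) (SSet.yonedaEquiv s))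
    (stdSimplex.map_vertex (S := ℝ) (SimplexCategory.δ (0 : Fin 2)).toOrderHom (0 : Fin 1)))
  have := SSet.yonedaEquiv_naturality (SimplexCategory.δ (0 : Fin 2)) s
  exact congrArg (fun z => X.toSSetObjEquiv (op ⦋0⦌) z (stdSimplex.vertex (0 : Fin 1))) this.symm

/-- The underlying topological space. -/
abbrev topOf (X : DeltaGenerated.{v}) : TopCat.{v} := DeltaGenerated.deltaGeneratedToTop.obj X

/-- The underlying continuous map. -/
abbrev topMap {X Y : DeltaGenerated.{v}} (f : X ⟶ Y) : topOf X ⟶ topOf Y :=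
  DeltaGenerated.deltaGeneratedToTop.map f

open SSet.modelCategoryQuillen in
/-- Path lifting for Serre fibrations. -/
lemma exists_path_lift {E B : DeltaGenerated.{v}} {p : E ⟶ B} (hp : serreFibrations p)
    (e : topOf E) (γ : C(unitInterval, topOf B)) (h : γ 1 = topMap p e) :
    ∃ γ' : C(unitInterval, topOf E), γ' 1 = e ∧ ∀ t, topMap p (γ' t) = γ t := by
  have hf : Fibration (TopCat.toSSet.map (topMap p)) := by
    rw [fibration_iff]; exact hp
  -- The horn `Λ[1, 1]` is the single vertex `1`, the image of `δ 0`.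
  obtain ⟨φ, h1, h2⟩ := SSet.horn.IsCompatible.exists_lift (n := 0) (i := 1)
    (f := fun j hj => ptSimplex e) (by simp) (TopCat.toSSet.map (topMap p)) (pathSimplex γ) (by
      intro j hj
      obtain rfl : j = 0 := by grind
      rw [ptSimplex_comp, simplexPath_one, simplexPath_pathSimplex, h])
  refine ⟨simplexPath φ, ?_, fun t => ?_⟩
  · have := h1 0 (by simp)
    rw [simplexPath_one] at this
    exact ptSimplex_injective this
  · rw [← simplexPath_comp, h2, simplexPath_pathSimplex]


/-- The map from the boundary of the `1`-simplex given by two vertices. -/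
def boundaryDesc {X : SSet.{v}} (x y : X _⦋0⦌) : (∂Δ[1] : SSet.{v}) ⟶ X where
  app n := ↾fun s => X.map ((SimplexCategory.const n.unop ⦋0⦌ 0)).op
    (if SSet.stdSimplex.asOrderHom s.1 0 = 0 then x else y)
  naturality := by
    intro n m f
    ext ⟨s, hs⟩
    -- A simplex of the boundary is a non-surjective monotone map to a two-element set, hence
    -- constant; its value at `0` decides to which vertex it belongs.
    have h : ∀ a b, SSet.stdSimplex.asOrderHom s a = SSet.stdSimplex.asOrderHom s b := by
      intro a b
      by_contra hab
      refine hs fun y => ?_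
      by_cases hy : SSet.stdSimplex.asOrderHom s a = y
      · exact ⟨a, hy⟩
      · exact ⟨b, by grind⟩
    have h' : SSet.stdSimplex.asOrderHom (Δ[1].map f s) 0 = SSet.stdSimplex.asOrderHom s 0 :=
      h _ _
    change X.map _ (if SSet.stdSimplex.asOrderHom (Δ[1].map f s) 0 = 0 then x else y) =
      X.map f (X.map _ (if SSet.stdSimplex.asOrderHom s 0 = 0 then x else y))
    rw [h', ← ConcreteCategory.comp_apply, ← X.map_comp]
    rfl

/-- Trivial Serre fibrations are Serre fibrations. -/
lemma trivialSerreFibrations_le : trivialSerreFibrations.{v} ≤ serreFibrations := by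
  intro E B p hp
  have h : (SSet.modelCategoryQuillen.I.{v}).rlp ≤ SSet.modelCategoryQuillen.J.rlp := by
    rw [← SSet.rlp_monomorphisms]
    exact MorphismProperty.antitone_rlp SSet.modelCategoryQuillen.J_le_monomorphisms
  exact h _ hp

/-- Path lifting for trivial Serre fibrations, relative to both endpoints. -/
lemma exists_path_lift_rel {E B : DeltaGenerated.{v}} {p : E ⟶ B} (hp : trivialSerreFibrations p)
    (e₀ e₁ : topOf E) (γ : C(unitInterval, topOf B)) (h₀ : γ 0 = topMap p e₀)
    (h₁ : γ 1 = topMap p e₁) :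
    ∃ γ' : C(unitInterval, topOf E), γ' 0 = e₀ ∧ γ' 1 = e₁ ∧ ∀ t, topMap p (γ' t) = γ t := by
  have : HasLiftingProperty (∂Δ[1] : (Δ[1] : SSet.{v}).Subcomplex).ι
      (TopCat.toSSet.map (topMap p)) := hp _ (SSet.modelCategoryQuillen.boundary_ι_mem_I 1)
  let q : (∂Δ[1] : SSet.{v}) ⟶ TopCat.toSSet.obj (topOf E) :=
    boundaryDesc (SSet.yonedaEquiv (ptSimplex e₀)) (SSet.yonedaEquiv (ptSimplex e₁))
  have q₀ : SSet.boundary.ι 1 ≫ q = ptSimplex e₀ := by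
    apply SSet.yonedaEquiv.injective
    change (TopCat.toSSet.obj (topOf E)).map (SimplexCategory.const ⦋0⦌ ⦋0⦌ 0).op
      (SSet.yonedaEquiv _) = _
    rw [SimplexCategory.const_eq_id, op_id, CategoryTheory.Functor.map_id]
    rfl
  have q₁ : SSet.boundary.ι 0 ≫ q = ptSimplex e₁ := by
    apply SSet.yonedaEquiv.injective
    change (TopCat.toSSet.obj (topOf E)).map (SimplexCategory.const ⦋0⦌ ⦋0⦌ 0).op
      (SSet.yonedaEquiv _) = _
    rw [SimplexCategory.const_eq_id, op_id, CategoryTheory.Functor.map_id]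
    rfl
  have sq : CommSq q (∂Δ[1] : (Δ[1] : SSet.{v}).Subcomplex).ι (TopCat.toSSet.map (topMap p))
      (pathSimplex γ) := ⟨by
    apply SSet.boundary.hom_ext
    intro i
    fin_cases i
    · change SSet.boundary.ι 0 ≫ _ = SSet.boundary.ι 0 ≫ _
      rw [reassoc_of% q₁, ptSimplex_comp, SSet.boundary.ι_ι_assoc, simplexPath_one,
        simplexPath_pathSimplex, h₁]
    · change SSet.boundary.ι 1 ≫ _ = SSet.boundary.ι 1 ≫ _
      rw [reassoc_of% q₀, ptSimplex_comp, SSet.boundary.ι_ι_assoc, simplexPath_zero,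
        simplexPath_pathSimplex, h₀]⟩
  refine ⟨simplexPath sq.lift, ?_, ?_, fun t => ?_⟩
  · apply ptSimplex_injective
    rw [← simplexPath_zero, ← q₀, ← SSet.boundary.ι_ι, Category.assoc, sq.fac_left]
  · apply ptSimplex_injective
    rw [← simplexPath_one, ← q₁, ← SSet.boundary.ι_ι, Category.assoc, sq.fac_left]
  · rw [← simplexPath_comp, sq.fac_right, simplexPath_pathSimplex]

instance deltaGeneratedSpace_punit : DeltaGeneratedSpace PUnit.{v + 1} :=
  (show Topology.IsQuotientMap (fun _ : Fin 0 → ℝ => PUnit.unit.{v + 1}) from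
    Topology.IsQuotientMap.of_inverse (g := fun _ : Fin 0 → ℝ => PUnit.unit.{v + 1})
      (f := fun _ => 0) continuous_const continuous_const (fun _ => rfl)).isGeneratedBy

/-- The point of a space as a morphism. -/
def ptHom {E : DeltaGenerated.{v}} (x : topOf E) : DeltaGenerated.of PUnit.{v + 1} ⟶ E :=
  ConcreteCategory.ofHom (X := DeltaGenerated.of PUnit.{v + 1}) (Y := E) (ContinuousMap.const _ x)

instance : Nonempty (topOf (𝟙_ DeltaGenerated.{v})) :=
  ⟨topMap (CartesianMonoidalCategory.toUnit (DeltaGenerated.of PUnit.{v + 1})) PUnit.unit⟩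

/-- The unit is only known as a terminal object, so its points are compared as morphisms out of the
one-point space, which is why that space has to be Delta-generated. -/
instance : Subsingleton (topOf (𝟙_ DeltaGenerated.{v})) :=
  ⟨fun x y => ConcreteCategory.congr_hom (DeltaGenerated.deltaGeneratedToTop.congr_map
    (CartesianMonoidalCategory.toUnit_unique (ptHom x) (ptHom y))) PUnit.unit⟩

/-- A path as a morphism. -/
def pathHom {E : DeltaGenerated.{v}} (γ : C(unitInterval, topOf E)) : interval.{v} ⟶ E :=
  ConcreteCategory.ofHom (X := DeltaGenerated.of (ULift.{v} unitInterval)) (Y := E)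
    (γ.comp ⟨_, continuous_uliftDown⟩)

/-- The unit is a single point, so a lifting problem against a Serre fibration is a path together
with a lift of its end at time `1`. -/
lemma intervalPt_one_mem : trivialSerreCofibrations.{v} (intervalPt 1) := by
  intro E B p hp
  constructor
  intro f g sq
  let x : topOf (𝟙_ DeltaGenerated.{v}) := Classical.arbitrary _
  obtain ⟨γ', h1, h2⟩ := exists_path_lift hp (topMap f x)
    ((topMap g).hom.comp ⟨_, continuous_uliftUp⟩) (by
      have := ConcreteCategory.congr_hom (DeltaGenerated.deltaGeneratedToTop.congr_map sq.w) x
      exact this.symm)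
  refine ⟨⟨pathHom γ', ?_, ?_⟩⟩
  · ext y
    obtain rfl := Subsingleton.elim x y
    exact h1
  · ext ⟨t⟩
    exact h2 t

/-- The same translation as for one endpoint, with the lifts of both ends prescribed; this needs a
trivial fibration. -/
lemma endpoints_mem : serreCofibrations.{v} (coprod.desc (intervalPt 0) (intervalPt 1)) := by
  intro E B p hp
  constructor
  intro f g sq
  let x : topOf (𝟙_ DeltaGenerated.{v}) := Classical.arbitrary _
  have w₀ := coprod.inl ≫= sq.w
  have w₁ := coprod.inr ≫= sq.w
  simp only [coprod.inl_desc_assoc, coprod.inr_desc_assoc] at w₀ w₁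
  obtain ⟨γ', h0, h1, h2⟩ := exists_path_lift_rel hp (topMap (coprod.inl ≫ f) x)
    (topMap (coprod.inr ≫ f) x)
    ((topMap g).hom.comp ⟨_, continuous_uliftUp⟩)
    (ConcreteCategory.congr_hom (DeltaGenerated.deltaGeneratedToTop.congr_map w₀) x).symm
    (ConcreteCategory.congr_hom (DeltaGenerated.deltaGeneratedToTop.congr_map w₁) x).symm
  refine ⟨⟨pathHom γ', ?_, ?_⟩⟩
  · apply coprod.hom_ext
    · rw [coprod.inl_desc_assoc]
      ext y
      obtain rfl := Subsingleton.elim x y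
      exact h0
    · rw [coprod.inr_desc_assoc]
      ext y
      obtain rfl := Subsingleton.elim x y
      exact h1
  · ext ⟨t⟩
    exact h2 t

/-! ### Self-maps of the interval and maps from the square to the interval -/

section

open CartesianMonoidalCategory

/-- A self-map of the interval. -/
def intervalMap (γ : C(unitInterval, unitInterval)) : interval.{v} ⟶ interval.{v} :=
  ConcreteCategory.ofHom (X := DeltaGenerated.of (ULift.{v} unitInterval))
    (Y := DeltaGenerated.of (ULift.{v} unitInterval))
    ⟨fun t => ULift.up (γ t.down), continuous_uliftUp.comp (γ.continuous.comp continuous_uliftDown)⟩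

/-- A map from the square to the interval. -/
def squareMap (c : C(unitInterval × unitInterval, unitInterval)) :
    interval.{v} ⊗ interval.{v} ⟶ interval.{v} :=
  ConcreteCategory.ofHom (X := interval.{v} ⊗ interval.{v})
    (Y := DeltaGenerated.of (ULift.{v} unitInterval))
    ⟨fun z => ULift.up (c (ULift.down (α := unitInterval) (topMap (fst interval interval) z),
        ULift.down (α := unitInterval) (topMap (snd interval interval) z))),
      continuous_uliftUp.comp (c.continuous.comp
        ((continuous_uliftDown.comp (topMap (fst interval.{v} interval.{v})).hom.continuous).prodMk
          (continuous_uliftDown.comp (topMap (snd interval.{v} interval.{v})).hom.continuous)))⟩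

lemma intervalMap_id : intervalMap.{v} (ContinuousMap.id _) = 𝟙 _ := rfl

lemma intervalMap_symm :
    intervalMap.{v} ⟨unitInterval.symm, unitInterval.continuous_symm⟩ = intervalRev := rfl

lemma intervalMap_const (t : unitInterval) :
    intervalMap.{v} (ContinuousMap.const _ t) = toUnit interval ≫ intervalPt t := rfl

lemma intervalPt_whiskerRight_squareMap (c : C(unitInterval × unitInterval, unitInterval))
    (s : unitInterval) :
    intervalPt.{v} s ▷ interval ≫ squareMap c =
      (λ_ _).hom ≫ intervalMap ⟨fun t => c (s, t), by fun_prop⟩ := by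
  have h₁ : intervalPt.{v} s ▷ interval ≫ fst interval interval = fst _ _ ≫ intervalPt s := by
    simp
  have h₂ : intervalPt.{v} s ▷ interval ≫ snd interval interval = (λ_ _).hom := by
    rw [whiskerRight_snd]; exact (leftUnitor_hom _).symm
  ext z
  have e₁ := ConcreteCategory.congr_hom (DeltaGenerated.deltaGeneratedToTop.congr_map h₁) z
  have e₂ := ConcreteCategory.congr_hom (DeltaGenerated.deltaGeneratedToTop.congr_map h₂) z
  exact congrArg₂ (fun a b => ULift.up (c (ULift.down (α := unitInterval) a,
    ULift.down (α := unitInterval) b))) e₁ e₂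

lemma whiskerLeft_intervalPt_squareMap (c : C(unitInterval × unitInterval, unitInterval))
    (t : unitInterval) :
    interval.{v} ◁ intervalPt.{v} t ≫ squareMap c =
      (ρ_ _).hom ≫ intervalMap ⟨fun s => c (s, t), by fun_prop⟩ := by
  have h₁ : interval ◁ intervalPt.{v} t ≫ fst interval interval = (ρ_ _).hom := by
    rw [whiskerLeft_fst]; exact (rightUnitor_hom _).symm
  have h₂ : interval ◁ intervalPt.{v} t ≫ snd interval interval = snd _ _ ≫ intervalPt t := by simp
  ext z
  have e₁ := ConcreteCategory.congr_hom (DeltaGenerated.deltaGeneratedToTop.congr_map h₁) z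
  have e₂ := ConcreteCategory.congr_hom (DeltaGenerated.deltaGeneratedToTop.congr_map h₂) z
  exact congrArg₂ (fun a b => ULift.up (c (ULift.down (α := unitInterval) a,
    ULift.down (α := unitInterval) b))) e₁ e₂

end

end

section

/-! ### Model categories and their homotopy categories -/

section Lifting

variable {C : Type u} [Category.{v} C] [ModelCategory C]

lemma exists_lift {A B E D : C} (i : A ⟶ B) (p : E ⟶ D) [Cofibration i] [Fibration p]
    [WeakEquivalence p] {f : A ⟶ E} {g : B ⟶ D} (w : f ≫ p = i ≫ g) :
    ∃ l : B ⟶ E, i ≫ l = f ∧ l ≫ p = g :=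
  have sq : CommSq f i p g := ⟨w⟩
  ⟨sq.lift, sq.fac_left, sq.fac_right⟩

lemma exists_lift_of_weakEquivalence {A B E D : C} (i : A ⟶ B) (p : E ⟶ D) [Cofibration i]
    [WeakEquivalence i] [Fibration p] {f : A ⟶ E} {g : B ⟶ D} (w : f ≫ p = i ≫ g) :
    ∃ l : B ⟶ E, i ≫ l = f ∧ l ≫ p = g :=
  have sq : CommSq f i p g := ⟨w⟩
  ⟨sq.lift, sq.fac_left, sq.fac_right⟩

lemma exists_lift_of_isCofibrant {V E D : C} [IsCofibrant V] (p : E ⟶ D) [Fibration p]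
    [WeakEquivalence p] (g : V ⟶ D) : ∃ l : V ⟶ E, l ≫ p = g := by
  obtain ⟨l, -, h⟩ := exists_lift (initial.to V) p (f := initial.to E) (g := g)
    (initialIsInitial.hom_ext _ _)
  exact ⟨l, h⟩

lemma exists_extension_of_isFibrant {A B Y : C} (i : A ⟶ B) [Cofibration i] [WeakEquivalence i]
    [IsFibrant Y] (f : A ⟶ Y) : ∃ l : B ⟶ Y, i ≫ l = f := by
  obtain ⟨l, h, -⟩ := exists_lift_of_weakEquivalence i (terminal.from Y) (f := f)
    (g := terminal.from B) (terminalIsTerminal.hom_ext _ _)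
  exact ⟨l, h⟩

/-- A fibrant replacement. -/
lemma exists_fibrant_replacement (Y : C) : ∃ (Y' : C) (j : Y ⟶ Y'), IsFibrant Y' ∧ Cofibration j ∧
    WeakEquivalence j :=
  ⟨_, FibrantObject.HoCat.iResolutionObj Y, inferInstance, inferInstance, inferInstance⟩

lemma exists_toHo_map_eq {V Y : C} [IsCofibrant V] [IsFibrant Y] (x : HoHom V Y) :
    ∃ f : V ⟶ Y, (toHo C).map f = x :=
  map_surjective_of_isLocalization (toHo C) V Y x

/-- Every object of the homotopy category is the image of a fibrant object. -/
lemma exists_iso_toHo_fibrant (Q : Ho C) :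
    ∃ (Y : C) (_ : IsFibrant Y), Nonempty (Q ≅ (toHo C).obj Y) := by
  obtain ⟨Y, j, h₁, -, h₂⟩ := exists_fibrant_replacement ((toHo C).objPreimage Q)
  exact ⟨Y, h₁, ⟨((toHo C).objObjPreimageIso Q).symm ≪≫ asIso ((toHo C).map j)⟩⟩

/-- Every object of the homotopy category is the image of a cofibrant object. -/
lemma exists_iso_toHo_cofibrant (Q : Ho C) :
    ∃ (V : C) (_ : IsCofibrant V), Nonempty ((toHo C).obj V ≅ Q) :=
  ⟨cofSrc ((toHo C).objPreimage Q), inferInstance,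
    ⟨asIso ((toHo C).map (cofSrcProj _)) ≪≫ (toHo C).objObjPreimageIso Q⟩⟩

/-- The homotopy extension property. -/
lemma exists_extension {A B Y : C} (i : A ⟶ B) [Cofibration i] [IsCofibrant A] [IsFibrant Y]
    {f : A ⟶ Y} {g : B ⟶ Y} (h : (toHo C).map f = (toHo C).map (i ≫ g)) :
    ∃ g' : B ⟶ Y, i ≫ g' = f ∧ (toHo C).map g' = (toHo C).map g := by
  rw [eq_comm, ← RightHomotopyRel.iff_map_eq (toHo C)] at h
  obtain ⟨P, _, ⟨h⟩⟩ := h.exists_good_pathObject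
  obtain ⟨l, H, hH⟩ := h.homotopy_extension i g
  refine ⟨l, by rw [← H.h₁, reassoc_of% hH, h.h₁], ((RightHomotopyRel.factorsThroughLocalization C H.rightHomotopyRel).map_eq
    (toHo C)).symm⟩

/-- Two maps with a common section or retraction which is invertible in the homotopy category
agree there. -/
lemma toHo_map_eq_of_retraction {X Z : C} {i₀ i₁ : X ⟶ Z} {π : Z ⟶ X} [IsIso ((toHo C).map π)]
    (h₀ : i₀ ≫ π = 𝟙 X) (h₁ : i₁ ≫ π = 𝟙 X) : (toHo C).map i₀ = (toHo C).map i₁ := by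
  rw [← cancel_mono ((toHo C).map π), ← Functor.map_comp, ← Functor.map_comp, h₀, h₁]

lemma toHo_map_eq_of_section {X Z : C} {p₀ p₁ : Z ⟶ X} {s : X ⟶ Z} [IsIso ((toHo C).map s)]
    (h₀ : s ≫ p₀ = 𝟙 X) (h₁ : s ≫ p₁ = 𝟙 X) : (toHo C).map p₀ = (toHo C).map p₁ := by
  rw [← cancel_epi ((toHo C).map s), ← Functor.map_comp, ← Functor.map_comp, h₀, h₁]

/-- A Yoneda argument tested on fibrant objects only, which suffices because `B` and `Q` are
isomorphic in the homotopy category to their fibrant replacements. -/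
lemma isIso_toHo_map_of_bijective {B Q : C} (q : B ⟶ Q)
    (hs : ∀ (Y : C) [IsFibrant Y] (x : HoHom B Y), ∃ y : HoHom Q Y, (toHo C).map q ≫ y = x)
    (hi : ∀ (Y : C) [IsFibrant Y] (y₀ y₁ : HoHom Q Y),
      (toHo C).map q ≫ y₀ = (toHo C).map q ≫ y₁ → y₀ = y₁) : IsIso ((toHo C).map q) := by
  obtain ⟨B', j, _, -, _⟩ := exists_fibrant_replacement B
  obtain ⟨Q', j', _, -, _⟩ := exists_fibrant_replacement Q
  obtain ⟨y, hy⟩ := hs B' ((toHo C).map j)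
  refine ⟨y ≫ inv ((toHo C).map j), by rw [reassoc_of% hy, IsIso.hom_inv_id], ?_⟩
  rw [← cancel_mono ((toHo C).map j')]
  apply hi
  simp only [Category.assoc, Category.id_comp]
  rw [reassoc_of% hy, IsIso.hom_inv_id_assoc]

end Lifting

/-! ### Quotients by subobjects, contractible objects and the zero object -/

section Pointed

variable {C : Type u} [Category.{v} C] [HasZeroMorphisms C]

/-- The map `q` is a cokernel of `i`. -/
structure IsCoker {A B Q : C} (i : A ⟶ B) (q : B ⟶ Q) : Prop where
  w : i ≫ q = 0
  exists_desc {Z : C} (f : B ⟶ Z) (h : i ≫ f = 0) : ∃ g : Q ⟶ Z, q ≫ g = f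
  epi : Epi q

lemma isCoker_cokernel {A B : C} (i : A ⟶ B) [HasCokernel i] : IsCoker i (cokernel.π i) where
  w := cokernel.condition i
  exists_desc f h := ⟨cokernel.desc i f h, cokernel.π_desc _ _ _⟩
  epi := inferInstance

lemma IsCoker.of_iso {A A' B B' Q : C} {i : A ⟶ B} {q : B ⟶ Q} (h : IsCoker i q) (a : A' ≅ A)
    (b : B ≅ B') {i' : A' ⟶ B'} {q' : B' ⟶ Q} (hi : i' = a.hom ≫ i ≫ b.hom)
    (hq : b.hom ≫ q' = q) : IsCoker i' q' := by
  obtain rfl : q' = b.inv ≫ q := by rw [← hq, Iso.inv_hom_id_assoc]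
  subst hi
  have := h.epi
  refine ⟨by simp [h.w], fun f hf => ?_, inferInstance⟩
  obtain ⟨g, hg⟩ := h.exists_desc (b.hom ≫ f) (by
    rw [← cancel_epi a.hom]; simpa using hf)
  exact ⟨g, by simp [hg]⟩

/-- Collapsing `D` in `B ∪_A D` leaves `B / A`. With `D` a cone, this collapses one half of a double
cone and compares the mapping cone with the quotient. -/
lemma IsCoker.pushout_desc {A B D Q : C}
    {i : A ⟶ B} {q : B ⟶ Q} (h : IsCoker i q) (j : A ⟶ D) [HasPushout i j] {w} :
    IsCoker (pushout.inr i j) (pushout.desc q 0 w) := by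
  refine ⟨pushout.inr_desc _ _ _, fun f hf => ?_, ?_⟩
  · obtain ⟨g, hg⟩ := h.exists_desc (pushout.inl _ _ ≫ f) (by
      rw [pushout.condition_assoc, hf, comp_zero])
    refine ⟨g, pushout.hom_ext ?_ ?_⟩
    · rw [pushout.inl_desc_assoc, hg]
    · rw [pushout.inr_desc_assoc, hf, zero_comp]
  · have := h.epi
    have : Epi (pushout.inl _ _ ≫ pushout.desc q 0 w) := by rwa [pushout.inl_desc]
    exact epi_of_epi (pushout.inl _ _) _

variable [ModelCategory C] [HasZeroObject C]

open ZeroObject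

lemma isCofibrant_iff_zero (X : C) : IsCofibrant X ↔ Cofibration (0 : (0 : C) ⟶ X) :=
  isCofibrant_iff_of_isInitial _ (isZero_zero C).isInitial

lemma isFibrant_iff_zero (X : C) : IsFibrant X ↔ Fibration (0 : X ⟶ (0 : C)) :=
  isFibrant_iff_of_isTerminal _ (isZero_zero C).isTerminal

instance cofibration_zero (X : C) [h : IsCofibrant X] : Cofibration (0 : (0 : C) ⟶ X) :=
  (isCofibrant_iff_zero X).1 h

instance isCofibrant_zero : IsCofibrant (0 : C) := by
  rw [isCofibrant_iff_zero, (isZero_zero C).eq_of_src 0 (𝟙 _)]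
  infer_instance

instance isFibrant_zero : IsFibrant (0 : C) := by
  rw [isFibrant_iff_zero, (isZero_zero C).eq_of_src 0 (𝟙 _)]
  infer_instance

instance (P : C) : Fibration (cofSrcProj P) :=
  inferInstanceAs (Fibration (CofibrantObject.HoCat.pResolutionObj P))

instance {P R : C} (g : P ⟶ R) : Fibration (cofTgtProj g) :=
  inferInstanceAs (Fibration (cofFac g).p)

instance {P R : C} (g : P ⟶ R) : Cofibration (cofIncl g) :=
  inferInstanceAs (Cofibration (cofFac g).i)

instance {P R : C} (g : P ⟶ R) : IsCofibrant (cofTgt g) :=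
  isCofibrant_of_cofibration (cofIncl g)

omit [HasZeroMorphisms C] [HasZeroObject C] in
lemma cofIncl_comp_cofTgtProj {P R : C} (g : P ⟶ R) :
    cofIncl g ≫ cofTgtProj g = cofSrcProj P ≫ g := (cofFac g).fac

/-- An object is contractible if the map from the zero object is a weak equivalence. -/
abbrev IsContractible (X : C) : Prop := WeakEquivalence (0 : (0 : C) ⟶ X)

/-- A lifting problem for `0 ⟶ Q` is a lifting problem for `i` with the zero map prescribed on `A`,
and a solution of the latter descends to `Q`. -/
lemma IsCoker.cofibration_zero {A B Q : C} {i : A ⟶ B} {q : B ⟶ Q} (h : IsCoker i q)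
    [Cofibration i] : IsCofibrant Q := by
  rw [isCofibrant_iff_zero, cofibration_iff, ← trivialFibrations_llp]
  intro E D p hp
  rw [mem_trivialFibrations_iff] at hp
  obtain ⟨_, _⟩ := hp
  refine ⟨fun {f g} sq => ?_⟩
  obtain ⟨l, h₁, h₂⟩ := exists_lift i p (f := 0) (g := q ≫ g) (by
    rw [reassoc_of% h.w, zero_comp, zero_comp])
  obtain ⟨l', rfl⟩ := h.exists_desc l h₁
  have := h.epi
  exact ⟨⟨l', (isZero_zero C).eq_of_src _ _, by rw [← cancel_epi q, ← h₂, Category.assoc]⟩⟩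

lemma IsCoker.isContractible {A B Q : C} {i : A ⟶ B} {q : B ⟶ Q} (h : IsCoker i q)
    [Cofibration i] [WeakEquivalence i] : IsContractible Q := by
  suffices trivialCofibrations C (0 : (0 : C) ⟶ Q) from (mem_trivialCofibrations_iff _ |>.1 this).2
  rw [← fibrations_llp]
  intro E D p hp
  rw [← fibration_iff] at hp
  refine ⟨fun {f g} sq => ?_⟩
  obtain ⟨l, h₁, h₂⟩ := exists_lift_of_weakEquivalence i p (f := 0) (g := q ≫ g) (by
    rw [reassoc_of% h.w, zero_comp, zero_comp])
  obtain ⟨l', rfl⟩ := h.exists_desc l h₁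
  have := h.epi
  exact ⟨⟨l', (isZero_zero C).eq_of_src _ _, by rw [← cancel_epi q, ← h₂, Category.assoc]⟩⟩

/-- Collapsing a contractible subobject: relative lifting up to homotopy. -/
lemma IsCoker.exists_factor_of_isContractible {A B Q E D : C} {i : A ⟶ B} {q : B ⟶ Q}
    (hq : IsCoker i q) [Cofibration i] [IsCofibrant A] [IsContractible A] (p : E ⟶ D)
    [Fibration p] (f : B ⟶ E) (g : Q ⟶ D) (w : f ≫ p = q ≫ g) :
    ∃ f' : Q ⟶ E, f' ≫ p = g ∧ (toHo C).map (q ≫ f') = (toHo C).map f := by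
  -- A path object of `E` relative to `D`: homotopies in it project to constant ones in `D`.
  let d := MorphismProperty.factorizationData (trivialCofibrations C) (fibrations C)
    (pullback.lift (f := p) (g := p) (𝟙 E) (𝟙 E) rfl)
  let p₀ : d.Z ⟶ E := d.p ≫ pullback.fst p p
  let p₁ : d.Z ⟶ E := d.p ≫ pullback.snd p p
  have e₀ : d.i ≫ p₀ = 𝟙 E := by simp [p₀, pullback.lift_fst]
  have e₁ : d.i ≫ p₁ = 𝟙 E := by simp [p₁, pullback.lift_snd]
  have : WeakEquivalence p₀ := weakEquivalence_of_precomp_of_fac e₀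
  -- As `0 ⟶ A` is a trivial cofibration, the restriction of `f` to `A` is homotopic to zero over
  -- `D`; `k` is this homotopy.
  obtain ⟨k, -, hk⟩ := exists_lift_of_weakEquivalence (0 : (0 : C) ⟶ A) d.p (f := 0)
    (g := pullback.lift (i ≫ f) 0 (by rw [Category.assoc, w, reassoc_of% hq.w, zero_comp,
      zero_comp])) ((isZero_zero C).eq_of_src _ _)
  -- Extend `k` to a homotopy on `B` starting at `f`. Its other end vanishes on `A`, hence factors
  -- through `q`.
  obtain ⟨H, hH₁, hH₂⟩ := exists_lift i p₀ (f := k) (g := f) (by simp [p₀, reassoc_of% hk, pullback.lift_fst])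
  obtain ⟨f', hf'⟩ := hq.exists_desc (H ≫ p₁) (by
    simp [p₁, reassoc_of% hH₁, reassoc_of% hk, pullback.lift_snd])
  have := hq.epi
  refine ⟨f', ?_, ?_⟩
  · rw [← cancel_epi q, reassoc_of% hf', ← w, ← hH₂]
    simp [p₀, p₁, pullback.condition]
  · rw [hf', ← hH₂, Functor.map_comp _ H p₁, Functor.map_comp _ H p₀, toHo_map_eq_of_section e₀ e₁]

/-- Collapsing a contractible subobject gives an isomorphism in the homotopy category. -/
lemma IsCoker.isIso_toHo_map {A B Q : C} {i : A ⟶ B} {q : B ⟶ Q}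
    (hq : IsCoker i q) [Cofibration i] [IsCofibrant A] [IsContractible A] :
    IsIso ((toHo C).map q) := by
  have : IsCofibrant B := isCofibrant_of_cofibration i
  have : IsCofibrant Q := hq.cofibration_zero
  apply isIso_toHo_map_of_bijective
  · intro Y _ x
    obtain ⟨f, rfl⟩ := exists_toHo_map_eq x
    have : Fibration (0 : Y ⟶ (0 : C)) := (isFibrant_iff_zero Y).1 inferInstance
    obtain ⟨f', -, h⟩ := hq.exists_factor_of_isContractible (0 : Y ⟶ (0 : C)) f 0 (by simp)
    exact ⟨(toHo C).map f', by rw [← Functor.map_comp, h]⟩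
  · intro Y _ x y h
    obtain ⟨f, rfl⟩ := exists_toHo_map_eq x
    obtain ⟨g, rfl⟩ := exists_toHo_map_eq y
    rw [← Functor.map_comp, ← Functor.map_comp, ← RightHomotopyRel.iff_map_eq (toHo C)] at h
    obtain ⟨P, _, ⟨h⟩⟩ := h.exists_good_pathObject
    -- A homotopy from `q ≫ f` to `q ≫ g` lifts `q ≫ (f, g)` along `P.p`; the relative form of the
    -- lemma replaces it by a lift that descends to `Q`.
    obtain ⟨k, hk, -⟩ := hq.exists_factor_of_isContractible P.p h.h (prod.lift f g) (by
      apply Limits.prod.hom_ext <;> simp [prod.lift_fst, prod.lift_snd])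
    have h₀ : k ≫ P.p₀ = f := by simpa [prod.lift_fst] using hk =≫ prod.fst
    have h₁ : k ≫ P.p₁ = g := by simpa [prod.lift_snd] using hk =≫ prod.snd
    exact (RightHomotopyRel.factorsThroughLocalization C
      (PathObject.RightHomotopy.rightHomotopyRel ⟨k, h₀, h₁⟩)).map_eq (toHo C)

/-- The zero object of the homotopy category. -/
lemma isZero_toHo_zero : IsZero ((toHo C).obj (0 : C)) := by
  constructor
  · intro Q
    obtain ⟨Y, _, ⟨e⟩⟩ := exists_iso_toHo_fibrant Q
    refine ⟨⟨⟨(toHo C).map 0 ≫ e.inv⟩, fun x => ?_⟩⟩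
    refine (Iso.eq_comp_inv _).2 ?_
    obtain ⟨f, hf⟩ := exists_toHo_map_eq (x ≫ e.hom)
    rw [← hf, (isZero_zero C).eq_of_src f 0]
  · intro Q
    obtain ⟨Y, _, ⟨e⟩⟩ := exists_iso_toHo_cofibrant Q
    refine ⟨⟨⟨e.inv ≫ (toHo C).map 0⟩, fun x => ?_⟩⟩
    refine (Iso.eq_inv_comp _).2 ?_
    obtain ⟨f, hf⟩ := exists_toHo_map_eq (e.hom ≫ x)
    rw [← hf, (isZero_zero C).eq_of_tgt f 0]

lemma isZero_toHo_of_isContractible (X : C) [IsContractible X] : IsZero ((toHo C).obj X) :=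
  isZero_toHo_zero.of_iso (asIso ((toHo C).map (0 : (0 : C) ⟶ X))).symm

end Pointed

/-! ### Coproducts of cofibrant objects in the homotopy category -/

section Coproducts

variable {C : Type u} [Category.{v} C] [ModelCategory C]

/-- Homotopies on the two summands combine to one on the coproduct, provided that both use the same
path object. -/
lemma hoCoprod_hom_ext {V W : C} [IsCofibrant V] [IsCofibrant W] {Q : Ho C}
    {x y : (toHo C).obj (V ⨿ W) ⟶ Q}
    (h₀ : (toHo C).map coprod.inl ≫ x = (toHo C).map coprod.inl ≫ y)
    (h₁ : (toHo C).map coprod.inr ≫ x = (toHo C).map coprod.inr ≫ y) : x = y := by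
  obtain ⟨Y, _, ⟨e⟩⟩ := exists_iso_toHo_fibrant Q
  rw [← cancel_mono e.hom] at *
  have : IsCofibrant (V ⨿ W) := isCofibrant_of_cofibration (coprod.inl : V ⟶ V ⨿ W)
  obtain ⟨f, hf⟩ := exists_toHo_map_eq (x ≫ e.hom)
  obtain ⟨g, hg⟩ := exists_toHo_map_eq (y ≫ e.hom)
  simp only [Category.assoc, ← hf, ← hg, ← Functor.map_comp] at h₀ h₁ ⊢
  rw [← RightHomotopyRel.iff_map_eq (toHo C)] at h₀ h₁ ⊢
  obtain ⟨P, _, ⟨H₀⟩⟩ := h₀.exists_good_pathObject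
  let H₁ := h₁.rightHomotopy P
  exact ⟨P, ⟨coprod.desc H₀.h H₁.h, by
    apply coprod.hom_ext <;> simp [coprod.inl_desc, coprod.inr_desc],
    by
    apply coprod.hom_ext <;> simp [coprod.inl_desc, coprod.inr_desc]⟩⟩

lemma exists_hoCoprod_desc {V W : C} [IsCofibrant V] [IsCofibrant W] {Q : Ho C}
    (x : (toHo C).obj V ⟶ Q) (y : (toHo C).obj W ⟶ Q) :
    ∃ z : (toHo C).obj (V ⨿ W) ⟶ Q,
      (toHo C).map coprod.inl ≫ z = x ∧ (toHo C).map coprod.inr ≫ z = y := by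
  obtain ⟨Y, _, ⟨e⟩⟩ := exists_iso_toHo_fibrant Q
  obtain ⟨f, hf⟩ := exists_toHo_map_eq (x ≫ e.hom)
  obtain ⟨g, hg⟩ := exists_toHo_map_eq (y ≫ e.hom)
  refine ⟨(toHo C).map (coprod.desc f g) ≫ e.inv, ?_, ?_⟩
  · rw [← Functor.map_comp_assoc, coprod.inl_desc, hf, Category.assoc, e.hom_inv_id,
      Category.comp_id]
  · rw [← Functor.map_comp_assoc, coprod.inr_desc, hg, Category.assoc, e.hom_inv_id,
      Category.comp_id]

/-- The map from a coproduct in the homotopy category. -/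
def hoDesc {V W : C} [IsCofibrant V] [IsCofibrant W] {Q : Ho C}
    (x : (toHo C).obj V ⟶ Q) (y : (toHo C).obj W ⟶ Q) : (toHo C).obj (V ⨿ W) ⟶ Q :=
  (exists_hoCoprod_desc x y).choose

lemma inl_hoDesc {V W : C} [IsCofibrant V] [IsCofibrant W] {Q : Ho C}
    (x : (toHo C).obj V ⟶ Q) (y : (toHo C).obj W ⟶ Q) :
    (toHo C).map coprod.inl ≫ hoDesc x y = x := (exists_hoCoprod_desc x y).choose_spec.1

lemma inr_hoDesc {V W : C} [IsCofibrant V] [IsCofibrant W] {Q : Ho C}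
    (x : (toHo C).obj V ⟶ Q) (y : (toHo C).obj W ⟶ Q) :
    (toHo C).map coprod.inr ≫ hoDesc x y = y := (exists_hoCoprod_desc x y).choose_spec.2

end Coproducts

end

section

/-! ### Tensor products, cones and suspensions -/

section Tensor

variable {C : Type u} [Category.{v} C] [MonoidalCategory C] [MonoidalClosed C]

instance tensorRight_isLeftAdjoint [SymmetricCategory C] (X : C) :
    (tensorRight X).IsLeftAdjoint :=
  Functor.isLeftAdjoint_of_iso (BraidedCategory.tensorLeftIsoTensorRight X)

instance epi_whiskerLeft {A B : C} (X : C) (f : A ⟶ B) [Epi f] : Epi (X ◁ f) :=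
  inferInstanceAs (Epi ((tensorLeft X).map f))

instance epi_whiskerRight [SymmetricCategory C] {A B : C} (X : C) (f : A ⟶ B) [Epi f] :
    Epi (f ▷ X) :=
  inferInstanceAs (Epi ((tensorRight X).map f))

variable [HasZeroObject C] [HasZeroMorphisms C]

/-- Tensoring is a left adjoint; the descent is obtained by passing to the internal hom and back. -/
lemma IsCoker.whiskerLeft {A B Q : C} {i : A ⟶ B} {q : B ⟶ Q} (h : IsCoker i q) (X : C) :
    IsCoker (X ◁ i) (X ◁ q) := by
  have := h.epi
  refine ⟨by rw [← whiskerLeft_comp, h.w, whiskerLeft_zero_eq], fun {Z} f hf => ?_, inferInstance⟩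
  obtain ⟨g, hg⟩ := h.exists_desc (MonoidalClosed.curry f) (by
    rw [← MonoidalClosed.curry_natural_left, hf]
    apply MonoidalClosed.uncurry_injective
    rw [MonoidalClosed.uncurry_curry, MonoidalClosed.uncurry_eq, whiskerLeft_zero_eq, zero_comp])
  exact ⟨MonoidalClosed.uncurry g, by
    rw [← MonoidalClosed.uncurry_natural_left, hg, MonoidalClosed.uncurry_curry]⟩

lemma IsCoker.whiskerRight [SymmetricCategory C] {A B Q : C} {i : A ⟶ B} {q : B ⟶ Q}
    (h : IsCoker i q) (X : C) : IsCoker (i ▷ X) (q ▷ X) := by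
  have := h.epi
  refine ⟨by rw [← comp_whiskerRight, h.w, zero_whiskerRight_eq], fun {Z} f hf => ?_, inferInstance⟩
  obtain ⟨g, hg⟩ := (h.whiskerLeft X).exists_desc ((β_ X B).hom ≫ f) (by
    rw [BraidedCategory.braiding_naturality_right_assoc, hf, comp_zero])
  exact ⟨(β_ Q X).hom ≫ g, by
    rw [BraidedCategory.braiding_naturality_left_assoc, hg,
      SymmetricCategory.symmetry_assoc]⟩

end Tensor

/-! ### Lifting properties of pushout-products -/

section PushoutProduct

variable {C : Type u} [Category.{v} C] [ModelCategory C] [MonoidalCategory C]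

/-- A map out of the pushout `B ⊗ X ∪ A ⊗ Y` is spelled out as a compatible pair, the form in which
the axiom is applied later. -/
lemma exists_lift_pushoutProduct {A B X Y E D : C} (i : A ⟶ B) (j : X ⟶ Y) (p : E ⟶ D)
    [HasLiftingProperty ((Arrow.pushoutProduct.obj (Arrow.mk i)).obj (Arrow.mk j)).hom p]
    (f₁ : B ⊗ X ⟶ E) (f₂ : A ⊗ Y ⟶ E) (w : i ▷ X ≫ f₁ = A ◁ j ≫ f₂) (g : B ⊗ Y ⟶ D)
    (h₁ : f₁ ≫ p = B ◁ j ≫ g) (h₂ : f₂ ≫ p = i ▷ Y ≫ g) :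
    ∃ l : B ⊗ Y ⟶ E, B ◁ j ≫ l = f₁ ∧ i ▷ Y ≫ l = f₂ ∧ l ≫ p = g := by
  let S := Functor.PushoutObjObj.ofHasPushout (curriedTensor C) i j
  have w' : ((curriedTensor C).map i).app X ≫ f₁ = ((curriedTensor C).obj A).map j ≫ f₂ := w
  have : HasLiftingProperty S.ι p :=
    ‹HasLiftingProperty ((Arrow.pushoutProduct.obj (Arrow.mk i)).obj (Arrow.mk j)).hom p›
  let g' : ((curriedTensor C).obj B).obj Y ⟶ D := g
  have sq : CommSq (S.isPushout.desc f₁ f₂ w') S.ι p g' := ⟨by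
    apply S.isPushout.hom_ext
    · rw [S.isPushout.inl_desc_assoc, S.inl_ι_assoc]; exact h₁
    · rw [S.isPushout.inr_desc_assoc, S.inr_ι_assoc]; exact h₂⟩
  refine ⟨sq.lift, ?_, ?_, sq.fac_right⟩
  · have := S.inl ≫= sq.fac_left
    rw [S.isPushout.inl_desc, S.inl_ι_assoc] at this
    exact this
  · have := S.inr ≫= sq.fac_left
    rw [S.isPushout.inr_desc, S.inr_ι_assoc] at this
    exact this

variable [MonoidalClosed C] [HasZeroObject C] [HasZeroMorphisms C]

lemma isZero_tensor_right (X : C) {Z : C} (h : IsZero Z) : IsZero (X ⊗ Z) := by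
  rw [IsZero.iff_id_eq_zero, ← whiskerLeft_id, (IsZero.iff_id_eq_zero _).1 h, whiskerLeft_zero_eq]

lemma isZero_tensor_left [SymmetricCategory C] {Z : C} (h : IsZero Z) (X : C) : IsZero (Z ⊗ X) :=
  (isZero_tensor_right X h).of_iso (β_ Z X)

/-- When `Z` is zero, so is the `Z ⊗ Y` corner, and the pushout-product of `Z ⟶ A` with `j` reduces
to `A ◁ j`. -/
lemma hasLiftingProperty_whiskerLeft [SymmetricCategory C] {Z A X Y E D : C} (i : Z ⟶ A)
    (hZ : IsZero Z) (j : X ⟶ Y) (p : E ⟶ D)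
    [HasLiftingProperty ((Arrow.pushoutProduct.obj (Arrow.mk i)).obj (Arrow.mk j)).hom p] :
    HasLiftingProperty (A ◁ j) p where
  sq_hasLift {f g} sq := by
    obtain ⟨l, h₁, -, h₂⟩ := exists_lift_pushoutProduct i j p f 0
      ((isZero_tensor_left hZ _).eq_of_src _ _) g sq.w
      ((isZero_tensor_left hZ _).eq_of_src _ _)
    exact ⟨⟨l, h₁, h₂⟩⟩

lemma hasLiftingProperty_whiskerRight {Z A X Y E D : C} (i : X ⟶ Y) (j : Z ⟶ A)
    (hZ : IsZero Z) (p : E ⟶ D)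
    [HasLiftingProperty ((Arrow.pushoutProduct.obj (Arrow.mk i)).obj (Arrow.mk j)).hom p] :
    HasLiftingProperty (i ▷ A) p where
  sq_hasLift {f g} sq := by
    obtain ⟨l, -, h₁, h₂⟩ := exists_lift_pushoutProduct i j p 0 f
      ((isZero_tensor_right _ hZ).eq_of_src _ _) g
      ((isZero_tensor_right _ hZ).eq_of_src _ _) sq.w
    exact ⟨⟨l, h₁, h₂⟩⟩

lemma cofibration_of_hasLiftingProperty {A B : C} (i : A ⟶ B)
    (h : ∀ {E D : C} (p : E ⟶ D) [Fibration p] [WeakEquivalence p], HasLiftingProperty i p) :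
    Cofibration i := by
  rw [cofibration_iff, ← trivialFibrations_llp]
  intro E D p hp
  rw [mem_trivialFibrations_iff] at hp
  obtain ⟨_, _⟩ := hp
  exact h p

lemma trivialCofibration_of_hasLiftingProperty {A B : C} (i : A ⟶ B)
    (h : ∀ {E D : C} (p : E ⟶ D) [Fibration p], HasLiftingProperty i p) :
    Cofibration i ∧ WeakEquivalence i := by
  rw [← mem_trivialCofibrations_iff, ← fibrations_llp]
  intro E D p hp
  rw [← fibration_iff] at hp
  exact h p

variable [SymmetricCategory C] [SymmetricMonoidalModelCategory C]

open ZeroObject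

instance cofibration_whiskerRight (A : C) [IsCofibrant A] {X Y : C} (j : X ⟶ Y) [Cofibration j] :
    Cofibration (j ▷ A) := by
  have := SymmetricMonoidalModelCategory.cofibration_pushoutProduct j (0 : (0 : C) ⟶ A)
  exact cofibration_of_hasLiftingProperty _
    fun p => hasLiftingProperty_whiskerRight j (0 : (0 : C) ⟶ A) (isZero_zero C) p

instance weakEquivalence_whiskerLeft (A : C) [IsCofibrant A] {X Y : C} (j : X ⟶ Y) [Cofibration j]
    [WeakEquivalence j] : WeakEquivalence (A ◁ j) := by
  have := SymmetricMonoidalModelCategory.cofibration_pushoutProduct (0 : (0 : C) ⟶ A) j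
  have := SymmetricMonoidalModelCategory.weakEquivalence_pushoutProduct (0 : (0 : C) ⟶ A) j
    (.inr inferInstance)
  exact (trivialCofibration_of_hasLiftingProperty _
    fun p => hasLiftingProperty_whiskerLeft (0 : (0 : C) ⟶ A) (isZero_zero C) j p).2

instance weakEquivalence_whiskerRight (A : C) [IsCofibrant A] {X Y : C} (j : X ⟶ Y) [Cofibration j]
    [WeakEquivalence j] : WeakEquivalence (j ▷ A) := by
  have := SymmetricMonoidalModelCategory.cofibration_pushoutProduct j (0 : (0 : C) ⟶ A)
  have := SymmetricMonoidalModelCategory.weakEquivalence_pushoutProduct j (0 : (0 : C) ⟶ A)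
    (.inl inferInstance)
  exact (trivialCofibration_of_hasLiftingProperty _
    fun p => hasLiftingProperty_whiskerRight j (0 : (0 : C) ⟶ A) (isZero_zero C) p).2

end PushoutProduct

/-! ### Cylinders, cones and suspensions of cofibrant objects -/

section Cones

variable {C : Type u} [Category.{v} C] [ModelCategory C] [MonoidalCategory C]
  [SymmetricCategory C] [MonoidalClosed C] [HasZeroObject C] [HasZeroMorphisms C]
  [TopologicalStructure C]

open ZeroObject TopologicalStructure Functor.LaxMonoidal

variable (C) in
/-- The interval in `C`. -/
abbrev unitInt : C := (spaces (C := C)).obj interval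

variable (C) in
/-- The inclusion of a point in the interval in `C`. -/
def unitPt (t : unitInterval) : 𝟙_ C ⟶ unitInt C :=
  ε (spaces (C := C)) ≫ (spaces (C := C)).map (intervalPt t)

/-- The inclusion `X ⟶ [0,1] ⊗ X` with parameter `t`. -/
def cylPt (t : unitInterval) (X : C) : X ⟶ unitInt C ⊗ X := (λ_ X).inv ≫ unitPt C t ▷ X

/-- The projection `[0,1] ⊗ X ⟶ C X`. -/
def toCone (X : C) : unitInt C ⊗ X ⟶ Cone X := toUnitCone C ▷ X

lemma cylPt_zero_toCone (X : C) : cylPt 0 X ≫ toCone X = coneBase X := by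
  simp only [cylPt, toCone, coneBase, unitConeBase, unitPt, comp_whiskerRight, Category.assoc]

lemma isCoker_toUnitCone : IsCoker (unitPt C 1) (toUnitCone C) := by
  refine (isCoker_cokernel ((spaces (C := C)).map (intervalPt 1))).of_iso
    (asIso (ε (spaces (C := C)))) (Iso.refl _) ?_ ?_
  · simp [unitPt]
  · simp [toUnitCone]

lemma isCoker_toCone (X : C) : IsCoker (cylPt 1 X) (toCone X) :=
  (isCoker_toUnitCone.whiskerRight X).of_iso (λ_ X).symm (Iso.refl _) (by simp [cylPt])
    (by simp [toCone])

lemma isCoker_coneToSusp (X : C) : IsCoker (coneBase X) (coneToSusp X) :=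
  ((isCoker_cokernel (unitConeBase C)).whiskerRight X).of_iso (λ_ X).symm (Iso.refl _)
    (by simp [coneBase]) (Category.id_comp _)

instance (X : C) : Epi (toCone X) := (isCoker_toCone X).epi

instance (X : C) : Epi (coneToSusp X) := (isCoker_coneToSusp X).epi

lemma coneBase_naturality {X Y : C} (f : X ⟶ Y) :
    coneBase X ≫ unitCone C ◁ f = f ≫ coneBase Y := by
  simp only [coneBase, Category.assoc, ← whisker_exchange]
  simp

lemma coneToSusp_naturality {X Y : C} (f : X ⟶ Y) :
    coneToSusp X ≫ unitSusp C ◁ f = unitCone C ◁ f ≫ coneToSusp Y := by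
  simp only [coneToSusp, whisker_exchange]

lemma coneToSuspRev_naturality {X Y : C} (f : X ⟶ Y) :
    coneToSuspRev X ≫ unitSusp C ◁ f = unitCone C ◁ f ≫ coneToSuspRev Y := by
  simp only [coneToSuspRev, whisker_exchange]

variable (C) in
-- The interval projects to the point. One retraction serves all parameters `t`, which is what makes
-- the two ends of a cylinder equal in the homotopy category.
lemma exists_unitInt_retraction : ∃ π : unitInt C ⟶ 𝟙_ C, ∀ t, unitPt C t ≫ π = 𝟙 _ := by
  refine ⟨(spaces (C := C)).map (CartesianMonoidalCategory.toUnit interval) ≫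
    Functor.OplaxMonoidal.η (spaces (C := C)), fun t => ?_⟩
  have : intervalPt.{v} t ≫ CartesianMonoidalCategory.toUnit interval = 𝟙 _ :=
    CartesianMonoidalCategory.toUnit_unique _ _
  rw [unitPt, Category.assoc, ← Functor.map_comp_assoc, this, CategoryTheory.Functor.map_id,
    Category.id_comp, Functor.Monoidal.ε_η]

lemma cylPt_retraction {π : unitInt C ⟶ 𝟙_ C} (hπ : ∀ t, unitPt C t ≫ π = 𝟙 _)
    (t : unitInterval) (X : C) : cylPt t X ≫ π ▷ X ≫ (λ_ X).hom = 𝟙 X := by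
  rw [cylPt, Category.assoc, ← comp_whiskerRight_assoc, hπ, id_whiskerRight, Category.id_comp,
    Iso.inv_hom_id]

section Cofibrant

variable (X : C) [IsCofibrant X]

/-- This is the pushout-product of the trivial cofibration `{1} ⟶ [0,1]` with `0 ⟶ X`, up to the
unit isomorphisms. -/
lemma trivialCofibration_cylPt_one : Cofibration (cylPt 1 X) ∧ WeakEquivalence (cylPt 1 X) := by
  have hk : serreCofibrations.{v} (intervalPt 1) :=
    MorphismProperty.antitone_llp trivialSerreFibrations_le _ intervalPt_one_mem
  have := TopologicalStructure.cofibration_pushoutProduct (C := C) (intervalPt 1)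
    (0 : (0 : C) ⟶ X) hk
  have := TopologicalStructure.weakEquivalence_pushoutProduct (C := C) (intervalPt 1)
    (0 : (0 : C) ⟶ X) hk (.inl intervalPt_one_mem)
  obtain ⟨_, _⟩ := trivialCofibration_of_hasLiftingProperty
    ((spaces (C := C)).map (intervalPt 1) ▷ X) fun p =>
      hasLiftingProperty_whiskerRight _ (0 : (0 : C) ⟶ X) (isZero_zero C) p
  have : cylPt 1 X = ((λ_ X).inv ≫ ε (spaces (C := C)) ▷ X) ≫
      (spaces (C := C)).map (intervalPt 1) ▷ X := by simp [cylPt, unitPt]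
  rw [this]
  constructor <;> infer_instance

omit [IsCofibrant X] in
variable {X} in
-- The lifting property of the pushout-product of `{0, 1} ⟶ [0,1]` with `j`: a homotopy can be
-- lifted when the lift is prescribed on `X` and at both ends.
lemma exists_lift_cylinder_rel {Y E D : C} (j : X ⟶ Y) [Cofibration j] (p : E ⟶ D) [Fibration p]
    [WeakEquivalence p] (f : unitInt C ⊗ X ⟶ E) (e₀ e₁ : Y ⟶ E) (g : unitInt C ⊗ Y ⟶ D)
    (w₀ : cylPt 0 X ≫ f = j ≫ e₀) (w₁ : cylPt 1 X ≫ f = j ≫ e₁) (hf : f ≫ p = unitInt C ◁ j ≫ g)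
    (h₀ : e₀ ≫ p = cylPt 0 Y ≫ g) (h₁ : e₁ ≫ p = cylPt 1 Y ≫ g) :
    ∃ l : unitInt C ⊗ Y ⟶ E, unitInt C ◁ j ≫ l = f ∧ cylPt 0 Y ≫ l = e₀ ∧ cylPt 1 Y ≫ l = e₁ ∧
      l ≫ p = g := by
  have := TopologicalStructure.cofibration_pushoutProduct (C := C) _ j endpoints_mem
  let k := coprod.desc (intervalPt.{v} 0) (intervalPt 1)
  -- Both `spaces` and tensoring are left adjoints, so a map out of the two ends of the cylinder on
  -- `Y` is a pair of maps out of `Y`.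
  have hc (Y : C) := isColimitOfHasBinaryCoproductOfPreservesColimit
    (spaces (C := C) ⋙ tensorRight Y) (𝟙_ DeltaGenerated.{v}) (𝟙_ DeltaGenerated.{v})
  have ext {Y Z : C} {f g : (spaces (C := C)).obj (𝟙_ DeltaGenerated.{v} ⨿ 𝟙_ _) ⊗ Y ⟶ Z}
      (h₀ : (spaces (C := C)).map coprod.inl ▷ Y ≫ f = (spaces (C := C)).map coprod.inl ▷ Y ≫ g)
      (h₁ : (spaces (C := C)).map coprod.inr ▷ Y ≫ f = (spaces (C := C)).map coprod.inr ▷ Y ≫ g) :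
      f = g := BinaryCofan.IsColimit.hom_ext (hc Y) h₀ h₁
  let a (Y : C) : (spaces (C := C)).obj (𝟙_ _) ⊗ Y ≅ Y :=
    whiskerRightIso (Functor.Monoidal.εIso (spaces (C := C))).symm Y ≪≫ λ_ Y
  have ha (t : unitInterval) (Y : C) :
      (spaces (C := C)).map (intervalPt t) ▷ Y = (a Y).hom ≫ cylPt t Y := by
    rw [← Iso.inv_comp_eq]
    simp [a, cylPt, unitPt]
  let f' : (spaces (C := C)).obj (𝟙_ _ ⨿ 𝟙_ _) ⊗ Y ⟶ E :=
    BinaryCofan.IsColimit.desc (hc Y) ((a Y).hom ≫ e₀) ((a Y).hom ≫ e₁)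
  have f₀ : (spaces (C := C)).map coprod.inl ▷ Y ≫ f' = (a Y).hom ≫ e₀ :=
    (hc Y).fac _ ⟨WalkingPair.left⟩
  have f₁ : (spaces (C := C)).map coprod.inr ▷ Y ≫ f' = (a Y).hom ≫ e₁ :=
    (hc Y).fac _ ⟨WalkingPair.right⟩
  have k₀ (Y : C) : (spaces (C := C)).map coprod.inl ▷ Y ≫ (spaces (C := C)).map k ▷ Y =
      (a Y).hom ≫ cylPt 0 Y := by
    rw [← ha, ← comp_whiskerRight, ← Functor.map_comp, coprod.inl_desc]
  have k₁ (Y : C) : (spaces (C := C)).map coprod.inr ▷ Y ≫ (spaces (C := C)).map k ▷ Y =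
      (a Y).hom ≫ cylPt 1 Y := by
    rw [← ha, ← comp_whiskerRight, ← Functor.map_comp, coprod.inr_desc]
  have aj : (spaces (C := C)).obj (𝟙_ _) ◁ j ≫ (a Y).hom = (a X).hom ≫ j := by
    simp only [a, Iso.trans_hom, whiskerRightIso_hom, Category.assoc, ← leftUnitor_naturality]
    rw [whisker_exchange_assoc]
  obtain ⟨l, l₁, l₂, l₃⟩ := exists_lift_pushoutProduct ((spaces (C := C)).map k) j p f f' (by
    apply ext
    · rw [reassoc_of% (k₀ X), w₀, ← whisker_exchange_assoc, f₀, reassoc_of% aj]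
    · rw [reassoc_of% (k₁ X), w₁, ← whisker_exchange_assoc, f₁, reassoc_of% aj]) g hf (by
    apply ext
    · rw [reassoc_of% f₀, reassoc_of% (k₀ Y), h₀]
    · rw [reassoc_of% f₁, reassoc_of% (k₁ Y), h₁])
  refine ⟨l, l₁, ?_, ?_, l₃⟩
  · rw [← cancel_epi (a Y).hom, ← reassoc_of% (k₀ Y), l₂, f₀]
  · rw [← cancel_epi (a Y).hom, ← reassoc_of% (k₁ Y), l₂, f₁]

lemma exists_lift_cylinder {E D : C} (p : E ⟶ D) [Fibration p] [WeakEquivalence p]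
    (e₀ e₁ : X ⟶ E) (g : unitInt C ⊗ X ⟶ D) (h₀ : e₀ ≫ p = cylPt 0 X ≫ g)
    (h₁ : e₁ ≫ p = cylPt 1 X ≫ g) :
    ∃ l : unitInt C ⊗ X ⟶ E, cylPt 0 X ≫ l = e₀ ∧ cylPt 1 X ≫ l = e₁ ∧ l ≫ p = g := by
  obtain ⟨l, -, h⟩ := exists_lift_cylinder_rel (0 : (0 : C) ⟶ X) p 0 e₀ e₁ g
    ((isZero_zero C).eq_of_src _ _) ((isZero_zero C).eq_of_src _ _)
    ((isZero_tensor_right _ (isZero_zero C)).eq_of_src _ _) h₀ h₁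
  exact ⟨l, h⟩

/-- Lift on the cylinder with the given map at the end `0` and the zero map at the end `1`; such a
lift descends to the cone. -/
instance cofibration_coneBase : Cofibration (coneBase X) := by
  refine cofibration_of_hasLiftingProperty _ fun p => ⟨fun {f g} sq => ?_⟩
  obtain ⟨l, h₀, h₁, h⟩ := exists_lift_cylinder X p f 0 (toCone X ≫ g)
    (by rw [← Category.assoc, cylPt_zero_toCone, sq.w])
    (by rw [reassoc_of% (isCoker_toCone X).w, zero_comp, zero_comp])
  obtain ⟨l', rfl⟩ := (isCoker_toCone X).exists_desc l h₁
  refine ⟨⟨l', by rw [← h₀, ← cylPt_zero_toCone, Category.assoc], ?_⟩⟩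
  rw [← cancel_epi (toCone X), ← h, Category.assoc]

instance isCofibrant_cone : IsCofibrant (Cone X) :=
  isCofibrant_of_cofibration (coneBase X)

instance isCofibrant_susp : IsCofibrant (Susp X) :=
  (isCoker_coneToSusp X).cofibration_zero

instance isContractible_cone : IsContractible (Cone X) := by
  obtain ⟨_, _⟩ := trivialCofibration_cylPt_one X
  exact (isCoker_toCone X).isContractible

/-- The endpoints of the interval give the same map in the homotopy category. -/
lemma toHo_map_cylPt : (toHo C).map (cylPt 0 X) = (toHo C).map (cylPt 1 X) := by
  obtain ⟨π, hπ⟩ := exists_unitInt_retraction C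
  obtain ⟨_, _⟩ := trivialCofibration_cylPt_one X
  have : WeakEquivalence (π ▷ X ≫ (λ_ X).hom) :=
    weakEquivalence_of_precomp_of_fac (cylPt_retraction hπ 1 X)
  exact toHo_map_eq_of_retraction (cylPt_retraction hπ 0 X) (cylPt_retraction hπ 1 X)

end Cofibrant

end Cones

end

section

/-! ### The two collapse maps from the double cone to the suspension are homotopic -/

section DoubleCone

variable {C : Type u} [Category.{v} C] [ModelCategory C] [MonoidalCategory C]
  [SymmetricCategory C] [MonoidalClosed C] [HasZeroObject C] [HasZeroMorphisms C]
  [TopologicalStructure C]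

open ZeroObject TopologicalStructure Functor.LaxMonoidal

/-! ### Homotopies on the cone induced by maps of the square -/

section Square

variable (C) (c : C(unitInterval × unitInterval, unitInterval))

/-- The map of intervals in `C` induced by a map of intervals. -/
abbrev unitMap (γ : C(unitInterval, unitInterval)) : unitInt C ⟶ unitInt C :=
  (spaces (C := C)).map (intervalMap γ)

/-- The map from the square to the interval in `C` induced by a map of spaces. -/
def unitSquareMap : unitInt C ⊗ unitInt C ⟶ unitInt C :=
  μ (spaces (C := C)) interval interval ≫ (spaces (C := C)).map (squareMap c)

lemma unitPt_whiskerRight_unitSquareMap (s : unitInterval) :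
    unitPt C s ▷ unitInt C ≫ unitSquareMap C c =
      (λ_ _).hom ≫ unitMap C ⟨fun t => c (s, t), by fun_prop⟩ := by
  rw [unitPt, comp_whiskerRight, unitSquareMap, Category.assoc, μ_natural_left_assoc,
    ← Functor.map_comp, intervalPt_whiskerRight_squareMap, Functor.map_comp,
    ← left_unitality_assoc]

lemma whiskerLeft_unitPt_unitSquareMap (t : unitInterval) :
    unitInt C ◁ unitPt C t ≫ unitSquareMap C c =
      (ρ_ _).hom ≫ unitMap C ⟨fun s => c (s, t), by fun_prop⟩ := by
  rw [unitPt, whiskerLeft_comp, unitSquareMap, Category.assoc, μ_natural_right_assoc,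
    ← Functor.map_comp, whiskerLeft_intervalPt_squareMap, Functor.map_comp,
    ← right_unitality_assoc]

/-- The projection from the interval to the suspension of the unit. -/
abbrev intToSusp : unitInt C ⟶ unitSusp C := toUnitCone C ≫ unitConeToSusp C

lemma unitMap_const_intToSusp {e : unitInterval} (he : e = 0 ∨ e = 1) :
    unitMap C (ContinuousMap.const _ e) ≫ intToSusp C = 0 := by
  rw [unitMap, intervalMap_const, Functor.map_comp, Category.assoc]
  obtain rfl | rfl := he
  · rw [spaces_zero_toUnitCone_toSusp, comp_zero]
  · rw [reassoc_of% (spaces_one_toUnitCone C), zero_comp, comp_zero]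

variable {c}

/-- An edge `t = 1` that goes to an end of the interval becomes zero in the suspension, so the
homotopy descends along the collapse of the tip of the cone. -/
lemma exists_coneHomotopy {e : unitInterval} (he : e = 0 ∨ e = 1) (hc : ∀ s, c (s, 1) = e) :
    ∃ H : unitInt C ⊗ unitCone C ⟶ unitSusp C,
      unitInt C ◁ toUnitCone C ≫ H = unitSquareMap C c ≫ intToSusp C := by
  refine (isCoker_toUnitCone.whiskerLeft (unitInt C)).exists_desc _ ?_
  rw [← Category.assoc, whiskerLeft_unitPt_unitSquareMap]
  have : (⟨fun s => c (s, 1), by fun_prop⟩ : C(unitInterval, unitInterval)) =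
    ContinuousMap.const _ e := by ext s; simp [hc s]
  rw [this, Category.assoc, unitMap_const_intToSusp C he, comp_zero]

variable {H : unitInt C ⊗ unitCone C ⟶ unitSusp C}
  (hH : unitInt C ◁ toUnitCone C ≫ H = unitSquareMap C c ≫ intToSusp C)

include hH

lemma unitConeBase_coneHomotopy (hc : ∀ s, c (s, 0) = s) :
    unitInt C ◁ unitConeBase C ≫ H = (ρ_ _).hom ≫ intToSusp C := by
  have : unitConeBase C = unitPt C 0 ≫ toUnitCone C := by simp [unitConeBase, unitPt]
  rw [this, whiskerLeft_comp, Category.assoc, hH, ← Category.assoc,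
    whiskerLeft_unitPt_unitSquareMap]
  have : (⟨fun s => c (s, 0), by fun_prop⟩ : C(unitInterval, unitInterval)) =
    ContinuousMap.id _ := by ext s; simp [hc s]
  rw [this, unitMap, intervalMap_id, CategoryTheory.Functor.map_id, Category.comp_id]

lemma unitPt_coneHomotopy (s : unitInterval) (γ : C(unitInterval, unitInterval))
    (hγ : ∀ t, c (s, t) = γ t) (h : unitCone C ⟶ unitSusp C)
    (hh : toUnitCone C ≫ h = unitMap C γ ≫ intToSusp C) :
    unitPt C s ▷ unitCone C ≫ H = (λ_ _).hom ≫ h := by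
  have := (isCoker_toUnitCone (C := C)).epi
  rw [← cancel_epi (𝟙_ C ◁ toUnitCone C), whisker_exchange_assoc, hH, ← Category.assoc,
    unitPt_whiskerRight_unitSquareMap, leftUnitor_naturality_assoc, hh, Category.assoc]
  obtain rfl : (⟨fun t => c (s, t), by fun_prop⟩ : C(unitInterval, unitInterval)) = γ := by
    ext t; simp [hγ]
  rfl

end Square

/-- Rotation of a suspension: on the first cone the identification is pushed off the tip, on the
second it is pulled in with reversed coordinate. Both homotopies sweep the base by `t = 0 ↦ s`, so
they glue on the double cone. -/
lemma exists_coneHomotopies : ∃ H₁ H₂ : unitInt C ⊗ unitCone C ⟶ unitSusp C,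
    unitInt C ◁ unitConeBase C ≫ H₁ = unitInt C ◁ unitConeBase C ≫ H₂ ∧
    unitPt C 0 ▷ unitCone C ≫ H₁ = (λ_ _).hom ≫ unitConeToSusp C ∧
    unitPt C 1 ▷ unitCone C ≫ H₁ = (λ_ _).hom ≫ 0 ∧
    unitPt C 0 ▷ unitCone C ≫ H₂ = (λ_ _).hom ≫ 0 ∧
    unitPt C 1 ▷ unitCone C ≫ H₂ = (λ_ _).hom ≫ unitConeToSuspRev C := by
  -- The formulas are `c₁(s, t) = 1 - (1 - s)(1 - t)`, from `t` to the constant `1`, and `c₂(s, t) =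
  -- s(1 - t)`, from the constant `0` to `1 - t`.
  let c₁ : C(unitInterval × unitInterval, unitInterval) :=
    ⟨fun x => unitInterval.symm (unitInterval.symm x.1 * unitInterval.symm x.2), by fun_prop⟩
  let c₂ : C(unitInterval × unitInterval, unitInterval) :=
    ⟨fun x => x.1 * unitInterval.symm x.2, by fun_prop⟩
  have h₀ : toUnitCone C ≫ unitConeToSusp C =
      unitMap C (ContinuousMap.id _) ≫ intToSusp C := by
    rw [unitMap, intervalMap_id, CategoryTheory.Functor.map_id, Category.id_comp]
  have h₁ : toUnitCone C ≫ unitConeToSuspRev C =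
      unitMap C ⟨unitInterval.symm, by fun_prop⟩ ≫ intToSusp C := by
    rw [unitMap, intervalMap_symm]
    exact cokernel.π_desc _ _ _
  have h₂ (e : unitInterval) (he : e = 0 ∨ e = 1) : toUnitCone C ≫ 0 =
      unitMap C (ContinuousMap.const _ e) ≫ intToSusp C := by
    rw [unitMap_const_intToSusp C he, comp_zero]
  obtain ⟨H₁, hH₁⟩ := exists_coneHomotopy C (c := c₁) (e := 1) (.inr rfl) (by simp [c₁])
  obtain ⟨H₂, hH₂⟩ := exists_coneHomotopy C (c := c₂) (e := 0) (.inl rfl) (by simp [c₂])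
  refine ⟨H₁, H₂, ?_, unitPt_coneHomotopy C hH₁ 0 _ (by simp [c₁]) _ h₀,
    unitPt_coneHomotopy C hH₁ 1 _ (by simp [c₁]) _ (h₂ 1 (.inr rfl)),
    unitPt_coneHomotopy C hH₂ 0 _ (by simp [c₂]) _ (h₂ 0 (.inl rfl)),
    unitPt_coneHomotopy C hH₂ 1 _ (by simp [c₂]) _ h₁⟩
  rw [unitConeBase_coneHomotopy C hH₁ (by simp [c₁]),
    unitConeBase_coneHomotopy C hH₂ (by simp [c₂])]

/-- The identification of the double cone with the suspension which collapses the first cone. -/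
def doubleConeToSuspRev (X : C) : DoubleCone X ⟶ Susp X :=
  pushout.desc 0 (coneToSuspRev X) (by rw [coneBase_toSuspRev, comp_zero])

lemma cylPt_whiskerRight_homotopy (X : C) {s : unitInterval}
    {H : unitInt C ⊗ unitCone C ⟶ unitSusp C} {h : unitCone C ⟶ unitSusp C}
    (w : unitPt C s ▷ unitCone C ≫ H = (λ_ _).hom ≫ h) :
    cylPt s (Cone X) ≫ (α_ _ _ _).inv ≫ H ▷ X = h ▷ X := by
  rw [cylPt, Category.assoc, associator_inv_naturality_left_assoc, ← comp_whiskerRight, w]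
  simp

lemma cylPt_naturality (s : unitInterval) {X Y : C} (f : X ⟶ Y) :
    f ≫ cylPt s Y = cylPt s X ≫ unitInt C ◁ f := by
  simp only [cylPt, Category.assoc, ← whisker_exchange]
  simp

variable (X : C) [IsCofibrant X]

instance isCofibrant_doubleCone : IsCofibrant (DoubleCone X) :=
  isCofibrant_of_cofibration (pushout.inl (coneBase X) (coneBase X))

/-- The map collapses the second cone, which is contractible. -/
instance isIso_toHo_doubleConeToSusp : IsIso ((toHo C).map (doubleConeToSusp X)) :=
  ((isCoker_coneToSusp X).pushout_desc (coneBase X)).isIso_toHo_map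

/-- Rotating the double cone shows that its two identifications with the suspension agree. -/
lemma toHo_map_doubleConeToSuspRev :
    (toHo C).map (doubleConeToSuspRev X) = (toHo C).map (doubleConeToSusp X) := by
  obtain ⟨H₁, H₂, w, h₁₀, h₁₁, h₂₀, h₂₁⟩ := exists_coneHomotopies (C := C)
  -- Tensoring with the interval preserves the gluing of the two cones, so homotopies that agree on
  -- the cylinder of the base define one on the double cone.
  have hp := (IsPushout.of_hasPushout (coneBase X) (coneBase X)).map (tensorLeft (unitInt C))
  have hw : unitInt C ◁ coneBase X ≫ (α_ _ _ _).inv ≫ H₁ ▷ X =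
      unitInt C ◁ coneBase X ≫ (α_ _ _ _).inv ≫ H₂ ▷ X := by
    simp only [coneBase, whiskerLeft_comp, Category.assoc,
      associator_inv_naturality_middle_assoc, ← comp_whiskerRight, w]
  let K : unitInt C ⊗ DoubleCone X ⟶ Susp X := hp.desc _ _ hw
  have hK₁ : unitInt C ◁ pushout.inl _ _ ≫ K = (α_ _ _ _).inv ≫ H₁ ▷ X := hp.inl_desc _ _ hw
  have hK₂ : unitInt C ◁ pushout.inr _ _ ≫ K = (α_ _ _ _).inv ≫ H₂ ▷ X := hp.inr_desc _ _ hw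
  have e₀ : cylPt 0 (DoubleCone X) ≫ K = doubleConeToSusp X := by
    apply pushout.hom_ext
    · rw [← Category.assoc, cylPt_naturality, Category.assoc, hK₁,
        cylPt_whiskerRight_homotopy X h₁₀]
      exact (pushout.inl_desc _ _ _).symm
    · rw [← Category.assoc, cylPt_naturality, Category.assoc, hK₂,
        cylPt_whiskerRight_homotopy X h₂₀, zero_whiskerRight_eq]
      exact (pushout.inr_desc _ _ _).symm
  have e₁ : cylPt 1 (DoubleCone X) ≫ K = doubleConeToSuspRev X := by
    apply pushout.hom_ext
    · rw [← Category.assoc, cylPt_naturality, Category.assoc, hK₁,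
        cylPt_whiskerRight_homotopy X h₁₁, zero_whiskerRight_eq]
      exact (pushout.inl_desc _ _ _).symm
    · rw [← Category.assoc, cylPt_naturality, Category.assoc, hK₂,
        cylPt_whiskerRight_homotopy X h₂₁]
      exact (pushout.inr_desc _ _ _).symm
  rw [← e₀, ← e₁, Functor.map_comp, Functor.map_comp, toHo_map_cylPt]

end DoubleCone

end

section

/-! ### The homotopy category of a stable model category is preadditive -/

section Abstract

/-- A bilinear unital addition of morphisms in a category with coproducts and inverses of identity
morphisms makes the category preadditive, by the Eckmann–Hilton argument. -/
@[reducible]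
def preadditiveOfAdd {D : Type*} [Category* D] (add : ∀ {A B : D}, (A ⟶ B) → (A ⟶ B) → (A ⟶ B))
    (zero : ∀ A B : D, A ⟶ B)
    (zero_comp' : ∀ {A B : D} (Q : D) (f : A ⟶ B), zero Q A ≫ f = zero Q B)
    (comp_add' : ∀ {A B Q : D} (f : A ⟶ B) (x y : B ⟶ Q), f ≫ add x y = add (f ≫ x) (f ≫ y))
    (add_comp' : ∀ {A B Q : D} (x y : A ⟶ B) (f : B ⟶ Q), add x y ≫ f = add (x ≫ f) (y ≫ f))
    (add_zero' : ∀ {A B : D} (x : A ⟶ B), add x (zero _ _) = x)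
    (zero_add' : ∀ {A B : D} (x : A ⟶ B), add (zero _ _) x = x)
    (exists_neg : ∀ A : D, ∃ ν : A ⟶ A, add (𝟙 A) ν = zero _ _)
    (exists_coprod : ∀ A : D, ∃ (S : D) (i j : A ⟶ S), ∀ {Q : D} (x y : A ⟶ Q),
      ∃ z : S ⟶ Q, i ≫ z = x ∧ j ≫ z = y) : Preadditive D := by
  -- Both `add x y` and `add z w` arise by precomposing with the universal sum `add i j`, and
  -- precomposition is additive; the interchange law follows.
  have interchange {A B : D} (x y z w : A ⟶ B) :
      add (add x y) (add z w) = add (add x z) (add y w) := by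
    obtain ⟨S, i, j, h⟩ := exists_coprod A
    obtain ⟨p, hp₁, hp₂⟩ := h x y
    obtain ⟨q, hq₁, hq₂⟩ := h z w
    have h₁ : add i j ≫ p = add x y := by rw [add_comp', hp₁, hp₂]
    have h₂ : add i j ≫ q = add z w := by rw [add_comp', hq₁, hq₂]
    rw [← h₁, ← h₂, ← comp_add', add_comp', comp_add', comp_add', hp₁, hp₂, hq₁, hq₂]
  have comm {A B : D} (x y : A ⟶ B) : add x y = add y x := by
    have := interchange (zero _ _) x y (zero _ _)
    rwa [zero_add', add_zero', zero_add', add_zero'] at this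
  have assoc {A B : D} (x y z : A ⟶ B) : add (add x y) z = add x (add y z) := by
    have := interchange x y (zero _ _) z
    rwa [zero_add', add_zero'] at this
  refine
    { homGroup A B :=
        { add := add
          zero := zero A B
          neg x := (exists_neg A).choose ≫ x
          nsmul := letI : Zero (A ⟶ B) := ⟨zero A B⟩; letI : Add (A ⟶ B) := ⟨add⟩; nsmulRec
          zsmul := letI : Zero (A ⟶ B) := ⟨zero A B⟩; letI : Add (A ⟶ B) := ⟨add⟩
            letI : Neg (A ⟶ B) := ⟨fun x => (exists_neg A).choose ≫ x⟩; zsmulRec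
          add_assoc := assoc
          add_comm := comm
          zero_add := zero_add'
          add_zero := add_zero'
          neg_add_cancel x := ?_ }
      add_comp _ _ _ x y f := add_comp' x y f
      comp_add _ _ _ f x y := comp_add' f x y }
  change add ((exists_neg A).choose ≫ x) x = zero _ _
  nth_rw 2 [← Category.id_comp x]
  rw [← add_comp', comm, (exists_neg A).choose_spec, zero_comp']

end Abstract

variable {C : Type u} [Category.{v} C] [ModelCategory C] [MonoidalCategory C]
  [SymmetricCategory C] [MonoidalClosed C] [HasZeroObject C] [HasZeroMorphisms C]
  [TopologicalStructure C]

section SuspAdd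

open ZeroObject

/-- The pinch map from the double cone to the wedge of two suspensions. -/
def pinch (X : C) : DoubleCone X ⟶ Susp X ⨿ Susp X :=
  pushout.desc (coneToSusp X ≫ coprod.inl) (coneToSuspRev X ≫ coprod.inr) (by
    rw [reassoc_of% (coneBase_toSusp X), reassoc_of% (coneBase_toSuspRev X), zero_comp, zero_comp])

lemma pinch_desc_left (X : C) :
    pinch X ≫ coprod.desc (𝟙 _) 0 = doubleConeToSusp X := by
  apply pushout.hom_ext
  · rw [pinch, pushout.inl_desc_assoc, doubleConeToSusp, pushout.inl_desc, Category.assoc,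
      coprod.inl_desc, Category.comp_id]
  · rw [pinch, pushout.inr_desc_assoc, doubleConeToSusp, pushout.inr_desc, Category.assoc,
      coprod.inr_desc, comp_zero]

lemma pinch_desc_right (X : C) :
    pinch X ≫ coprod.desc 0 (𝟙 _) = doubleConeToSuspRev X := by
  apply pushout.hom_ext
  · rw [pinch, pushout.inl_desc_assoc, doubleConeToSuspRev, pushout.inl_desc, Category.assoc,
      coprod.inl_desc, comp_zero]
  · rw [pinch, pushout.inr_desc_assoc, doubleConeToSuspRev, pushout.inr_desc, Category.assoc,
      coprod.inr_desc, Category.comp_id]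

lemma pinch_naturality {X Y : C} (f : X ⟶ Y) :
    pinch X ≫ coprod.map (unitSusp C ◁ f) (unitSusp C ◁ f) =
      pushout.map _ _ _ _ (unitCone C ◁ f) (unitCone C ◁ f) f (coneBase_naturality f)
        (coneBase_naturality f) ≫ pinch Y := by
  apply pushout.hom_ext
  · simp only [pinch, pushout.map, pushout.inl_desc_assoc, Category.assoc, coprod.inl_map,
      pushout.inl_desc]
    rw [← Category.assoc, coneToSusp_naturality, Category.assoc]
  · simp only [pinch, pushout.map, pushout.inr_desc_assoc, Category.assoc, coprod.inr_map,
      pushout.inr_desc]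
    rw [← Category.assoc, coneToSuspRev_naturality, Category.assoc]

lemma doubleConeToSusp_naturality {X Y : C} (f : X ⟶ Y) :
    doubleConeToSusp X ≫ unitSusp C ◁ f =
      pushout.map _ _ _ _ (unitCone C ◁ f) (unitCone C ◁ f) f (coneBase_naturality f)
        (coneBase_naturality f) ≫ doubleConeToSusp Y := by
  apply pushout.hom_ext
  · simp only [doubleConeToSusp, pushout.map, pushout.inl_desc_assoc, Category.assoc,
      pushout.inl_desc]
    rw [coneToSusp_naturality]
  · simp only [doubleConeToSusp, pushout.map, pushout.inr_desc_assoc, Category.assoc,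
      pushout.inr_desc, zero_comp, comp_zero]

section

variable (X : C) [IsCofibrant X]

/-- The comultiplication of a suspension in the homotopy category. -/
def suspComul : (toHo C).obj (Susp X) ⟶ (toHo C).obj (Susp X ⨿ Susp X) :=
  inv ((toHo C).map (doubleConeToSusp X)) ≫ (toHo C).map (pinch X)

lemma suspComul_desc_left :
    suspComul X ≫ (toHo C).map (coprod.desc (𝟙 _) 0) = 𝟙 _ := by
  rw [suspComul, Category.assoc, ← Functor.map_comp, pinch_desc_left, IsIso.inv_hom_id]

/-- The second counit law is where the rotation of the double cone enters: the inverted map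
collapses the second cone, while this projection collapses the first. -/
lemma suspComul_desc_right :
    suspComul X ≫ (toHo C).map (coprod.desc 0 (𝟙 _)) = 𝟙 _ := by
  rw [suspComul, Category.assoc, ← Functor.map_comp, pinch_desc_right,
    toHo_map_doubleConeToSuspRev, IsIso.inv_hom_id]

lemma suspComul_naturality {X Y : C} [IsCofibrant X] [IsCofibrant Y] (f : X ⟶ Y) :
    (toHo C).map (unitSusp C ◁ f) ≫ suspComul Y =
      suspComul X ≫ (toHo C).map (coprod.map (unitSusp C ◁ f) (unitSusp C ◁ f)) := by
  rw [suspComul, suspComul, Category.assoc, IsIso.eq_inv_comp, ← Functor.map_comp,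
    pinch_naturality, ← Functor.map_comp_assoc, doubleConeToSusp_naturality]
  simp

/-- The addition of morphisms from a suspension in the homotopy category. -/
def suspAdd {Q : Ho C} (x y : (toHo C).obj (Susp X) ⟶ Q) : (toHo C).obj (Susp X) ⟶ Q :=
  suspComul X ≫ hoDesc x y

/-- The zero morphisms of the homotopy category. -/
def zeroHo (A B : Ho C) : A ⟶ B :=
  (isZero_toHo_zero (C := C)).from_ A ≫ (isZero_toHo_zero (C := C)).to_ B

lemma comp_zeroHo {A B : Ho C} (f : A ⟶ B) (Q : Ho C) : f ≫ zeroHo B Q = zeroHo A Q := by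
  rw [zeroHo, zeroHo, ← Category.assoc]
  congr 1
  exact (isZero_toHo_zero (C := C)).eq_of_tgt _ _

lemma zeroHo_comp {A B : Ho C} (Q : Ho C) (f : A ⟶ B) : zeroHo Q A ≫ f = zeroHo Q B := by
  rw [zeroHo, zeroHo, Category.assoc]
  congr 1
  exact (isZero_toHo_zero (C := C)).eq_of_src _ _

lemma eq_zeroHo_of_factor {A B : Ho C} {Q : Ho C} (h : IsZero Q) (f : A ⟶ Q) (g : Q ⟶ B) :
    f ≫ g = zeroHo A B := by
  rw [h.eq_of_src g (zeroHo _ _), comp_zeroHo]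

lemma toHo_map_zero (A B : C) : (toHo C).map (0 : A ⟶ B) = zeroHo _ _ := by
  have : (0 : A ⟶ B) = (0 : A ⟶ (0 : C)) ≫ 0 := by simp
  rw [this, Functor.map_comp]
  exact eq_zeroHo_of_factor isZero_toHo_zero _ _

variable {X} {Q : Ho C} (x y : (toHo C).obj (Susp X) ⟶ Q)

lemma suspAdd_zero : suspAdd X x (zeroHo _ _) = x := by
  have : hoDesc (V := Susp X) (W := Susp X) x (zeroHo _ _) = (toHo C).map (coprod.desc (𝟙 _) 0) ≫ x := by
    apply hoCoprod_hom_ext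
    · rw [inl_hoDesc, ← Functor.map_comp_assoc, coprod.inl_desc, CategoryTheory.Functor.map_id,
        Category.id_comp]
    · rw [inr_hoDesc, ← Functor.map_comp_assoc, coprod.inr_desc, toHo_map_zero, zeroHo_comp]
  rw [suspAdd, this, ← Category.assoc, suspComul_desc_left, Category.id_comp]

lemma zero_suspAdd : suspAdd X (zeroHo _ _) x = x := by
  have : hoDesc (V := Susp X) (W := Susp X) (zeroHo _ _) x = (toHo C).map (coprod.desc 0 (𝟙 _)) ≫ x := by
    apply hoCoprod_hom_ext
    · rw [inl_hoDesc, ← Functor.map_comp_assoc, coprod.inl_desc, toHo_map_zero, zeroHo_comp]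
    · rw [inr_hoDesc, ← Functor.map_comp_assoc, coprod.inr_desc, CategoryTheory.Functor.map_id,
        Category.id_comp]
  rw [suspAdd, this, ← Category.assoc, suspComul_desc_right, Category.id_comp]

lemma suspAdd_comp {R : Ho C} (f : Q ⟶ R) : suspAdd X x y ≫ f = suspAdd X (x ≫ f) (y ≫ f) := by
  rw [suspAdd, suspAdd, Category.assoc]
  congr 1
  apply hoCoprod_hom_ext
  · rw [inl_hoDesc, ← Category.assoc, inl_hoDesc]
  · rw [inr_hoDesc, ← Category.assoc, inr_hoDesc]

lemma toHo_map_comp_suspAdd {W : C} [IsCofibrant W] (f : W ⟶ X) :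
    (toHo C).map (unitSusp C ◁ f) ≫ suspAdd X x y =
      suspAdd W ((toHo C).map (unitSusp C ◁ f) ≫ x) ((toHo C).map (unitSusp C ◁ f) ≫ y) := by
  rw [suspAdd, suspAdd, ← Category.assoc, suspComul_naturality, Category.assoc]
  congr 1
  apply hoCoprod_hom_ext
  · rw [inl_hoDesc, ← Functor.map_comp_assoc, coprod.inl_map, Functor.map_comp_assoc, inl_hoDesc]
  · rw [inr_hoDesc, ← Functor.map_comp_assoc, coprod.inr_map, Functor.map_comp_assoc, inr_hoDesc]

end

variable [StableStructure C]

attribute [instance] StableStructure.isEquivalence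

/-- The comparison of the suspension functors. -/
abbrev suspIsoApp (V : C) [IsCofibrant V] :
    (StableStructure.susp (C := C)).obj ((toHo C).obj V) ≅ (toHo C).obj (Susp V) :=
  (StableStructure.suspIso (C := C)).app (CofibrantObject.mk V)

lemma suspIsoApp_naturality {V W : C} [IsCofibrant V] [IsCofibrant W] (f : V ⟶ W) :
    (StableStructure.susp (C := C)).map ((toHo C).map f) ≫ (suspIsoApp W).hom =
      (suspIsoApp V).hom ≫ (toHo C).map (unitSusp C ◁ f) :=
  (StableStructure.suspIso (C := C)).hom.naturality
    (X := CofibrantObject.mk V) (Y := CofibrantObject.mk W) ⟨f⟩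

/-- Every morphism of suspensions in the homotopy category desuspends. -/
lemma exists_eq_toHo_map_susp_comp_inv {V W : C} [IsCofibrant V] [IsCofibrant W]
    (h : (toHo C).obj (Susp V) ⟶ (toHo C).obj (Susp W)) :
    ∃ (W' : C) (_ : IsCofibrant W') (f : V ⟶ W') (j : W ⟶ W')
      (_ : IsIso ((toHo C).map (unitSusp C ◁ j))),
      h ≫ (toHo C).map (unitSusp C ◁ j) = (toHo C).map (unitSusp C ◁ f) := by
  obtain ⟨k, hk⟩ := (StableStructure.susp (C := C)).map_surjective
    ((suspIsoApp V).hom ≫ h ≫ (suspIsoApp W).inv)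
  -- The desuspended morphism is represented by a map only after a fibrant replacement of its
  -- target; `W'` stays cofibrant because `j` is a cofibration.
  obtain ⟨W', j, _, _, _⟩ := exists_fibrant_replacement W
  have : IsCofibrant W' := isCofibrant_of_cofibration j
  obtain ⟨f, hf⟩ := exists_toHo_map_eq (k ≫ (toHo C).map j)
  have e : (toHo C).map (unitSusp C ◁ j) = (suspIsoApp W).inv ≫
      (StableStructure.susp (C := C)).map ((toHo C).map j) ≫ (suspIsoApp W').hom := by
    rw [suspIsoApp_naturality, Iso.inv_hom_id_assoc]
  refine ⟨W', inferInstance, f, j, ?_, ?_⟩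
  · rw [e]; infer_instance
  · rw [← cancel_epi (suspIsoApp V).hom, ← suspIsoApp_naturality, hf, Functor.map_comp, hk, e]
    simp

/-- The comultiplication is natural for suspended maps only. Stability extends this to all morphisms
of suspensions, since each becomes a suspended map after composing with an invertible one. -/
lemma comp_suspAdd {V W : C} [IsCofibrant V] [IsCofibrant W] {Q : Ho C}
    (h : (toHo C).obj (Susp V) ⟶ (toHo C).obj (Susp W)) (x y : (toHo C).obj (Susp W) ⟶ Q) :
    h ≫ suspAdd W x y = suspAdd V (h ≫ x) (h ≫ y) := by
  obtain ⟨W', _, f, j, _, hh⟩ := exists_eq_toHo_map_susp_comp_inv h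
  have hx (x : (toHo C).obj (Susp W) ⟶ Q) : ∃ x', (toHo C).map (unitSusp C ◁ j) ≫ x' = x :=
    ⟨inv ((toHo C).map (unitSusp C ◁ j)) ≫ x, by simp⟩
  obtain ⟨x, rfl⟩ := hx x
  obtain ⟨y, rfl⟩ := hx y
  rw [← toHo_map_comp_suspAdd, reassoc_of% hh, reassoc_of% hh, reassoc_of% hh,
    toHo_map_comp_suspAdd]

lemma exists_iso_toHo_susp (A : Ho C) :
    ∃ (V : C) (_ : IsCofibrant V), Nonempty ((toHo C).obj (Susp V) ≅ A) := by
  obtain ⟨V, hV, ⟨e⟩⟩ := exists_iso_toHo_cofibrant ((StableStructure.susp (C := C)).objPreimage A)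
  exact ⟨V, hV, ⟨(suspIsoApp V).symm ≪≫ (StableStructure.susp (C := C)).mapIso e ≪≫
    (StableStructure.susp (C := C)).objObjPreimageIso A⟩⟩

/-- A desuspension of an object of the homotopy category. -/
def desusp (A : Ho C) : C := (exists_iso_toHo_susp A).choose

instance (A : Ho C) : IsCofibrant (desusp A) := (exists_iso_toHo_susp A).choose_spec.choose

/-- The identification of the suspension of the desuspension. -/
def suspDesuspIso (A : Ho C) : (toHo C).obj (Susp (desusp A)) ≅ A :=
  (exists_iso_toHo_susp A).choose_spec.choose_spec.some

/-- The addition of morphisms in the homotopy category. -/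
def hoAdd {A B : Ho C} (x y : A ⟶ B) : A ⟶ B :=
  (suspDesuspIso A).inv ≫ suspAdd _ ((suspDesuspIso A).hom ≫ x) ((suspDesuspIso A).hom ≫ y)

lemma hoAdd_comp {A B D : Ho C} (x y : A ⟶ B) (f : B ⟶ D) :
    hoAdd x y ≫ f = hoAdd (x ≫ f) (y ≫ f) := by
  simp only [hoAdd, Category.assoc, suspAdd_comp]

lemma comp_hoAdd {A B D : Ho C} (f : A ⟶ B) (x y : B ⟶ D) :
    f ≫ hoAdd x y = hoAdd (f ≫ x) (f ≫ y) := by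
  rw [hoAdd, hoAdd, ← cancel_epi (suspDesuspIso A).hom, Iso.hom_inv_id_assoc]
  have := comp_suspAdd ((suspDesuspIso A).hom ≫ f ≫ (suspDesuspIso B).inv)
    ((suspDesuspIso B).hom ≫ x) ((suspDesuspIso B).hom ≫ y)
  simpa using this

lemma hoAdd_zero {A B : Ho C} (x : A ⟶ B) : hoAdd x (zeroHo _ _) = x := by
  rw [hoAdd, comp_zeroHo, suspAdd_zero, Iso.inv_hom_id_assoc]

lemma zero_hoAdd {A B : Ho C} (x : A ⟶ B) : hoAdd (zeroHo _ _) x = x := by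
  rw [hoAdd, comp_zeroHo, zero_suspAdd, Iso.inv_hom_id_assoc]

/-- The map from the double cone to the wedge which uses the same cone coordinate twice. -/
def doublePinch (X : C) : DoubleCone X ⟶ Susp X ⨿ Susp X :=
  pushout.desc (coneToSusp X ≫ coprod.inl) (coneToSusp X ≫ coprod.inr) (by
    rw [reassoc_of% (coneBase_toSusp X), reassoc_of% (coneBase_toSusp X), zero_comp, zero_comp])

/-- The collapse of the first cone, without reversion of the cone coordinate. -/
def doubleConeToSuspRight (X : C) : DoubleCone X ⟶ Susp X :=
  pushout.desc 0 (coneToSusp X) (by rw [coneBase_toSusp, comp_zero])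

/-- With the same coordinate on both cones, the sum of the two collapses factors through the fold
map onto a single cone, which is contractible. The second collapse is therefore the negative of the
first. -/
lemma hoAdd_doubleCone (X : C) [IsCofibrant X] :
    hoAdd ((toHo C).map (doubleConeToSusp X)) ((toHo C).map (doubleConeToSuspRight X)) =
      zeroHo _ _ := by
  have h : hoAdd ((toHo C).map (coprod.desc (𝟙 (Susp X)) 0 ≫ coprod.inl))
      ((toHo C).map (coprod.desc 0 (𝟙 (Susp X)) ≫ coprod.inr)) = 𝟙 _ := by
    apply hoCoprod_hom_ext
    · rw [comp_hoAdd, ← Functor.map_comp, ← Functor.map_comp, coprod.inl_desc_assoc,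
        coprod.inl_desc_assoc, Category.id_comp, zero_comp, toHo_map_zero, hoAdd_zero,
        Category.comp_id]
    · rw [comp_hoAdd, ← Functor.map_comp, ← Functor.map_comp, coprod.inr_desc_assoc,
        coprod.inr_desc_assoc, Category.id_comp, zero_comp, toHo_map_zero, zero_hoAdd,
        Category.comp_id]
  have e₁ : doublePinch X ≫ (coprod.desc (𝟙 (Susp X)) 0 ≫ coprod.inl) ≫
      coprod.desc (𝟙 _) (𝟙 _) = doubleConeToSusp X := by
    rw [Category.assoc, coprod.inl_desc, Category.comp_id]
    apply pushout.hom_ext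
    · simp only [doublePinch, doubleConeToSusp, pushout.inl_desc_assoc, pushout.inl_desc,
        Category.assoc, coprod.inl_desc, Category.comp_id]
    · simp only [doublePinch, doubleConeToSusp, pushout.inr_desc_assoc, pushout.inr_desc,
        Category.assoc, coprod.inr_desc, comp_zero]
  have e₂ : doublePinch X ≫ (coprod.desc 0 (𝟙 (Susp X)) ≫ coprod.inr) ≫
      coprod.desc (𝟙 _) (𝟙 _) = doubleConeToSuspRight X := by
    rw [Category.assoc, coprod.inr_desc, Category.comp_id]
    apply pushout.hom_ext
    · simp only [doublePinch, doubleConeToSuspRight, pushout.inl_desc_assoc, pushout.inl_desc,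
        Category.assoc, coprod.inl_desc, comp_zero]
    · simp only [doublePinch, doubleConeToSuspRight, pushout.inr_desc_assoc, pushout.inr_desc,
        Category.assoc, coprod.inr_desc, Category.comp_id]
  have e₃ : doublePinch X ≫ coprod.desc (𝟙 _) (𝟙 _) =
      pushout.desc (𝟙 _) (𝟙 _) rfl ≫ coneToSusp X := by
    apply pushout.hom_ext
    · simp only [doublePinch, pushout.inl_desc_assoc, Category.assoc, coprod.inl_desc,
        Category.id_comp, Category.comp_id]
    · simp only [doublePinch, pushout.inr_desc_assoc, Category.assoc, coprod.inr_desc,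
        Category.id_comp, Category.comp_id]
  rw [← e₁, ← e₂, Functor.map_comp, Functor.map_comp _ (doublePinch X), ← comp_hoAdd,
    Functor.map_comp _ _ (coprod.desc (𝟙 (Susp X)) (𝟙 (Susp X))),
    Functor.map_comp _ _ (coprod.desc (𝟙 (Susp X)) (𝟙 (Susp X))), ← hoAdd_comp, h,
    Category.id_comp, ← Functor.map_comp, e₃, Functor.map_comp]
  exact eq_zeroHo_of_factor (isZero_toHo_of_isContractible _) _ _

/-- The homotopy category of a stable model category is preadditive. -/
instance preadditiveHo : Preadditive (Ho C) :=
  preadditiveOfAdd hoAdd zeroHo zeroHo_comp comp_hoAdd hoAdd_comp hoAdd_zero zero_hoAdd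
    (fun A => by
      -- Through the identification by the first collapse, the second collapse becomes a self-map of
      -- `A`, which is the negative of the identity.
      let e := asIso ((toHo C).map (doubleConeToSusp (desusp A))) ≪≫ suspDesuspIso A
      refine ⟨e.inv ≫ (toHo C).map (doubleConeToSuspRight (desusp A)) ≫ (suspDesuspIso A).hom, ?_⟩
      rw [← cancel_epi e.hom, comp_hoAdd, Iso.hom_inv_id_assoc, Category.comp_id, comp_zeroHo]
      change hoAdd (_ ≫ (suspDesuspIso A).hom) _ = _
      rw [← hoAdd_comp]
      change hoAdd ((toHo C).map _) _ ≫ _ = _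
      rw [hoAdd_doubleCone, zeroHo_comp])
    (fun A => by
      obtain ⟨V, _, ⟨e⟩⟩ := exists_iso_toHo_cofibrant A
      refine ⟨(toHo C).obj (V ⨿ V), e.inv ≫ (toHo C).map coprod.inl,
        e.inv ≫ (toHo C).map coprod.inr, fun x y => ?_⟩
      obtain ⟨z, h₁, h₂⟩ := exists_hoCoprod_desc (e.hom ≫ x) (e.hom ≫ y)
      exact ⟨z, by rw [Category.assoc, h₁, Iso.inv_hom_id_assoc],
        by rw [Category.assoc, h₂, Iso.inv_hom_id_assoc]⟩)

lemma toHo_map_zero_eq (A B : C) : (toHo C).map (0 : A ⟶ B) = 0 := toHo_map_zero A B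

lemma hoZero_eq (A B : C) : hoZero A B = 0 := toHo_map_zero A B

lemma toHo_map_doubleConeToSuspRight (X : C) [IsCofibrant X] :
    (toHo C).map (doubleConeToSuspRight X) = -(toHo C).map (doubleConeToSusp X) :=
  eq_neg_of_add_eq_zero_right (hoAdd_doubleCone X)

/-- The biproduct decomposition: it lets sums defined through a coproduct be compared with the
preadditive addition. -/
lemma id_hoCoprod_eq (V W : C) [IsCofibrant V] [IsCofibrant W] :
    𝟙 ((toHo C).obj (V ⨿ W)) = (toHo C).map (coprod.desc (𝟙 _) 0) ≫ (toHo C).map coprod.inl +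
      (toHo C).map (coprod.desc 0 (𝟙 _)) ≫ (toHo C).map coprod.inr := by
  apply hoCoprod_hom_ext
  · rw [Preadditive.comp_add]
    simp only [← Functor.map_comp]
    rw [coprod.inl_desc_assoc, coprod.inl_desc_assoc, Category.id_comp, zero_comp, toHo_map_zero_eq,
      add_zero, Category.comp_id]
  · rw [Preadditive.comp_add]
    simp only [← Functor.map_comp]
    rw [coprod.inr_desc_assoc, coprod.inr_desc_assoc, Category.id_comp, zero_comp, toHo_map_zero_eq,
      zero_add, Category.comp_id]

/-- The addition used in the definition of the spectral sequence is the one of the preadditive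
structure. -/
lemma isSum_iff {V Y : C} [IsCofibrant V] {x y z : HoHom V Y} : IsSum x y z ↔ z = x + y := by
  constructor
  · rintro ⟨δ, h, h₁, h₂, rfl, rfl, rfl⟩
    have := δ ≫= (id_hoCoprod_eq V V =≫ h)
    rw [Category.id_comp, Preadditive.add_comp, Preadditive.comp_add, Category.assoc,
      Category.assoc, reassoc_of% h₁, reassoc_of% h₂] at this
    exact this
  · rintro rfl
    refine ⟨(toHo C).map coprod.inl + (toHo C).map coprod.inr, hoDesc x y, ?_, ?_,
      inl_hoDesc _ _, inr_hoDesc _ _, ?_⟩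
    · rw [Preadditive.add_comp, ← Functor.map_comp, ← Functor.map_comp, coprod.inl_desc,
        coprod.inr_desc, toHo_map_zero_eq, add_zero, CategoryTheory.Functor.map_id]
    · rw [Preadditive.add_comp, ← Functor.map_comp, ← Functor.map_comp, coprod.inl_desc,
        coprod.inr_desc, toHo_map_zero_eq, zero_add, CategoryTheory.Functor.map_id]
    · rw [Preadditive.add_comp, inl_hoDesc, inr_hoDesc]

/-- A map from the double cone which vanishes on the common base is a difference. -/
lemma toHo_map_doubleCone {X Y : C} [IsCofibrant X] (φ : DoubleCone X ⟶ Y) (f g : Susp X ⟶ Y)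
    (hf : pushout.inl _ _ ≫ φ = coneToSusp X ≫ f) (hg : pushout.inr _ _ ≫ φ = coneToSusp X ≫ g) :
    (toHo C).map φ =
      (toHo C).map (doubleConeToSusp X) ≫ ((toHo C).map f - (toHo C).map g) := by
  have h : φ = doublePinch X ≫ coprod.desc f g := by
    apply pushout.hom_ext
    · rw [hf, doublePinch, pushout.inl_desc_assoc, Category.assoc, coprod.inl_desc]
    · rw [hg, doublePinch, pushout.inr_desc_assoc, Category.assoc, coprod.inr_desc]
  have e₁ : doublePinch X ≫ coprod.desc (𝟙 (Susp X)) 0 = doubleConeToSusp X := by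
    apply pushout.hom_ext
    · simp only [doublePinch, doubleConeToSusp, pushout.inl_desc_assoc, pushout.inl_desc,
        Category.assoc, coprod.inl_desc, Category.comp_id]
    · simp only [doublePinch, doubleConeToSusp, pushout.inr_desc_assoc, pushout.inr_desc,
        Category.assoc, coprod.inr_desc, comp_zero]
  have e₂ : doublePinch X ≫ coprod.desc 0 (𝟙 (Susp X)) = doubleConeToSuspRight X := by
    apply pushout.hom_ext
    · simp only [doublePinch, doubleConeToSuspRight, pushout.inl_desc_assoc, pushout.inl_desc,
        Category.assoc, coprod.inl_desc, comp_zero]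
    · simp only [doublePinch, doubleConeToSuspRight, pushout.inr_desc_assoc, pushout.inr_desc,
        Category.assoc, coprod.inr_desc, Category.comp_id]
  have := (toHo C).map (doublePinch X) ≫= (id_hoCoprod_eq (Susp X) (Susp X) =≫
    (toHo C).map (coprod.desc f g))
  rw [Category.id_comp, Preadditive.add_comp, Preadditive.comp_add, Category.assoc,
    Category.assoc, ← Functor.map_comp _ coprod.inl, ← Functor.map_comp _ coprod.inr,
    ← Functor.map_comp, coprod.inl_desc, coprod.inr_desc, ← Functor.map_comp_assoc, e₁, ← Functor.map_comp_assoc, e₂,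
    toHo_map_doubleConeToSuspRight, ← h] at this
  rw [this, Preadditive.comp_sub, Preadditive.neg_comp, sub_eq_add_neg]

end SuspAdd

end

section

/-! ### Homotopy cofibers -/

lemma IsCoker.pushout_desc_left {C : Type u} [Category.{v} C] [HasZeroMorphisms C] {A B D Q : C}
    {j : A ⟶ D} {q : D ⟶ Q} (h : IsCoker j q) (i : A ⟶ B) [HasPushout i j] {w} :
    IsCoker (pushout.inl i j) (pushout.desc 0 q w) := by
  refine ⟨pushout.inl_desc _ _ _, fun f hf => ?_, ?_⟩
  · obtain ⟨g, hg⟩ := h.exists_desc (pushout.inr _ _ ≫ f) (by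
      rw [← pushout.condition_assoc, hf, comp_zero])
    refine ⟨g, pushout.hom_ext ?_ ?_⟩
    · rw [pushout.inl_desc_assoc, hf, zero_comp]
    · rw [pushout.inr_desc_assoc, hg]
  · have := h.epi
    have : Epi (pushout.inr _ _ ≫ pushout.desc 0 q w) := by rwa [pushout.inr_desc]
    exact epi_of_epi (pushout.inr _ _) _

variable {C : Type u} [Category.{v} C] [ModelCategory C] [MonoidalCategory C]
  [SymmetricCategory C] [MonoidalClosed C] [HasZeroObject C] [HasZeroMorphisms C]
  [TopologicalStructure C]

open ZeroObject

section

variable {P R : C} (g : P ⟶ R)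

lemma isCoker_quoProj : IsCoker (cofIncl g) (quoProj g) := isCoker_cokernel _

instance isCofibrant_quo : IsCofibrant (Quo g) := (isCoker_quoProj g).cofibration_zero

/-- The inclusion of the target in the mapping cone. -/
def cofibInl : cofTgt g ⟶ Cofib g := pushout.inl (cofIncl g) (coneBase (cofSrc P))

/-- The inclusion of the cone in the mapping cone. -/
def cofibInr : Cone (cofSrc P) ⟶ Cofib g := pushout.inr (cofIncl g) (coneBase (cofSrc P))

lemma cofib_condition : cofIncl g ≫ cofibInl g = coneBase _ ≫ cofibInr g := pushout.condition

variable {g} in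
lemma cofib_hom_ext {Y : C} {f f' : Cofib g ⟶ Y} (h₁ : cofibInl g ≫ f = cofibInl g ≫ f')
    (h₂ : cofibInr g ≫ f = cofibInr g ≫ f') : f = f' := pushout.hom_ext h₁ h₂

/-- The map from the mapping cone defined by maps from the target and from the cone. -/
def cofibDesc {Y : C} (a : cofTgt g ⟶ Y) (b : Cone (cofSrc P) ⟶ Y)
    (w : cofIncl g ≫ a = coneBase _ ≫ b) : Cofib g ⟶ Y := pushout.desc a b w

lemma cofibInl_desc {Y : C} (a : cofTgt g ⟶ Y) (b : Cone (cofSrc P) ⟶ Y)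
    (w : cofIncl g ≫ a = coneBase _ ≫ b) : cofibInl g ≫ cofibDesc g a b w = a :=
  pushout.inl_desc _ _ _

lemma cofibInr_desc {Y : C} (a : cofTgt g ⟶ Y) (b : Cone (cofSrc P) ⟶ Y)
    (w : cofIncl g ≫ a = coneBase _ ≫ b) : cofibInr g ≫ cofibDesc g a b w = b :=
  pushout.inr_desc _ _ _

lemma cofibInl_toQuo : cofibInl g ≫ cofibToQuo g = quoProj g := pushout.inl_desc _ _ _

lemma cofibInr_toQuo : cofibInr g ≫ cofibToQuo g = 0 := pushout.inr_desc _ _ _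

lemma cofibInl_toSusp : cofibInl g ≫ cofibToSusp g = 0 := pushout.inl_desc _ _ _

lemma cofibInr_toSusp : cofibInr g ≫ cofibToSusp g = coneToSuspRev _ := pushout.inr_desc _ _ _

lemma hoToCofib_eq :
    hoToCofib g = inv ((toHo C).map (cofTgtProj g)) ≫ (toHo C).map (cofibInl g) := rfl

instance isIso_toHo_cofibToQuo : IsIso ((toHo C).map (cofibToQuo g)) :=
  ((isCoker_quoProj g).pushout_desc (coneBase (cofSrc P))).isIso_toHo_map

lemma cofIncl_quoProj : cofIncl g ≫ quoProj g = 0 := (isCoker_quoProj g).w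

lemma hoToCofib_cofibToQuo : hoToCofib g ≫ (toHo C).map (cofibToQuo g) =
    inv ((toHo C).map (cofTgtProj g)) ≫ (toHo C).map (quoProj g) := by
  rw [hoToCofib_eq, Category.assoc, ← Functor.map_comp, cofibInl_toQuo]

lemma toHo_map_hoToCofib {W : C} {x : W ⟶ R} {x' : W ⟶ cofTgt g} (h : x' ≫ cofTgtProj g = x) :
    ((toHo C).map x ≫ hoToCofib g) ≫ (toHo C).map (cofibToQuo g) =
      (toHo C).map (x' ≫ quoProj g) := by
  rw [Category.assoc, hoToCofib_cofibToQuo, ← h, Functor.map_comp, Category.assoc,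
    IsIso.hom_inv_id_assoc, Functor.map_comp]

/-- A map of pairs `(C W, W) ⟶ (R, P)` defines a map to the quotient, after the choice of lifts to
the cofibrant replacements. -/
def IsPairMap {W : C} (Φ : Cone W ⟶ R) (γ : W ⟶ P) (q : Susp W ⟶ Quo g) : Prop :=
  ∃ (Φ' : Cone W ⟶ cofTgt g) (γ' : W ⟶ cofSrc P), coneBase W ≫ Φ' = γ' ≫ cofIncl g ∧
    Φ' ≫ cofTgtProj g = Φ ∧ γ' ≫ cofSrcProj P = γ ∧ coneToSusp W ≫ q = Φ' ≫ quoProj g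

variable {g}

lemma exists_isPairMap {W : C} [IsCofibrant W] {Φ : Cone W ⟶ R} {γ : W ⟶ P}
    (h : coneBase W ≫ Φ = γ ≫ g) : ∃ q, IsPairMap g Φ γ q := by
  obtain ⟨γ', hγ⟩ := exists_lift_of_isCofibrant (cofSrcProj P) γ
  obtain ⟨Φ', h₁, h₂⟩ := exists_lift (coneBase W) (cofTgtProj g) (f := γ' ≫ cofIncl g) (g := Φ) (by
    rw [Category.assoc, cofIncl_comp_cofTgtProj, reassoc_of% hγ, h])
  obtain ⟨q, hq⟩ := (isCoker_coneToSusp W).exists_desc (Φ' ≫ quoProj g) (by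
    rw [reassoc_of% h₁, cofIncl_quoProj, comp_zero])
  exact ⟨q, Φ', γ', h₁, h₂, hγ, hq⟩

/-- The class of the map to the quotient does not depend on the choice of lifts. -/
lemma IsPairMap.toHo_map_eq {W : C} [IsCofibrant W] {Φ : Cone W ⟶ R} {γ : W ⟶ P}
    {q₀ q₁ : Susp W ⟶ Quo g} (h₀ : IsPairMap g Φ γ q₀) (h₁ : IsPairMap g Φ γ q₁) :
    (toHo C).map q₀ = (toHo C).map q₁ := by
  obtain ⟨Φ₀, γ₀, w₀, hΦ₀, hγ₀, hq₀⟩ := h₀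
  obtain ⟨Φ₁, γ₁, w₁, hΦ₁, hγ₁, hq₁⟩ := h₁
  obtain ⟨π, hπ⟩ := exists_unitInt_retraction C
  let pr (X : C) : unitInt C ⊗ X ⟶ X := π ▷ X ≫ (λ_ X).hom
  have hpr (t : unitInterval) (X : C) : cylPt t X ≫ pr X = 𝟙 X := cylPt_retraction hπ t X
  have hn {X Y : C} (f : X ⟶ Y) : unitInt C ◁ f ≫ pr Y = pr X ≫ f := by
    simp only [pr, Category.assoc, ← leftUnitor_naturality]
    rw [whisker_exchange_assoc]
  -- Two lifts of `γ` along a trivial fibration are joined by a homotopy over `γ`. It is then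
  -- extended to a homotopy of the lifts of `Φ`, with the base and both ends prescribed, and passes
  -- to the quotients.
  obtain ⟨γ', hγ'₀, hγ'₁, hγ'⟩ := exists_lift_cylinder W (cofSrcProj P) γ₀ γ₁ (pr W ≫ γ)
    (by rw [reassoc_of% hpr, hγ₀]) (by rw [reassoc_of% hpr, hγ₁])
  obtain ⟨Φ', hΦ', hΦ'₀, hΦ'₁, -⟩ := exists_lift_cylinder_rel (coneBase W) (cofTgtProj g)
    (γ' ≫ cofIncl g) Φ₀ Φ₁ (pr _ ≫ Φ) (by rw [reassoc_of% hγ'₀, w₀])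
    (by rw [reassoc_of% hγ'₁, w₁])
    (by rw [reassoc_of% hn, Category.assoc, cofIncl_comp_cofTgtProj, reassoc_of% hγ', ← hΦ₀,
      reassoc_of% w₀, cofIncl_comp_cofTgtProj, reassoc_of% hγ₀])
    (by rw [reassoc_of% hpr, hΦ₀]) (by rw [reassoc_of% hpr, hΦ₁])
  obtain ⟨q, hq⟩ := ((isCoker_coneToSusp W).whiskerLeft (unitInt C)).exists_desc
    (Φ' ≫ quoProj g) (by rw [reassoc_of% hΦ', cofIncl_quoProj, comp_zero])
  have e₀ : cylPt 0 (Susp W) ≫ q = q₀ := by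
    rw [← cancel_epi (coneToSusp W), ← Category.assoc, cylPt_naturality, Category.assoc, hq,
      reassoc_of% hΦ'₀, hq₀]
  have e₁ : cylPt 1 (Susp W) ≫ q = q₁ := by
    rw [← cancel_epi (coneToSusp W), ← Category.assoc, cylPt_naturality, Category.assoc, hq,
      reassoc_of% hΦ'₁, hq₁]
  rw [← e₀, ← e₁, Functor.map_comp, Functor.map_comp, toHo_map_cylPt]

end

section

variable {W Y : C} [IsCofibrant W]

lemma exists_nullhomotopy [IsFibrant Y] {f : W ⟶ Y} (h : (toHo C).map f = (toHo C).map 0) :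
    ∃ F : Cone W ⟶ Y, coneBase W ≫ F = f := by
  obtain ⟨F, h, -⟩ := exists_extension (coneBase W) (f := f) (g := 0) (by rw [h, comp_zero])
  exact ⟨F, h⟩

end

/-! ### Connecting morphisms and exactness -/

section Stable

variable [StableStructure C]

lemma comp_eq_zero_of_isContractible {A B : Ho C} (X : C) [IsContractible X]
    (f : A ⟶ (toHo C).obj X) (g : (toHo C).obj X ⟶ B) : f ≫ g = 0 :=
  eq_zeroHo_of_factor (isZero_toHo_of_isContractible X) f g

/-- The image in the cofiber of a map from the double cone is the difference of the classes of its
restrictions to the two cones, as maps of pairs. -/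
lemma IsPairMap.toHo_map_doubleCone {P R : C} {g : P ⟶ R} {W : C} [IsCofibrant W]
    {Φ₀ Φ₁ : Cone W ⟶ R} {γ : W ⟶ P} {q₀ q₁ : Susp W ⟶ Quo g} (h₀ : IsPairMap g Φ₀ γ q₀)
    (h₁ : IsPairMap g Φ₁ γ q₁) (φ : DoubleCone W ⟶ R) (e₀ : pushout.inl _ _ ≫ φ = Φ₀)
    (e₁ : pushout.inr _ _ ≫ φ = Φ₁) :
    (toHo C).map φ ≫ hoToCofib g ≫ (toHo C).map (cofibToQuo g) =
      (toHo C).map (doubleConeToSusp W) ≫ ((toHo C).map q₀ - (toHo C).map q₁) := by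
  obtain ⟨Φ₀', γ', w₀, hΦ₀, hγ, hq₀⟩ := id h₀
  -- The second cone is lifted afresh, with the same `γ'` on the base, so that the two lifts glue;
  -- this does not change the class of `q₁`.
  obtain ⟨Φ₁', w₁, hΦ₁⟩ := exists_lift (coneBase W) (cofTgtProj g) (f := γ' ≫ cofIncl g)
    (g := Φ₁) (by rw [Category.assoc, cofIncl_comp_cofTgtProj, reassoc_of% hγ, ← e₁,
      ← pushout.condition_assoc, e₀, ← hΦ₀, reassoc_of% w₀, cofIncl_comp_cofTgtProj,
      reassoc_of% hγ])
  obtain ⟨q, hq⟩ := (isCoker_coneToSusp W).exists_desc (Φ₁' ≫ quoProj g) (by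
    rw [reassoc_of% w₁, cofIncl_quoProj, comp_zero])
  rw [h₁.toHo_map_eq ⟨Φ₁', γ', w₁, hΦ₁, hγ, hq⟩]
  let φ' : DoubleCone W ⟶ cofTgt g := pushout.desc Φ₀' Φ₁' (by rw [w₀, w₁])
  have hφ' : φ' ≫ cofTgtProj g = φ := by
    apply pushout.hom_ext
    · rw [e₀, ← hΦ₀, pushout.inl_desc_assoc]
    · rw [e₁, ← hΦ₁, pushout.inr_desc_assoc]
  rw [← Category.assoc, toHo_map_hoToCofib g hφ']
  apply TodaMassey.toHo_map_doubleCone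
  · rw [pushout.inl_desc_assoc, hq₀]
  · rw [pushout.inr_desc_assoc, hq]

lemma hoSusp_eq {V Y : C} [IsCofibrant V] (y : HoHom V Y) :
    hoSusp y = (suspIsoApp V).inv ≫ (StableStructure.susp (C := C)).map y := rfl

lemma hoSusp_injective {V Y : C} [IsCofibrant V] {y y' : HoHom V Y} (h : hoSusp y = hoSusp y') :
    y = y' := by
  rw [hoSusp_eq, hoSusp_eq, cancel_epi] at h
  exact (StableStructure.susp (C := C)).map_injective h

lemma hoSusp_zero {V Y : C} [IsCofibrant V] : hoSusp (0 : HoHom V Y) = 0 := by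
  rw [hoSusp_eq, Functor.map_zero, comp_zero]

lemma toHo_map_comp_hoSusp {V V' Y : C} [IsCofibrant V] [IsCofibrant V'] (f : V ⟶ V')
    (y : HoHom V' Y) :
    (toHo C).map (unitSusp C ◁ f) ≫ hoSusp y = hoSusp ((toHo C).map f ≫ y) := by
  rw [hoSusp_eq, hoSusp_eq, ← cancel_epi (suspIsoApp V).hom, Functor.map_comp,
    Iso.hom_inv_id_assoc, ← reassoc_of% suspIsoApp_naturality, Iso.hom_inv_id_assoc]

lemma hoSusp_comp {V Y Y' : C} [IsCofibrant V] (y : HoHom V Y) (z : HoHom Y Y') :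
    hoSusp y ≫ (StableStructure.susp (C := C)).map z = hoSusp (y ≫ z) := by
  rw [hoSusp_eq, hoSusp_eq, Category.assoc, Functor.map_comp]

lemma exists_hoSusp_eq {V Y : C} [IsCofibrant V]
    (z : (toHo C).obj (Susp V) ⟶ (StableStructure.susp (C := C)).obj ((toHo C).obj Y)) :
    ∃ y : HoHom V Y, hoSusp y = z := by
  obtain ⟨y, hy⟩ := (StableStructure.susp (C := C)).map_surjective ((suspIsoApp V).hom ≫ z)
  exact ⟨y, by rw [hoSusp_eq, hy, Iso.inv_hom_id_assoc]⟩

variable {P R : C} (g : P ⟶ R)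

lemma hoToCofib_hoConn : hoToCofib g ≫ hoConn g = 0 := by
  rw [hoToCofib_eq, hoConn, Category.assoc, ← Functor.map_comp_assoc, cofibInl_toSusp,
    toHo_map_zero_eq, zero_comp, comp_zero]

/-- Extending the mapping cone over the inclusion, the collapse to the suspension of the target
factors through the contractible cone on the target. -/
lemma hoConn_susp_map : hoConn g ≫ (StableStructure.susp (C := C)).map ((toHo C).map g) = 0 := by
  have h : cofibToSusp g ≫ unitSusp C ◁ cofIncl g =
      cofibDesc g (coneBase _) (unitCone C ◁ cofIncl g) (coneBase_naturality _).symm ≫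
        coneToSuspRev _ := by
    apply cofib_hom_ext
    · rw [reassoc_of% cofibInl_toSusp, reassoc_of% cofibInl_desc, zero_comp, coneBase_toSuspRev]
    · rw [reassoc_of% cofibInr_toSusp, reassoc_of% cofibInr_desc, coneToSuspRev_naturality]
  rw [hoConn, Category.assoc, hoSusp_comp, ← Functor.map_comp, ← cofIncl_comp_cofTgtProj,
    Functor.map_comp _ (cofIncl g), ← toHo_map_comp_hoSusp, ← Functor.map_comp_assoc, h,
    Functor.map_comp, Category.assoc]
  exact comp_eq_zero_of_isContractible _ _ _

variable {g}

/-- The connecting morphism maps the class of a map of pairs to the suspension of its restriction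
to the base. -/
lemma IsPairMap.comp_hoConn {W : C} [IsCofibrant W] {Φ : Cone W ⟶ R} {γ : W ⟶ P}
    {q : Susp W ⟶ Quo g} (h : IsPairMap g Φ γ q) :
    ((toHo C).map q ≫ inv ((toHo C).map (cofibToQuo g))) ≫ hoConn g =
      hoSusp ((toHo C).map γ) := by
  obtain ⟨Φ', γ', w, -, rfl, hq⟩ := h
  -- One map compares both collapses: collapsing the cone of `Cofib g` gives `q` on the first half,
  -- collapsing the target gives `Σ γ'` on the second. The rotation identifies the two projections
  -- of the double cone.
  let φ : DoubleCone W ⟶ Cofib g := pushout.desc (Φ' ≫ cofibInl g)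
    (unitCone C ◁ γ' ≫ cofibInr g) (by
      rw [reassoc_of% w, reassoc_of% (coneBase_naturality γ'), cofib_condition])
  have h₁ : φ ≫ cofibToQuo g = doubleConeToSusp W ≫ q := by
    apply pushout.hom_ext
    · rw [pushout.inl_desc_assoc, doubleConeToSusp, pushout.inl_desc_assoc,
        Category.assoc, cofibInl_toQuo, hq]
    · rw [pushout.inr_desc_assoc, doubleConeToSusp, pushout.inr_desc_assoc,
        Category.assoc, cofibInr_toQuo, zero_comp, comp_zero]
  have h₂ : φ ≫ cofibToSusp g = doubleConeToSuspRev W ≫ unitSusp C ◁ γ' := by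
    apply pushout.hom_ext
    · rw [pushout.inl_desc_assoc, doubleConeToSuspRev, pushout.inl_desc_assoc,
        Category.assoc, cofibInl_toSusp, zero_comp, comp_zero]
    · rw [pushout.inr_desc_assoc, doubleConeToSuspRev, pushout.inr_desc_assoc,
        Category.assoc, cofibInr_toSusp, coneToSuspRev_naturality]
  have h₃ : (toHo C).map q ≫ inv ((toHo C).map (cofibToQuo g)) =
      inv ((toHo C).map (doubleConeToSusp W)) ≫ (toHo C).map φ := by
    rw [IsIso.comp_inv_eq, Category.assoc, IsIso.eq_inv_comp, ← Functor.map_comp,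
      ← Functor.map_comp, h₁]
  rw [h₃, hoConn, Category.assoc, ← Functor.map_comp_assoc, h₂, Functor.map_comp, Category.assoc,
    toHo_map_doubleConeToSuspRev, IsIso.inv_hom_id_assoc, toHo_map_comp_hoSusp, Functor.map_comp]

/-- Exactness for a cofibration. -/
lemma exists_lift_of_comp_pushout_inl_eq_zero {A B W : C} (i : A ⟶ B) [Cofibration i]
    [IsCofibrant A] [IsCofibrant W] (f : W ⟶ B)
    (hf : (toHo C).map (f ≫ pushout.inl i (coneBase A)) = 0) :
    ∃ y : HoHom W A, y ≫ (toHo C).map i = (toHo C).map f := by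
  have : IsCofibrant B := isCofibrant_of_cofibration i
  -- An actual null homotopy needs a fibrant target. The iterated mapping cone is therefore formed
  -- over `Z` as well, and `ι` compares it with the one over `pushout i (coneBase A)`.
  obtain ⟨Z, j, _, _, _⟩ := exists_fibrant_replacement (pushout i (coneBase A))
  obtain ⟨K, hK⟩ := exists_nullhomotopy (f := f ≫ pushout.inl _ _ ≫ j) (by
    rw [← Category.assoc, Functor.map_comp, hf, zero_comp, toHo_map_zero_eq])
  let b : B ⟶ pushout i (coneBase A) := pushout.inl _ _
  have : IsCofibrant (pushout i (coneBase A)) := isCofibrant_of_cofibration b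
  let ι : pushout b (coneBase B) ⟶ pushout (b ≫ j) (coneBase B) :=
    pushout.desc (j ≫ pushout.inl _ _) (pushout.inr _ _) (by
      rw [← pushout.condition, Category.assoc])
  have hι : trivialCofibrations C ι := by
    refine MorphismProperty.of_isPushout (IsPushout.flip <| IsPushout.of_left (h₁₁ := b) (h₁₂ := j)
      (v₁₁ := coneBase B) (h₂₁ := pushout.inr _ _) (v₁₂ := pushout.inl _ _)
      (v₁₃ := pushout.inl _ _) (h₂₂ := ι) ?_ (pushout.inl_desc _ _ _).symm
      (IsPushout.of_hasPushout _ _)) ?_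
    · rw [pushout.inr_desc]
      exact IsPushout.of_hasPushout _ _
    · exact (mem_trivialCofibrations_iff _).2 ⟨inferInstance, inferInstance⟩
  have : WeakEquivalence ι := ((mem_trivialCofibrations_iff _).1 hι).2
  -- Collapsing the cone on `B` in the iterated mapping cone leaves `Σ A`. Hence the double cone on
  -- `A`, included by `d`, is equivalent to the iterated mapping cone.
  let t : pushout b (coneBase B) ⟶ Susp A := pushout.desc (pushout.desc 0 (coneToSusp A) (by
    rw [comp_zero, coneBase_toSusp])) 0 (by rw [pushout.inl_desc, comp_zero])
  have : IsIso ((toHo C).map t) :=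
    (((isCoker_coneToSusp A).pushout_desc_left i).pushout_desc (coneBase B)).isIso_toHo_map
  let d : DoubleCone A ⟶ pushout b (coneBase B) := pushout.desc
    (pushout.inr _ _ ≫ pushout.inl _ _) (unitCone C ◁ i ≫ pushout.inr _ _) (by
      rw [reassoc_of% (coneBase_naturality i), ← pushout.condition, pushout.condition_assoc])
  have hdt : d ≫ t = doubleConeToSusp A := by
    apply pushout.hom_ext
    · rw [pushout.inl_desc_assoc, Category.assoc, pushout.inl_desc, pushout.inr_desc,
        doubleConeToSusp, pushout.inl_desc]
    · rw [pushout.inr_desc_assoc, Category.assoc, pushout.inr_desc, comp_zero,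
        doubleConeToSusp, pushout.inr_desc]
  have : IsIso ((toHo C).map d) := by
    have : (toHo C).map d ≫ (toHo C).map t = (toHo C).map (doubleConeToSusp A) := by
      rw [← Functor.map_comp, hdt]
    exact IsIso.of_isIso_fac_right this
  let s : pushout (b ≫ j) (coneBase B) ⟶ Susp B := pushout.desc 0 (coneToSuspRev B) (by
    rw [comp_zero, coneBase_toSuspRev])
  have hds : d ≫ ι ≫ s = doubleConeToSuspRev A ≫ unitSusp C ◁ i := by
    apply pushout.hom_ext
    · rw [pushout.inl_desc_assoc, Category.assoc, pushout.inl_desc_assoc, Category.assoc,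
        pushout.inl_desc, comp_zero, comp_zero, doubleConeToSuspRev, pushout.inl_desc_assoc,
        zero_comp]
    · rw [pushout.inr_desc_assoc, Category.assoc, pushout.inr_desc_assoc,
        pushout.inr_desc, doubleConeToSuspRev, pushout.inr_desc_assoc, coneToSuspRev_naturality]
  -- The null homotopy `K` on one cone and the cone on `f` on the other: the Puppe construction of a
  -- map from `Σ W` to the iterated mapping cone.
  let θ : DoubleCone W ⟶ pushout (b ≫ j) (coneBase B) := pushout.desc
    (K ≫ pushout.inl _ _) (unitCone C ◁ f ≫ pushout.inr _ _) (by
      rw [reassoc_of% hK, reassoc_of% (coneBase_naturality f), ← pushout.condition,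
        Category.assoc])
  have hθ : θ ≫ s = doubleConeToSuspRev W ≫ unitSusp C ◁ f := by
    apply pushout.hom_ext
    · rw [pushout.inl_desc_assoc, Category.assoc, pushout.inl_desc, comp_zero,
        doubleConeToSuspRev, pushout.inl_desc_assoc, zero_comp]
    · rw [pushout.inr_desc_assoc, Category.assoc, pushout.inr_desc,
        doubleConeToSuspRev, pushout.inr_desc_assoc, coneToSuspRev_naturality]
  -- Read through `ι` and `d`, `θ` becomes a map `Σ W ⟶ Σ A`. Collapsing to `Σ B` and rotating both
  -- double cones shows that it lies over `Σ f`; stability then desuspends it.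
  obtain ⟨δ, hδ⟩ : ∃ δ : (toHo C).obj (Susp W) ⟶ (toHo C).obj (Susp A),
      δ ≫ (toHo C).map (unitSusp C ◁ i) = (toHo C).map (unitSusp C ◁ f) := by
    refine ⟨inv ((toHo C).map (doubleConeToSusp W)) ≫ (toHo C).map θ ≫ inv ((toHo C).map ι) ≫
      inv ((toHo C).map d) ≫ (toHo C).map (doubleConeToSusp A), ?_⟩
    rw [← cancel_epi ((toHo C).map (doubleConeToSusp W)), Category.assoc, IsIso.hom_inv_id_assoc,
      ← toHo_map_doubleConeToSuspRev A, ← toHo_map_doubleConeToSuspRev W]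
    simp only [Category.assoc]
    rw [← Functor.map_comp, ← Functor.map_comp, ← hds, ← hθ]
    simp
  obtain ⟨y, hy⟩ := exists_hoSusp_eq (δ ≫ hoSusp (𝟙 _))
  refine ⟨y, hoSusp_injective ?_⟩
  rw [← hoSusp_comp, hy, Category.assoc, hoSusp_comp, Category.id_comp, ← Category.comp_id
    ((toHo C).map i), ← toHo_map_comp_hoSusp, reassoc_of% hδ, toHo_map_comp_hoSusp,
    Category.comp_id]

/-- Exactness at the target of a morphism. -/
lemma exists_lift_of_comp_hoToCofib_eq_zero {W : C} [IsCofibrant W] {y : HoHom W R}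
    (h : y ≫ hoToCofib g = 0) : ∃ y₀ : HoHom W P, y₀ ≫ (toHo C).map g = y := by
  obtain ⟨B', j, _, _, _⟩ := exists_fibrant_replacement (cofTgt g)
  obtain ⟨f, hf⟩ := exists_toHo_map_eq (y ≫ inv ((toHo C).map (cofTgtProj g)) ≫ (toHo C).map j)
  -- The target is replaced by a fibrant object so that `y` becomes an actual map; `k` carries the
  -- vanishing in the cofiber to the new mapping cone.
  let k : Cofib g ⟶ pushout (cofIncl g ≫ j) (coneBase (cofSrc P)) :=
    cofibDesc g (j ≫ pushout.inl _ _) (pushout.inr _ _) (by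
      rw [← pushout.condition, Category.assoc])
  obtain ⟨y₀, hy₀⟩ := exists_lift_of_comp_pushout_inl_eq_zero (cofIncl g ≫ j) f (by
    have : j ≫ pushout.inl _ _ = cofibInl g ≫ k := (cofibInl_desc _ _ _ _).symm
    rw [Functor.map_comp, hf, Category.assoc, Category.assoc, ← Functor.map_comp, this,
      Functor.map_comp]
    rw [hoToCofib_eq] at h
    rw [reassoc_of% h, zero_comp])
  rw [hf, Functor.map_comp, ← Category.assoc, ← Category.assoc, cancel_mono,
    IsIso.eq_comp_inv, Category.assoc, ← Functor.map_comp, cofIncl_comp_cofTgtProj,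
    Functor.map_comp, ← Category.assoc] at hy₀
  exact ⟨_, hy₀⟩

end Stable

end

section

/-! ### Smash products of homotopy classes -/

section Smash

variable {C : Type u} [Category.{v} C] [ModelCategory C] [MonoidalCategory C]
  [SymmetricCategory C] [MonoidalClosed C] [HasZeroObject C] [HasZeroMorphisms C]
  [SymmetricMonoidalModelCategory C]

/-- Cylinders rather than path objects are used: tensoring with a cofibrant object preserves trivial
cofibrations, so it carries a good cylinder to an object whose two ends still agree in the homotopy
category. -/
lemma toHo_map_whiskerRight_eq {V Y W : C} [IsCofibrant V] [IsFibrant Y] [IsCofibrant W]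
    {x₀ x₁ : V ⟶ Y} (h : (toHo C).map x₀ = (toHo C).map x₁) :
    (toHo C).map (x₀ ▷ W) = (toHo C).map (x₁ ▷ W) := by
  rw [← LeftHomotopyRel.iff_map_eq (toHo C)] at h
  obtain ⟨P, _, ⟨h⟩⟩ := h.exists_good_cylinder
  have h₀ : P.i₀ ▷ W ≫ P.π ▷ W = 𝟙 _ := by rw [← comp_whiskerRight, P.i₀_π, id_whiskerRight]
  have h₁ : P.i₁ ▷ W ≫ P.π ▷ W = 𝟙 _ := by rw [← comp_whiskerRight, P.i₁_π, id_whiskerRight]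
  have : WeakEquivalence (P.π ▷ W) := weakEquivalence_of_precomp_of_fac h₀
  have e₀ : x₀ ▷ W = P.i₀ ▷ W ≫ h.h ▷ W := by rw [← comp_whiskerRight, h.h₀]
  have e₁ : x₁ ▷ W = P.i₁ ▷ W ≫ h.h ▷ W := by rw [← comp_whiskerRight, h.h₁]
  rw [e₀, e₁, Functor.map_comp, Functor.map_comp, toHo_map_eq_of_retraction h₀ h₁]

lemma toHo_map_whiskerLeft_eq {V Y W : C} [IsCofibrant V] [IsFibrant Y] [IsCofibrant W]
    {x₀ x₁ : V ⟶ Y} (h : (toHo C).map x₀ = (toHo C).map x₁) :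
    (toHo C).map (W ◁ x₀) = (toHo C).map (W ◁ x₁) := by
  have e (x : V ⟶ Y) : W ◁ x = (β_ W V).hom ≫ x ▷ W ≫ (β_ Y W).hom := by
    rw [BraidedCategory.braiding_naturality_left, SymmetricCategory.symmetry_assoc]
  rw [e, e, Functor.map_comp, Functor.map_comp, toHo_map_whiskerRight_eq h, ← Functor.map_comp,
    ← Functor.map_comp]

/-- The tensor product of maps from cofibrant to fibrant objects is homotopy invariant. -/
lemma toHo_map_tensorHom_eq {V Y W Z : C} [IsCofibrant V] [IsFibrant Y] [IsCofibrant W]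
    [IsFibrant Z] {x₀ x₁ : V ⟶ Y} {y₀ y₁ : W ⟶ Z} (h : (toHo C).map x₀ = (toHo C).map x₁)
    (h' : (toHo C).map y₀ = (toHo C).map y₁) :
    (toHo C).map (x₀ ⊗ₘ y₀) = (toHo C).map (x₁ ⊗ₘ y₁) := by
  rw [MonoidalCategory.tensorHom_def, Functor.map_comp, toHo_map_whiskerRight_eq h,
    ← Functor.map_comp, ← MonoidalCategory.tensorHom_def, tensorHom_def', tensorHom_def',
    Functor.map_comp, toHo_map_whiskerLeft_eq h', ← Functor.map_comp]

lemma isSmash_toHo_map {V W Y Z : C} (f : V ⟶ Y) (g : W ⟶ Z) :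
    IsSmash ((toHo C).map f) ((toHo C).map g) ((toHo C).map (f ⊗ₘ g)) := by
  obtain ⟨Y', i, h₁, h₂, h₃⟩ := exists_fibrant_replacement Y
  obtain ⟨Z', j, h₄, h₅, h₆⟩ := exists_fibrant_replacement Z
  exact ⟨Y', Z', i, j, f ≫ i, g ≫ j, h₁, h₄, h₂, h₃, h₅, h₆, Functor.map_comp _ _ _,
    Functor.map_comp _ _ _, by rw [← Functor.map_comp, tensorHom_comp_tensorHom]⟩

/-- Any two choices of fibrant replacements are compared by extending one along the other; their
tensor product is inverted because all objects involved are cofibrant. -/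
lemma IsSmash.unique {V W Y Z : C} [IsCofibrant V] [IsCofibrant W] [IsCofibrant Y]
    [IsCofibrant Z] {x : HoHom V Y} {y : HoHom W Z} {w w' : HoHom (V ⊗ W) (Y ⊗ Z)}
    (h : IsSmash x y w) (h' : IsSmash x y w') : w = w' := by
  obtain ⟨Y₀, Z₀, i₀, j₀, x₀, y₀, _, _, _, _, _, _, hx₀, hy₀, hw₀⟩ := h
  obtain ⟨Y₁, Z₁, i₁, j₁, x₁, y₁, _, _, _, _, _, _, hx₁, hy₁, hw₁⟩ := h'
  obtain ⟨e, he⟩ := exists_extension_of_isFibrant i₀ i₁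
  obtain ⟨e', he'⟩ := exists_extension_of_isFibrant j₀ j₁
  have : IsCofibrant Y₁ := isCofibrant_of_cofibration i₁
  have : IsIso ((toHo C).map (i₁ ⊗ₘ j₁)) := by
    rw [MonoidalCategory.tensorHom_def, Functor.map_comp]; infer_instance
  rw [← cancel_mono ((toHo C).map (i₁ ⊗ₘ j₁)), hw₁, ← he, ← he', ← tensorHom_comp_tensorHom,
    Functor.map_comp, reassoc_of% hw₀, ← Functor.map_comp, tensorHom_comp_tensorHom]
  apply toHo_map_tensorHom_eq
  · rw [Functor.map_comp, hx₀, Category.assoc, ← Functor.map_comp, he, hx₁]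
  · rw [Functor.map_comp, hy₀, Category.assoc, ← Functor.map_comp, he', hy₁]

end Smash

/-! ### Towers and pairings -/

namespace FilteredObject

variable {C : Type u} [Category.{v} C] [ModelCategory C] (X : FilteredObject C)

/-- The structure maps, in terms of the natural numbers which index the tower. -/
def mapNat {m n : ℤ} (h : m.toNat ≤ n.toNat) : X.obj n ⟶ X.obj m := X.tower.map (homOfLE h).op

lemma map_eq {m n : ℤ} (h : m ≤ n) : X.map h = X.mapNat (Int.toNat_le_toNat h) := rfl

lemma toBase_eq (f : ℤ) : X.toBase f = X.mapNat (Nat.zero_le _) := rfl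

lemma step_eq (f : ℤ) : X.step f = X.mapNat (by lia) := rfl

lemma mapNat_refl {m : ℤ} (h : m.toNat ≤ m.toNat) : X.mapNat h = 𝟙 _ := X.tower.map_id _

lemma mapNat_comp {k m n : ℤ} (h : m.toNat ≤ n.toNat) (h' : k.toNat ≤ m.toNat) :
    X.mapNat h ≫ X.mapNat h' = X.mapNat (h'.trans h) := (X.tower.map_comp _ _).symm

instance (n : ℤ) : IsFibrant (X.obj n) := by
  suffices ∀ n : ℕ, IsFibrant (X.tower.obj (op n)) from this _
  intro n
  induction n with
  | zero => exact X.isFibrant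
  | succ n ih =>
    have := X.fibration n
    exact isFibrant_of_fibration (X.tower.map (homOfLE n.le_succ).op)

lemma toHo_map_comp_p [MonoidalCategory C] [SymmetricCategory C] [MonoidalClosed C]
    [HasZeroObject C] [HasZeroMorphisms C] [TopologicalStructure C] {f : ℤ} {W : C}
    {x : W ⟶ X.obj f} {x' : W ⟶ cofTgt (X.step f)} (h : x' ≫ cofTgtProj (X.step f) = x) :
    ((toHo C).map x ≫ X.p f) ≫ (toHo C).map (cofibToQuo (X.step f)) =
      (toHo C).map (x' ≫ quoProj (X.step f)) :=
  toHo_map_hoToCofib _ h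

lemma layer_hom_ext [MonoidalCategory C] [SymmetricCategory C] [MonoidalClosed C]
    [HasZeroObject C] [HasZeroMorphisms C] [TopologicalStructure C] {f : ℤ} {Q : Ho C}
    {z z' : Q ⟶ (toHo C).obj (X.layer f)} (h : z ≫ (toHo C).map (cofibToQuo (X.step f)) =
      z' ≫ (toHo C).map (cofibToQuo (X.step f))) : z = z' :=
  (cancel_mono (Y := (toHo C).obj (Cofib (X.step f)))
    ((toHo C).map (cofibToQuo (X.step f)))).1 h

end FilteredObject

namespace Pairing

variable {C : Type u} [Category.{v} C] [ModelCategory C] [MonoidalCategory C]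

section

variable {X' X Y : FilteredObject C} (μ : Pairing X' X Y)

lemma app_comp_map_naturality {m m' n n' k k' : ℕ} (h : k ≤ m + n) (h' : k' ≤ m' + n')
    (hm : m ≤ m') (hn : n ≤ n') (hk : k ≤ k') :
    (X'.tower.map (homOfLE hm).op ⊗ₘ X.tower.map (homOfLE hn).op) ≫ μ.app m n ≫
      Y.tower.map (homOfLE h).op =
    (μ.app m' n' ≫ Y.tower.map (homOfLE h').op) ≫ Y.tower.map (homOfLE hk).op := by
  rw [reassoc_of% (μ.naturality hm hn), Category.assoc, ← Functor.map_comp, ← Functor.map_comp]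
  rfl

lemma app'_naturality {m m' n n' k k' : ℤ} (h : k ≤ m + n) (h' : k' ≤ m' + n')
    (hm : m.toNat ≤ m'.toNat) (hn : n.toNat ≤ n'.toNat) (hk : k.toNat ≤ k'.toNat) :
    (X'.mapNat hm ⊗ₘ X.mapNat hn) ≫ μ.app' h = μ.app' h' ≫ Y.mapNat hk :=
  μ.app_comp_map_naturality (by lia) (by lia) hm hn hk

lemma mapNat_whiskerRight_app' {m m' n k k' : ℤ} (h : k ≤ m + n) (h' : k' ≤ m' + n)
    (hm : m.toNat ≤ m'.toNat) (hk : k.toNat ≤ k'.toNat) :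
    X'.mapNat hm ▷ X.obj n ≫ μ.app' h = μ.app' h' ≫ Y.mapNat hk := by
  rw [← μ.app'_naturality h h' hm le_rfl hk, X.mapNat_refl, tensorHom_id]

lemma mapNat_whiskerLeft_app' {m n n' k k' : ℤ} (h : k ≤ m + n) (h' : k' ≤ m + n')
    (hn : n.toNat ≤ n'.toNat) (hk : k.toNat ≤ k'.toNat) :
    X'.obj m ◁ X.mapNat hn ≫ μ.app' h = μ.app' h' ≫ Y.mapNat hk := by
  rw [← μ.app'_naturality h h' le_rfl hn hk, X'.mapNat_refl, id_tensorHom]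

end

lemma IsAssociative.app_comp_map {X X' X'' : FilteredObject C} {μ : Pairing X' X X}
    {μ' : Pairing X'' X' X'} {μ'' : Pairing X'' X X} (h : μ.IsAssociative μ' μ'')
    {k m n s t f : ℕ} (hs : s ≤ k + m) (ht : t ≤ m + n) (hf : f ≤ s + n) (hf' : f ≤ k + t) :
    (μ'.app k m ≫ X'.tower.map (homOfLE hs).op) ▷ X.tower.obj (op n) ≫ μ.app s n ≫
      X.tower.map (homOfLE hf).op =
    (α_ _ _ _).hom ≫ X''.tower.obj (op k) ◁ (μ.app m n ≫ X.tower.map (homOfLE ht).op) ≫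
      μ''.app k t ≫ X.tower.map (homOfLE hf').op := by
  have e₁ := μ.app_comp_map_naturality hf (k' := f) (by lia) hs le_rfl le_rfl
  have e₂ := μ''.app_comp_map_naturality hf' (k' := f) (by lia) le_rfl ht le_rfl
  rw [show (homOfLE (le_refl n)).op = 𝟙 _ from rfl, CategoryTheory.Functor.map_id, tensorHom_id]
    at e₁
  rw [show (homOfLE (le_refl k)).op = 𝟙 _ from rfl, CategoryTheory.Functor.map_id, id_tensorHom]
    at e₂
  rw [comp_whiskerRight, Category.assoc, e₁, whiskerLeft_comp, Category.assoc, Category.assoc, e₂,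
    Category.assoc, reassoc_of% (h k m n), ← Functor.map_comp,
    ← Functor.map_comp, ← Functor.map_comp]
  rfl

/-- Filtrations enter through inequalities since stages are truncated at `0`: `n + m - r` may be
negative, and truncation is only subadditive. -/
lemma IsAssociative.app' {X X' X'' : FilteredObject C} {μ : Pairing X' X X}
    {μ' : Pairing X'' X' X'} {μ'' : Pairing X'' X X} (h : μ.IsAssociative μ' μ'')
    {k m n s t f : ℤ} (hs : s ≤ k + m) (ht : t ≤ m + n) (hf : f ≤ s + n) (hf' : f ≤ k + t) :
    μ'.app' hs ▷ X.obj n ≫ μ.app' hf =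
      (α_ _ _ _).hom ≫ X''.obj k ◁ μ.app' ht ≫ μ''.app' hf' :=
  h.app_comp_map (by lia) (by lia) (by lia) (by lia)

section

variable [SymmetricCategory C] [MonoidalClosed C] [HasZeroObject C] [HasZeroMorphisms C]
  [SymmetricMonoidalModelCategory C] [TopologicalStructure C]
  {X' X Y : FilteredObject C} (μ : Pairing X' X Y)

/-- Pairings of filtered objects induce pairings of the layers. -/
lemma exists_isQuoPairing {m n k : ℤ} (h : k ≤ m + n) :
    ∃ ν : Quo (X'.step m) ⊗ Quo (X.step n) ⟶ Quo (Y.step k), μ.IsQuoPairing h ν := by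
  have n₁ : X'.step m ▷ X.obj n ≫ μ.app' h = μ.app' (k := k + 1) (by lia) ≫ Y.step k :=
    μ.mapNat_whiskerRight_app' _ _ (by lia) (by lia)
  have n₂ : X'.obj m ◁ X.step n ≫ μ.app' h = μ.app' (k := k + 1) (by lia) ≫ Y.step k :=
    μ.mapNat_whiskerLeft_app' _ _ (by lia) (by lia)
  have n₃ : X'.obj (m + 1) ◁ X.step n ≫ μ.app' (k := k + 1) (by lia) =
      X'.step m ▷ X.obj (n + 1) ≫ μ.app' (k := k + 1) (by lia) := by
    have := μ.mapNat_whiskerLeft_app' (m := m + 1) (n := n) (n' := n + 1) (k := k + 1)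
      (k' := k + 1) (by lia) (by lia) (by lia) le_rfl
    exact this.trans (μ.mapNat_whiskerRight_app' _ _ (by lia) le_rfl).symm
  -- The map on the two smaller corners is built first on `A' ⊗ B`, then on `B' ⊗ A` relative to `A'
  -- ⊗ A`; the pushout-product axiom extends it to `B' ⊗ B`.
  obtain ⟨a₁, ha₁⟩ := exists_lift_of_isCofibrant (cofSrcProj (Y.obj (k + 1)))
    ((cofSrcProj (X'.obj (m + 1)) ⊗ₘ cofTgtProj (X.step n)) ≫ μ.app' (by lia))
  obtain ⟨a₂, ha, ha₂⟩ := exists_lift (cofIncl (X'.step m) ▷ cofSrc (X.obj (n + 1)))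
    (cofSrcProj (Y.obj (k + 1))) (f := _ ◁ cofIncl (X.step n) ≫ a₁)
    (g := (cofTgtProj (X'.step m) ⊗ₘ cofSrcProj (X.obj (n + 1))) ≫ μ.app' (by lia)) (by
      rw [Category.assoc, ha₁, whiskerLeft_comp_tensorHom_assoc, cofIncl_comp_cofTgtProj,
        whiskerRight_comp_tensorHom_assoc, cofIncl_comp_cofTgtProj,
        ← tensorHom_comp_whiskerLeft_assoc, n₃, ← tensorHom_comp_whiskerRight_assoc])
  have := SymmetricMonoidalModelCategory.cofibration_pushoutProduct (cofIncl (X'.step m))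
    (cofIncl (X.step n))
  obtain ⟨b, hb₁, hb₂, hb⟩ := exists_lift_pushoutProduct (cofIncl (X'.step m)) (cofIncl (X.step n))
    (cofTgtProj (Y.step k)) (a₂ ≫ cofIncl _) (a₁ ≫ cofIncl _) (by rw [reassoc_of% ha])
    ((cofTgtProj (X'.step m) ⊗ₘ cofTgtProj (X.step n)) ≫ μ.app' h) (by
      rw [Category.assoc, cofIncl_comp_cofTgtProj, reassoc_of% ha₂,
        whiskerLeft_comp_tensorHom_assoc, cofIncl_comp_cofTgtProj,
        ← tensorHom_comp_whiskerLeft_assoc, n₂]) (by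
      rw [Category.assoc, cofIncl_comp_cofTgtProj, reassoc_of% ha₁,
        whiskerRight_comp_tensorHom_assoc, cofIncl_comp_cofTgtProj,
        ← tensorHom_comp_whiskerRight_assoc, n₁])
  -- Pass to the quotient in one variable at a time.
  obtain ⟨c, hc⟩ := ((isCoker_quoProj (X'.step m)).whiskerRight _).exists_desc
    (b ≫ quoProj _) (by rw [reassoc_of% hb₂, cofIncl_quoProj, comp_zero])
  obtain ⟨ν, hν⟩ := ((isCoker_quoProj (X.step n)).whiskerLeft _).exists_desc c (by
    have := (isCoker_quoProj (X'.step m)).epi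
    rw [← cancel_epi (quoProj (X'.step m) ▷ _), ← whisker_exchange_assoc, hc, reassoc_of% hb₁,
      cofIncl_quoProj, comp_zero, comp_zero])
  exact ⟨ν, b, a₁, a₂, hb, ha₁, ha₂, hb₂.symm, hb₁.symm, ha.symm, by
    rw [MonoidalCategory.tensorHom_def, Category.assoc, hν, hc]⟩

variable {V' V : C} [IsCofibrant V'] [IsCofibrant V]

lemma isLayerProd_of_isQuoPairing {m n k : ℤ} (h : k ≤ m + n) {x' : HoHom V' (X'.layer m)}
    {x : HoHom V (X.layer n)} {z : HoHom (V' ⊗ V) (Y.layer k)} {f' : V' ⟶ Quo (X'.step m)}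
    {f : V ⟶ Quo (X.step n)} {ν : Quo (X'.step m) ⊗ Quo (X.step n) ⟶ Quo (Y.step k)}
    (hν : μ.IsQuoPairing h ν) (hf' : x' ≫ (toHo C).map (cofibToQuo _) = (toHo C).map f')
    (hf : x ≫ (toHo C).map (cofibToQuo _) = (toHo C).map f)
    (hz : z ≫ (toHo C).map (cofibToQuo _) = (toHo C).map ((f' ⊗ₘ f) ≫ ν)) :
    μ.IsLayerProd h x' x z :=
  ⟨ν, _, hν, by rw [hf', hf]; exact isSmash_toHo_map f' f, by rw [hz, Functor.map_comp]⟩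

/-- For classes lifted to the towers, the layer product does not depend on the induced pairing:
every admissible `ν` lies under a map over `μ`, and smash products of classes are unique. -/
lemma IsLayerProd.eq {m n k : ℤ} {h : k ≤ m + n} {y' : V' ⟶ X'.obj m} {y : V ⟶ X.obj n}
    {z : HoHom (V' ⊗ V) (Y.layer k)}
    (hz : μ.IsLayerProd h ((toHo C).map y' ≫ X'.p m) ((toHo C).map y ≫ X.p n) z) :
    z = (toHo C).map ((y' ⊗ₘ y) ≫ μ.app' h) ≫ Y.p k := by
  obtain ⟨ν, w, ⟨b, a₁, a₂, hb, -, -, -, -, -, hν⟩, hw, hz⟩ := hz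
  obtain ⟨ŷ', hŷ'⟩ := exists_lift_of_isCofibrant (cofTgtProj (X'.step m)) y'
  obtain ⟨ŷ, hŷ⟩ := exists_lift_of_isCofibrant (cofTgtProj (X.step n)) y
  rw [X'.toHo_map_comp_p hŷ', X.toHo_map_comp_p hŷ] at hw
  rw [hw.unique (isSmash_toHo_map _ _), ← Functor.map_comp, ← tensorHom_comp_tensorHom,
    Category.assoc, hν, ← Category.assoc, ← Y.toHo_map_comp_p
      (x := (y' ⊗ₘ y) ≫ μ.app' h) (by
        rw [Category.assoc, hb, tensorHom_comp_tensorHom_assoc, hŷ', hŷ])] at hz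
  exact Y.layer_hom_ext hz

end

/-! ### Products of a map of pairs with a map -/

section Cones

variable [SymmetricCategory C] [MonoidalClosed C] [HasZeroObject C] [HasZeroMorphisms C]
  [SymmetricMonoidalModelCategory C] [TopologicalStructure C]

lemma coneBase_coneTensorRight (X Y : C) :
    coneBase (X ⊗ Y) ≫ coneTensorRight X Y = coneBase X ▷ Y := by
  simp [coneBase, coneTensorRight]

lemma coneToSusp_suspTensorRight (X Y : C) :
    coneToSusp (X ⊗ Y) ≫ suspTensorRight X Y = coneTensorRight X Y ≫ coneToSusp X ▷ Y := by
  simp [coneToSusp, coneTensorRight, suspTensorRight]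

lemma coneBase_coneTensorLeft (X Y : C) :
    coneBase (X ⊗ Y) ≫ coneTensorLeft X Y = X ◁ coneBase Y := by
  simp only [coneBase, coneTensorLeft, Category.assoc, associator_inv_naturality_left_assoc,
    ← comp_whiskerRight_assoc, BraidedCategory.braiding_naturality_left]
  simp

lemma coneToSusp_suspTensorLeft (X Y : C) :
    coneToSusp (X ⊗ Y) ≫ suspTensorLeft X Y = coneTensorLeft X Y ≫ X ◁ coneToSusp Y := by
  simp only [coneToSusp, coneTensorLeft, suspTensorLeft, Category.assoc,
    associator_inv_naturality_left_assoc, ← comp_whiskerRight_assoc,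
    BraidedCategory.braiding_naturality_left]
  simp

variable {X' X Y : FilteredObject C} {μ : Pairing X' X Y}

/-- The product of a map of pairs with a map. -/
lemma IsQuoPairing.isPairMap_right {m n k : ℤ} {h : k ≤ m + n}
    {ν : Quo (X'.step m) ⊗ Quo (X.step n) ⟶ Quo (Y.step k)} (hν : μ.IsQuoPairing h ν)
    (h' : k + 1 ≤ m + 1 + n) {W V : C} {Φ : Cone W ⟶ X'.obj m} {γ : W ⟶ X'.obj (m + 1)}
    {q : Susp W ⟶ Quo (X'.step m)} (hq : IsPairMap (X'.step m) Φ γ q)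
    {x : V ⟶ X.obj n} {x' : V ⟶ cofTgt (X.step n)} (hx : x' ≫ cofTgtProj (X.step n) = x) :
    IsPairMap (Y.step k) (coneTensorRight W V ≫ (Φ ⊗ₘ x) ≫ μ.app' h) ((γ ⊗ₘ x) ≫ μ.app' h')
      (suspTensorRight W V ≫ (q ⊗ₘ (x' ≫ quoProj (X.step n))) ≫ ν) := by
  obtain ⟨b, a₁, -, hb, ha₁, -, w, -, -, hν⟩ := hν
  obtain ⟨Φ', γ', e, rfl, rfl, hq⟩ := hq
  refine ⟨coneTensorRight W V ≫ (Φ' ⊗ₘ x') ≫ b, (γ' ⊗ₘ x') ≫ a₁, ?_, ?_, ?_, ?_⟩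
  · rw [reassoc_of% coneBase_coneTensorRight, whiskerRight_comp_tensorHom_assoc, e,
      ← tensorHom_comp_whiskerRight_assoc, ← w, Category.assoc]
  · rw [Category.assoc, Category.assoc, hb, tensorHom_comp_tensorHom_assoc, hx]
  · rw [Category.assoc, ha₁, tensorHom_comp_tensorHom_assoc, hx]
  · rw [reassoc_of% coneToSusp_suspTensorRight, whiskerRight_comp_tensorHom_assoc, hq,
      ← tensorHom_comp_tensorHom_assoc, hν, Category.assoc, Category.assoc]

/-- The product of a map with a map of pairs. -/
lemma IsQuoPairing.isPairMap_left {m n k : ℤ} {h : k ≤ m + n}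
    {ν : Quo (X'.step m) ⊗ Quo (X.step n) ⟶ Quo (Y.step k)} (hν : μ.IsQuoPairing h ν)
    (h' : k + 1 ≤ m + (n + 1)) {W V : C} {Φ : Cone W ⟶ X.obj n} {γ : W ⟶ X.obj (n + 1)}
    {q : Susp W ⟶ Quo (X.step n)} (hq : IsPairMap (X.step n) Φ γ q)
    {x : V ⟶ X'.obj m} {x' : V ⟶ cofTgt (X'.step m)} (hx : x' ≫ cofTgtProj (X'.step m) = x) :
    IsPairMap (Y.step k) (coneTensorLeft V W ≫ (x ⊗ₘ Φ) ≫ μ.app' h) ((x ⊗ₘ γ) ≫ μ.app' h')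
      (suspTensorLeft V W ≫ ((x' ≫ quoProj (X'.step m)) ⊗ₘ q) ≫ ν) := by
  obtain ⟨b, -, a₂, hb, -, ha₂, -, w, -, hν⟩ := hν
  obtain ⟨Φ', γ', e, rfl, rfl, hq⟩ := hq
  refine ⟨coneTensorLeft V W ≫ (x' ⊗ₘ Φ') ≫ b, (x' ⊗ₘ γ') ≫ a₂, ?_, ?_, ?_, ?_⟩
  · rw [reassoc_of% coneBase_coneTensorLeft, whiskerLeft_comp_tensorHom_assoc, e,
      ← tensorHom_comp_whiskerLeft_assoc, ← w, Category.assoc]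
  · rw [Category.assoc, Category.assoc, hb, tensorHom_comp_tensorHom_assoc, hx]
  · rw [Category.assoc, ha₂, tensorHom_comp_tensorHom_assoc, hx]
  · rw [reassoc_of% coneToSusp_suspTensorLeft, whiskerLeft_comp_tensorHom_assoc, hq,
      ← tensorHom_comp_tensorHom_assoc, hν, Category.assoc, Category.assoc]

end Cones

end Pairing

end

section

/-! ### Pages of the spectral sequence -/

variable {C : Type u} [Category.{v} C] [ModelCategory C] [MonoidalCategory C]
  [SymmetricCategory C] [MonoidalClosed C] [HasZeroObject C] [HasZeroMorphisms C]
  [TopologicalStructure C] [StableStructure C]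

namespace FilteredObject

variable {X : FilteredObject C}

lemma p_κ (f : ℤ) : X.p f ≫ X.κ f = 0 := hoToCofib_hoConn (X.step f)

lemma κ_susp_map_step (f : ℤ) :
    X.κ f ≫ (StableStructure.susp (C := C)).map ((toHo C).map (X.step f)) = 0 :=
  hoConn_susp_map (X.step f)

variable (X) in
/-- The inverse of the comparison map from the mapping cone to the quotient. -/
def quoToLayer (f : ℤ) : (toHo C).obj (Quo (X.step f)) ⟶ (toHo C).obj (X.layer f) :=
  inv (X := (toHo C).obj (Cofib (X.step f))) ((toHo C).map (cofibToQuo (X.step f)))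

lemma quoToLayer_cofibToQuo (f : ℤ) :
    X.quoToLayer f ≫ (toHo C).map (cofibToQuo (X.step f)) = 𝟙 _ :=
  IsIso.inv_hom_id (X := (toHo C).obj (Cofib (X.step f))) _

lemma comp_quoToLayer_comp_κ {f : ℤ} {W : C} [IsCofibrant W] {Φ : Cone W ⟶ X.obj f}
    {γ : W ⟶ X.obj (f + 1)} {q : Susp W ⟶ Quo (X.step f)} (h : IsPairMap (X.step f) Φ γ q) :
    ((toHo C).map q ≫ X.quoToLayer f) ≫ X.κ f = hoSusp ((toHo C).map γ) := h.comp_hoConn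

section

variable {V : C} {f : ℤ} {r : ℕ}

lemma zero_mem_boundaries (hr : 1 ≤ r) : (0 : HoHom V (X.layer f)) ∈ X.boundaries V f r :=
  ⟨by lia, 0, by rw [zero_comp, hoZero_eq], zero_comp⟩

lemma neg_mem_boundaries {x : HoHom V (X.layer f)} (hx : x ∈ X.boundaries V f r) :
    -x ∈ X.boundaries V f r := by
  obtain ⟨h, y, hy, rfl⟩ := hx
  exact ⟨h, -y, by rw [Preadditive.neg_comp, hy, hoZero_eq, neg_zero], Preadditive.neg_comp _ _⟩

lemma add_mem_boundaries {x x' : HoHom V (X.layer f)} (hx : x ∈ X.boundaries V f r)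
    (hx' : x' ∈ X.boundaries V f r) : x + x' ∈ X.boundaries V f r := by
  obtain ⟨h, y, hy, rfl⟩ := hx
  obtain ⟨_, y', hy', rfl⟩ := hx'
  exact ⟨h, y + y', by rw [Preadditive.add_comp, hy, hy', hoZero_eq, add_zero],
    Preadditive.add_comp _ _ _ _ _ _⟩

lemma comp_κ_of_mem_boundaries {x : HoHom V (X.layer f)} (hx : x ∈ X.boundaries V f r) :
    x ≫ X.κ f = 0 := by
  obtain ⟨_, y, _, rfl⟩ := hx
  rw [Category.assoc, p_κ, comp_zero]

lemma mem_cycles_of_comp_κ {x : HoHom V (X.layer f)} (h : f + 1 ≤ f + r)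
    (y : (toHo C).obj V ⟶ (StableStructure.susp (C := C)).obj ((toHo C).obj (X.obj (f + r))))
    (hy : x ≫ X.κ f = y ≫ (StableStructure.susp (C := C)).map ((toHo C).map (X.map h))) :
    x ∈ X.cycles V f r := ⟨h, y, hy.symm⟩

lemma comp_p_mem_cycles (hr : 1 ≤ r) (y : HoHom V (X.obj f)) : y ≫ X.p f ∈ X.cycles V f r :=
  ⟨by lia, 0, by rw [Category.assoc, p_κ, comp_zero, zero_comp]⟩

lemma mem_cycles_of_comp_mem {V' : C} (i : V' ⟶ V) [IsIso i] {x : HoHom V (X.layer f)}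
    (hx : (toHo C).map i ≫ x ∈ X.cycles V' f r) : x ∈ X.cycles V f r := by
  obtain ⟨h, y, hy⟩ := hx
  exact ⟨h, inv ((toHo C).map i) ≫ y, by
    rw [Category.assoc, hy, Category.assoc, IsIso.inv_hom_id_assoc]⟩

end

namespace Page

variable {V : C} {f : ℤ} {r : ℕ} {e : X.Page V f r}

/-- The class of a cycle. -/
def mk (x : HoHom V (X.layer f)) (hx : x ∈ X.cycles V f r) : X.Page V f r := Quot.mk _ ⟨x, hx⟩

lemma mk_isClassOf (x : HoHom V (X.layer f)) (hx : x ∈ X.cycles V f r) : (mk x hx).IsClassOf x :=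
  ⟨hx, rfl⟩

/-- The boundaries form a subgroup, so the equivalence relation generated in the quotient is
congruence modulo boundaries. The assumption `1 ≤ r` makes zero a boundary. -/
lemma IsClassOf.exists_eq_add [IsCofibrant V] (hr : 1 ≤ r) {x x' : HoHom V (X.layer f)}
    (hx : e.IsClassOf x) (hx' : e.IsClassOf x') : ∃ b ∈ X.boundaries V f r, x' = x + b := by
  obtain ⟨h, rfl⟩ := hx
  obtain ⟨h', e'⟩ := hx'
  suffices ∀ x x' : X.cycles V f r,
      Relation.EqvGen (fun x y : X.cycles V f r => ∃ b ∈ X.boundaries V f r, IsSum y.1 b x.1) x x' →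
        ∃ b ∈ X.boundaries V f r, x'.1 = x.1 + b from this _ _ (Quot.eqvGen_exact e')
  intro x x' h
  induction h with
  | rel x y h =>
    obtain ⟨b, hb, h⟩ := h
    exact ⟨-b, neg_mem_boundaries hb, by rw [isSum_iff.1 h, add_neg_cancel_right]⟩
  | refl x => exact ⟨0, zero_mem_boundaries hr, (add_zero _).symm⟩
  | symm x y _ h =>
    obtain ⟨b, hb, h⟩ := h
    exact ⟨-b, neg_mem_boundaries hb, by rw [h, add_neg_cancel_right]⟩
  | trans x y z _ _ h h' =>
    obtain ⟨b, hb, h⟩ := h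
    obtain ⟨b', hb', h'⟩ := h'
    exact ⟨b + b', add_mem_boundaries hb hb', by rw [h', h, add_assoc]⟩

/-- Every representative of a permanent cycle lifts, with the same image in lower filtration. -/
lemma IsClassOf.exists_eq_comp_p [IsCofibrant V] (hr : 1 ≤ r) {x : HoHom V (X.layer f)}
    {y : HoHom V (X.obj f)} (hx : e.IsClassOf x) (hy : e.IsClassOf (y ≫ X.p f)) :
    ∃ y₁ : HoHom V (X.obj f), y₁ ≫ X.p f = x ∧
      ∀ h : (f - r + 1).toNat ≤ f.toNat,
        y₁ ≫ (toHo C).map (X.mapNat h) = y ≫ (toHo C).map (X.mapNat h) := by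
  obtain ⟨b, ⟨h, z, hz, rfl⟩, rfl⟩ := hy.exists_eq_add hr hx
  refine ⟨y + z, Preadditive.add_comp _ _ _ _ _ _, fun h => ?_⟩
  rw [map_eq, hoZero_eq] at hz
  rw [Preadditive.add_comp, hz, add_zero]

/-- Both lifts from `X_f` and boundaries are projections of classes in `X_f`, and `κ` kills these.
-/
lemma IsClassOf.comp_κ_of_isPermanent [IsCofibrant V] (hr : 1 ≤ r) {x : HoHom V (X.layer f)}
    (hx : e.IsClassOf x) (he : e.IsPermanent) : x ≫ X.κ f = 0 := by
  obtain ⟨y, hy⟩ := he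
  obtain ⟨b, hb, rfl⟩ := hy.exists_eq_add hr hx
  rw [Preadditive.add_comp, comp_κ_of_mem_boundaries hb, Category.assoc, p_κ, comp_zero, add_zero]

end Page

/-- A class in the image of a higher filtration which vanishes in filtration `0`, vanishes in
the range of filtrations to which the crossing differential hypothesis applies. -/
lemma CrossingHypothesis.comp_mapNat_eq_zero {W : C} [IsCofibrant W] {f r : ℕ}
    (h : X.CrossingHypothesis W f r) (δ : HoHom W (X.obj (f + 1)))
    (h₀ : δ ≫ (toHo C).map (X.mapNat (m := 0) (Nat.zero_le _)) = 0) (i : ℕ)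
    (hi : i = 0 ∨ i + r ≤ f) (hif : (i : ℤ).toNat ≤ ((f : ℤ) + 1).toNat) :
    δ ≫ (toHo C).map (X.mapNat hif) = 0 := by
  -- Climb the tower one stage at a time. The case `i = 0` is allowed separately, as `f` may be
  -- smaller than `r`.
  induction i with
  | zero => exact h₀
  | succ i ih =>
    obtain ⟨d, rfl⟩ := exists_toHo_map_eq δ
    have ih := ih (by lia) (by lia)
    obtain ⟨Φ, hΦ⟩ := exists_nullhomotopy (f := d ≫ X.mapNat (m := i) (by lia)) (by
      rw [Functor.map_comp, ih, toHo_map_zero_eq])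
    obtain ⟨q, hq⟩ := exists_isPairMap (g := X.step i) (Φ := Φ)
      (γ := d ≫ X.mapNat (m := i + 1) (by lia)) (by
        rw [hΦ, step_eq, Category.assoc, mapNat_comp])
    have hκ := comp_quoToLayer_comp_κ hq
    -- The null homotopy in `X_i` has `κ` equal to the suspended image of `δ`, which lives in
    -- `X_{f+1}` with `f + 1 = i + (f - i + 1)`. This is why the hypothesis concerns the page
    -- `E_{f-i+1}`.
    have hx : (toHo C).map q ≫ X.quoToLayer i ∈ X.cycles (Susp W) i (f - i + 1) := by
      refine mem_cycles_of_comp_κ (by lia) (hoSusp ((toHo C).map (d ≫ X.mapNat (by lia)))) ?_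
      rw [hoSusp_comp, ← Functor.map_comp, map_eq, Category.assoc d, mapNat_comp]
      exact hκ
    have := (Page.mk_isClassOf _ hx).comp_κ_of_isPermanent (by lia) (h i (by lia) _)
    rw [← Functor.map_comp]
    apply hoSusp_injective
    rw [hoSusp_zero]
    exact hκ.symm.trans this

/-- A permanent cycle that is hit by `d_r` and detects zero lifts to a class that vanishes
in filtration lower by `r`. -/
lemma Page.IsDiff.comp_mapNat_eq_zero {W : C} [IsCofibrant W] {k k₀ : ℤ} {f r : ℕ} (hr : 1 ≤ r)
    (hf : k = f) {e : X.Page W k r} {b : X.Page (Susp W) k₀ r} (hb : b.IsDiff e)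
    (hcross : X.CrossingHypothesis W f r) {z : HoHom W (X.obj k)} (hz : e.IsClassOf (z ≫ X.p k))
    (h₀ : z ≫ (toHo C).map (X.toBase k) = 0) (hk : k₀.toNat ≤ k.toNat) :
    z ≫ (toHo C).map (X.mapNat hk) = 0 := by
  subst hf
  obtain ⟨hk', h, x, y, -, hκ, hy⟩ := hb
  obtain ⟨y₁, hy₁, e₁⟩ := hy.exists_eq_comp_p hr hz
  -- The image of `y` in `X_{k₀+1}` suspends to a value of `κ`, so it dies one stage lower.
  have hy₀ : y ≫ (toHo C).map (X.mapNat hk) = 0 := by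
    apply hoSusp_injective
    rw [hoSusp_zero, ← X.mapNat_comp (m := k₀ + 1) (by lia) (by lia), Functor.map_comp,
      ← Category.assoc, ← hoSusp_comp]
    have := κ_susp_map_step (X := X) k₀
    rw [map_eq] at hκ
    rw [step_eq] at this
    rw [← hκ, Category.assoc, this, comp_zero]
  -- Now `y` and `y₁` have the same projection to the layer, so their difference lifts by exactness.
  obtain ⟨δ, hδ⟩ := exists_lift_of_comp_hoToCofib_eq_zero (g := X.step f) (y := y - y₁) (by
    have : (y - y₁) ≫ X.p f = 0 := by rw [Preadditive.sub_comp, hy₁, sub_self]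
    exact this)
  have comp {i j : ℤ} (y : HoHom W (X.obj f)) (h : i.toNat ≤ (f : ℤ).toNat)
      (h' : j.toNat ≤ i.toNat) : y ≫ (toHo C).map (X.mapNat (h'.trans h)) =
        (y ≫ (toHo C).map (X.mapNat h)) ≫ (toHo C).map (X.mapNat h') := by
    rw [Category.assoc, ← Functor.map_comp, mapNat_comp]
  have e₂ : y₁ ≫ (toHo C).map (X.mapNat hk) = z ≫ (toHo C).map (X.mapNat hk) := by
    rw [comp y₁ (i := f - r + 1) (by lia) (by lia), e₁, ← comp]
  rw [toBase_eq] at h₀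
  have hδ' {i : ℤ} (hi : i.toNat ≤ (f : ℤ).toNat) (hi' : i.toNat ≤ ((f : ℤ) + 1).toNat) :
      δ ≫ (toHo C).map (X.mapNat hi') =
        y ≫ (toHo C).map (X.mapNat hi) - y₁ ≫ (toHo C).map (X.mapNat hi) := by
    rw [← Preadditive.sub_comp, ← hδ, step_eq, Category.assoc, ← Functor.map_comp, mapNat_comp]
  -- In `X_0` both `y` and `z` vanish, and `y₁` agrees there with `z`; hence so does `δ`. The stage
  -- `k₀` is truncated at `0` to enter the induction.
  have hδ₀ := hcross.comp_mapNat_eq_zero δ (by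
    rw [hδ' (i := 0) (by lia), comp y hk (by lia), comp y₁ hk (by lia), e₂, hy₀, zero_comp,
      ← comp, h₀, sub_zero]) k₀.toNat (by lia) (by lia)
  have hδ₁ := hδ' (i := k₀) hk (by lia)
  have e₃ : δ ≫ (toHo C).map (X.mapNat (m := k₀) (by lia)) = 0 := by
    rw [← X.mapNat_comp (m := (k₀.toNat : ℤ)) (by lia) (by lia), Functor.map_comp,
      ← Category.assoc, hδ₀, zero_comp]
  rw [e₃, hy₀, zero_sub, e₂] at hδ₁
  exact neg_eq_zero.1 hδ₁.symm

end FilteredObject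

end

section

/-! ### Products of detecting classes, and Massey products -/

lemma IsPairMap.w {C : Type u} [Category.{v} C] [ModelCategory C] [MonoidalCategory C]
    [SymmetricCategory C] [MonoidalClosed C] [HasZeroObject C] [HasZeroMorphisms C]
    [TopologicalStructure C] {P R W : C} {g : P ⟶ R} {Φ : Cone W ⟶ R} {γ : W ⟶ P}
    {q : Susp W ⟶ Quo g} (h : IsPairMap g Φ γ q) : coneBase W ≫ Φ = γ ≫ g := by
  obtain ⟨Φ', γ', e, rfl, rfl, -⟩ := h
  rw [reassoc_of% e, cofIncl_comp_cofTgtProj, Category.assoc]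

lemma IsPairMap.precomp {C : Type u} [Category.{v} C] [ModelCategory C] [MonoidalCategory C]
    [SymmetricCategory C] [MonoidalClosed C] [HasZeroObject C] [HasZeroMorphisms C]
    [TopologicalStructure C] {P R W V : C} {g : P ⟶ R} {Φ : Cone W ⟶ R} {γ : W ⟶ P}
    {q : Susp W ⟶ Quo g} (h : IsPairMap g Φ γ q) (f : V ⟶ W) :
    IsPairMap g (unitCone C ◁ f ≫ Φ) (f ≫ γ) (unitSusp C ◁ f ≫ q) := by
  obtain ⟨Φ', γ', e, rfl, rfl, hq⟩ := h
  refine ⟨unitCone C ◁ f ≫ Φ', f ≫ γ', ?_, Category.assoc _ _ _, Category.assoc _ _ _, ?_⟩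
  · rw [reassoc_of% (coneBase_naturality f), e, Category.assoc]
  · rw [reassoc_of% (coneToSusp_naturality f), hq, Category.assoc]

variable {C : Type u} [Category.{v} C] [ModelCategory C] [MonoidalCategory C]
  [SymmetricCategory C] [MonoidalClosed C] [HasZeroObject C] [HasZeroMorphisms C]
  [TopologicalStructure C]

instance (X Y : C) : IsIso (suspTensorRight X Y) :=
  inferInstanceAs (IsIso (α_ (unitSusp C) X Y).inv)

instance (X Y : C) : IsIso (suspTensorLeft X Y) := by
  unfold suspTensorLeft; infer_instance

variable [StableStructure C]

lemma FilteredObject.Page.Detects.exists_map {X : FilteredObject C} {V : C} [IsCofibrant V]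
    {f : ℤ} {r : ℕ} {e : X.Page V f r} {α : HoHom V (X.obj 0)} (h : e.Detects α) :
    ∃ x : V ⟶ X.obj f, (toHo C).map (x ≫ X.toBase f) = α ∧
      e.IsClassOf ((toHo C).map x ≫ X.p f) := by
  obtain ⟨y, rfl, hy⟩ := h
  obtain ⟨x, rfl⟩ := exists_toHo_map_eq y
  exact ⟨x, Functor.map_comp _ _ _, hy⟩

namespace Pairing

variable {X' X Y : FilteredObject C} (μ : Pairing X' X Y)

lemma app'_comp_mapNat {m n k k' : ℤ} (h : k ≤ m + n) (h' : k' ≤ m + n)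
    (hk : k.toNat ≤ k'.toNat) : μ.app' h' ≫ Y.mapNat hk = μ.app' h := by
  rw [← μ.mapNat_whiskerRight_app' h h' le_rfl hk, X'.mapNat_refl, id_whiskerRight,
    Category.id_comp]

variable [SymmetricMonoidalModelCategory C] {T T' : C} [IsCofibrant T] [IsCofibrant T']

/-- The restriction to the base of a product. -/
lemma tensorHom_app'_toBase {m n k : ℤ} (h : k ≤ m + n) (x' : T' ⟶ X'.obj m) (x : T ⟶ X.obj n) :
    ((x' ⊗ₘ x) ≫ μ.app' h) ≫ Y.toBase k =
      ((x' ≫ X'.toBase m) ⊗ₘ (x ≫ X.toBase n)) ≫ μ.app' (k := 0) le_rfl := by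
  rw [← tensorHom_comp_tensorHom_assoc, Category.assoc, FilteredObject.toBase_eq,
    FilteredObject.toBase_eq, FilteredObject.toBase_eq,
    μ.app'_naturality (m := 0) (n := 0) (k := 0) le_rfl h (by lia) (by lia) (by lia)]

/-- If the product of detecting elements is hit by `d_r`, and the product in filtration `0`
vanishes, then the product vanishes in filtration lower by `r`. -/
lemma ProdIsHit.toHo_map_eq_zero {m n r : ℕ} (hr : 1 ≤ r) {a' : X'.Page T' m r}
    {a : X.Page T n r} (hit : μ.ProdIsHit a' a)
    (hcross : Y.CrossingHypothesis (T' ⊗ T) (m + n) r) {x' : T' ⟶ X'.obj m} {x : T ⟶ X.obj n}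
    (hx' : a'.IsClassOf ((toHo C).map x' ≫ X'.p m)) (hx : a.IsClassOf ((toHo C).map x ≫ X.p n))
    (h₀ : (toHo C).map (((x' ≫ X'.toBase m) ⊗ₘ (x ≫ X.toBase n)) ≫ μ.app' (k := 0) le_rfl) = 0)
    {k : ℤ} (hk : k = m + n - r) :
    (toHo C).map ((x' ⊗ₘ x) ≫ μ.app' (k := k) (by lia)) = 0 := by
  subst hk
  obtain ⟨e, b, ⟨_, _, z, hy', hy, hz, he⟩, hb⟩ := hit
  -- The page product in the hypothesis uses some representatives of `a'` and `a`. They are lifted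
  -- so as to agree with `x'` and `x` in filtrations `m - r + 1` and `n - r + 1`.
  obtain ⟨y', rfl, e₁⟩ := hy'.exists_eq_comp_p hr hx'
  obtain ⟨y, rfl, e₂⟩ := hy.exists_eq_comp_p hr hx
  obtain ⟨y', rfl⟩ := exists_toHo_map_eq y'
  obtain ⟨y, rfl⟩ := exists_toHo_map_eq y
  simp only [← Functor.map_comp] at e₁ e₂
  have e₁' := e₁ (by lia)
  have e₂' := e₂ (by lia)
  have b₁ : (toHo C).map (y' ≫ X'.toBase m) = (toHo C).map (x' ≫ X'.toBase m) := by
    rw [X'.toBase_eq, ← X'.mapNat_comp (m := m - r + 1) (by lia) (by lia), ← Category.assoc,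
      Functor.map_comp, e₁', ← Functor.map_comp, Category.assoc]
  have b₂ : (toHo C).map (y ≫ X.toBase n) = (toHo C).map (x ≫ X.toBase n) := by
    rw [X.toBase_eq, ← X.mapNat_comp (m := n - r + 1) (by lia) (by lia), ← Category.assoc,
      Functor.map_comp, e₂', ← Functor.map_comp, Category.assoc]
  rw [hz.eq] at he
  have key := hb.comp_mapNat_eq_zero hr (f := m + n) (by push_cast; rfl) hcross he (by
    rw [← Functor.map_comp, tensorHom_app'_toBase, Functor.map_comp, toHo_map_tensorHom_eq b₁ b₂,
      ← Functor.map_comp, h₀]) (by lia)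
  rw [← Functor.map_comp, Category.assoc, app'_comp_mapNat _ (by lia)] at key
  rw [← key]
  -- In filtration `m + n - r` the product depends on each factor only through its image `r - 1`
  -- stages lower, so the old and new representatives have the same product there.
  have s₁ (x' : T' ⟶ X'.obj m) (y : T ⟶ X.obj n) :
      (x' ⊗ₘ y) ≫ μ.app' (k := m + n - r) (by lia) =
        ((x' ≫ X'.mapNat (m := m - r + 1) (by lia)) ⊗ₘ y) ≫
          μ.app' (k := m + n - r) (by lia) := by
    rw [← tensorHom_comp_whiskerRight_assoc, μ.mapNat_whiskerRight_app' (k' := m + n - r) _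
      (by lia) _ le_rfl, Y.mapNat_refl, Category.comp_id]
  have s₂ (x' : T' ⟶ X'.obj m) (y : T ⟶ X.obj n) :
      (x' ⊗ₘ y) ≫ μ.app' (k := m + n - r) (by lia) =
        (x' ⊗ₘ (y ≫ X.mapNat (m := n - r + 1) (by lia))) ≫
          μ.app' (k := m + n - r) (by lia) := by
    rw [← tensorHom_comp_whiskerLeft_assoc, μ.mapNat_whiskerLeft_app' (k' := m + n - r) _
      (by lia) _ le_rfl, Y.mapNat_refl, Category.comp_id]
  have t₁ : (toHo C).map ((y' ⊗ₘ y) ≫ μ.app' (k := m + n - r) (by lia)) =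
      (toHo C).map ((x' ⊗ₘ y) ≫ μ.app' (k := m + n - r) (by lia)) := by
    rw [s₁ y' y, s₁ x' y, Functor.map_comp, Functor.map_comp, toHo_map_tensorHom_eq e₁' rfl]
  have t₂ : (toHo C).map ((x' ⊗ₘ y) ≫ μ.app' (k := m + n - r) (by lia)) =
      (toHo C).map ((x' ⊗ₘ x) ≫ μ.app' (k := m + n - r) (by lia)) := by
    rw [s₂ x' y, s₂ x' x, Functor.map_comp, Functor.map_comp, toHo_map_tensorHom_eq rfl e₂']
  rw [t₁, t₂]

/-- The product of maps which represent classes with product zero vanishes. -/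
lemma IsProd.toHo_map_eq {m n k : ℤ} {h : k ≤ m + n} {α' : HoHom T' (X'.obj m)}
    {α : HoHom T (X.obj n)} {γ : HoHom (T' ⊗ T) (Y.obj k)} (hγ : μ.IsProd h α' α γ)
    {x' : T' ⟶ X'.obj m} {x : T ⟶ X.obj n} (hx' : (toHo C).map x' = α')
    (hx : (toHo C).map x = α) : (toHo C).map ((x' ⊗ₘ x) ≫ μ.app' h) = γ := by
  obtain ⟨y', y, rfl, rfl, rfl⟩ := hγ
  rw [Functor.map_comp, toHo_map_tensorHom_eq hx' hx, ← Functor.map_comp]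

/-- The product of detecting elements of the pages is represented by the product of the maps. -/
lemma isPageProd_mk {m n k : ℤ} {r : ℕ} (hr : 1 ≤ r) (h : k = m + n) {a' : X'.Page T' m r}
    {a : X.Page T n r} {x' : T' ⟶ X'.obj m} {x : T ⟶ X.obj n}
    (hx' : a'.IsClassOf ((toHo C).map x' ≫ X'.p m))
    (hx : a.IsClassOf ((toHo C).map x ≫ X.p n)) :
    μ.IsPageProd h a' a (.mk ((toHo C).map ((x' ⊗ₘ x) ≫ μ.app' h.le) ≫ Y.p k)
      (FilteredObject.comp_p_mem_cycles hr _)) := by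
  obtain ⟨ν, hν⟩ := μ.exists_isQuoPairing h.le
  obtain ⟨x₁', rfl⟩ := exists_lift_of_isCofibrant (cofTgtProj (X'.step m)) x'
  obtain ⟨x₁, rfl⟩ := exists_lift_of_isCofibrant (cofTgtProj (X.step n)) x
  refine ⟨_, _, _, hx', hx, μ.isLayerProd_of_isQuoPairing h.le hν (X'.toHo_map_comp_p rfl)
    (X.toHo_map_comp_p rfl) ?_, FilteredObject.Page.mk_isClassOf _ _⟩
  obtain ⟨b, -, -, hb, -, -, -, -, -, hν⟩ := id hν
  rw [Y.toHo_map_comp_p (x' := (x₁' ⊗ₘ x₁) ≫ b) (by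
      rw [Category.assoc, hb, tensorHom_comp_tensorHom_assoc]),
    ← tensorHom_comp_tensorHom_assoc, hν, Category.assoc]

end Pairing

/-- The class of a map of pairs whose restriction to the base lifts is a cycle. -/
lemma FilteredObject.mem_cycles_of_isPairMap {X : FilteredObject C} {W : C} [IsCofibrant W]
    {f : ℤ} {r : ℕ} (hr : 1 ≤ r) {z : W ⟶ X.obj (f + r)} {Φ : Cone W ⟶ X.obj f}
    {q : Susp W ⟶ Quo (X.step f)} (hq : IsPairMap (X.step f) Φ (z ≫ X.mapNat (by lia)) q) :
    (toHo C).map q ≫ X.quoToLayer f ∈ X.cycles (Susp W) f r := by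
  refine mem_cycles_of_comp_κ (by lia) (hoSusp ((toHo C).map z)) ?_
  rw [comp_quoToLayer_comp_κ hq, hoSusp_comp, map_eq, Functor.map_comp]

/-- A nullhomotopy in filtration lower by `r` of a class defines an element with differential
the given class. -/
lemma FilteredObject.exists_isDiff {X : FilteredObject C} {W : C} [IsCofibrant W] {f f₀ : ℤ}
    {r : ℕ} (hr : 1 ≤ r) (hf : f = f₀ + r) {z : W ⟶ X.obj f} {Φ : Cone W ⟶ X.obj f₀}
    {q : Susp W ⟶ Quo (X.step f₀)} {e : X.Page W f r}
    (he : e.IsClassOf ((toHo C).map z ≫ X.p f))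
    (hq : IsPairMap (X.step f₀) Φ (z ≫ X.mapNat (by lia)) q) :
    ∃ b : X.Page (Susp W) f₀ r, b.IsDiff e ∧ b.IsClassOf ((toHo C).map q ≫ X.quoToLayer f₀) := by
  subst hf
  have hc := mem_cycles_of_isPairMap hr hq
  refine ⟨.mk _ hc, ⟨rfl, by lia, _, _, Page.mk_isClassOf _ hc, ?_, he⟩, Page.mk_isClassOf _ hc⟩
  rw [comp_quoToLayer_comp_κ hq, map_eq, Functor.map_comp]

end

end TodaMassey

end

/-! ### The theorem on Massey products and Toda brackets -/

open TodaMassey in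
theorem theorem4p6 {C : Type u} [Category.{v} C] [ModelCategory C] [MonoidalCategory C]
    [SymmetricCategory C] [MonoidalClosed C] [HasZeroObject C] [HasZeroMorphisms C]
    [SymmetricMonoidalModelCategory C] [TopologicalStructure C] [StableStructure C]
    -- three filtered objects with associative pairings
    (X X' X'' : FilteredObject C)
    (μ : Pairing X' X X) (μ' : Pairing X'' X' X') (μ'' : Pairing X'' X X)
    (hassoc : μ.IsAssociative μ' μ'')
    -- the degrees of `α`, `α'`, `α''`, and the filtrations of `a`, `a'`, `a''`
    (T T' T'' : C) [IsCofibrant T] [IsCofibrant T'] [IsCofibrant T'']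
    (l m n : ℕ) (r : ℕ) (hr : 1 ≤ r)
    (α : HoHom T (X.obj 0)) (α' : HoHom T' (X'.obj 0)) (α'' : HoHom T'' (X''.obj 0))
    (hα : μ.IsProd (k := 0) le_rfl α' α (hoZero _ _))
    (hα' : μ'.IsProd (k := 0) le_rfl α'' α' (hoZero _ _))
    (a : X.Page T l r) (a' : X'.Page T' m r) (a'' : X''.Page T'' n r)
    (ha : a.Detects α) (ha' : a'.Detects α') (ha'' : a''.Detects α'')
    (haa' : μ.ProdIsHit a' a) (ha'a'' : μ'.ProdIsHit a'' a')
    (hcross : X.CrossingHypothesis (T' ⊗ T) (m + l) r)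
    (hcross' : X'.CrossingHypothesis (T'' ⊗ T') (n + m) r) :
    ∃ c ∈ MasseyProduct μ μ' μ'' a a' a'', ∃ ζ ∈ TodaBracket μ μ' μ'' α α' α'',
      c.Detects ζ := by
  obtain ⟨x, hx, ax⟩ := ha.exists_map
  obtain ⟨x', hx', ax'⟩ := ha'.exists_map
  obtain ⟨x'', hx'', ax''⟩ := ha''.exists_map
  -- null homotopies in the expected filtrations
  obtain ⟨G, hG⟩ := exists_nullhomotopy ((haa'.toHo_map_eq_zero μ hr hcross ax' ax (by
    rw [hα.toHo_map_eq μ hx' hx, hoZero_eq]) (k := m + l - r) rfl).trans (toHo_map_zero_eq _ _).symm)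
  obtain ⟨F, hF⟩ := exists_nullhomotopy ((ha'a''.toHo_map_eq_zero μ' hr hcross' ax'' ax' (by
    rw [hα'.toHo_map_eq μ' hx'' hx', hoZero_eq]) (k := n + m - r) rfl).trans
      (toHo_map_zero_eq _ _).symm)
  -- the elements `b` and `b'`
  obtain ⟨q, hq⟩ := exists_isPairMap (g := X.step (m + l - r)) (Φ := G)
    (γ := ((x' ⊗ₘ x) ≫ μ.app' (k := m + l) le_rfl) ≫ X.mapNat (m := m + l - r + 1) (by lia)) (by
      rw [hG, FilteredObject.step_eq, Category.assoc, Category.assoc, X.mapNat_comp,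
        μ.app'_comp_mapNat])
  obtain ⟨q', hq'⟩ := exists_isPairMap (g := X'.step (n + m - r)) (Φ := F)
    (γ := ((x'' ⊗ₘ x') ≫ μ'.app' (k := n + m) le_rfl) ≫
      X'.mapNat (m := n + m - r + 1) (by lia)) (by
      rw [hF, FilteredObject.step_eq, Category.assoc, Category.assoc, X'.mapNat_comp,
        μ'.app'_comp_mapNat])
  obtain ⟨b, hb, bq⟩ := FilteredObject.exists_isDiff hr (by lia)
    (FilteredObject.Page.mk_isClassOf _ (FilteredObject.comp_p_mem_cycles hr _)) hq
  obtain ⟨b', hb', bq'⟩ := FilteredObject.exists_isDiff hr (by lia)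
    (FilteredObject.Page.mk_isClassOf _ (FilteredObject.comp_p_mem_cycles hr _)) hq'
  -- the products of `b'` and `a`, and of `a''` and `b`
  obtain ⟨ν, hν⟩ := μ.exists_isQuoPairing (m := n + m - r) (n := l) (k := l + m + n - r) (by lia)
  obtain ⟨ν'', hν''⟩ := μ''.exists_isQuoPairing (m := n) (n := m + l - r) (k := l + m + n - r)
    (by lia)
  obtain ⟨x₁, hx₁⟩ := exists_lift_of_isCofibrant (cofTgtProj (X.step l)) x
  obtain ⟨x₁'', hx₁''⟩ := exists_lift_of_isCofibrant (cofTgtProj (X''.step n)) x''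
  have hs : (l + m + n - r : ℤ) + 1 ≤ l + m + n - r + r := by lia
  -- On their common base both cones restrict to the triple product in filtration `l + m + n`. This
  -- stage is written as `l + m + n - r + r` so that the cycle criterion for the `E_r`-page applies
  -- literally.
  have base : (((((x'' ⊗ₘ x') ≫ μ'.app' (k := n + m) le_rfl) ≫
      X'.mapNat (m := n + m - r + 1) (by lia)) ⊗ₘ x) ≫ μ.app' (k := l + m + n - r + 1) (by lia) :
        (T'' ⊗ T') ⊗ T ⟶ _) =
      ((((x'' ⊗ₘ x') ≫ μ'.app' (k := n + m) le_rfl) ⊗ₘ x) ≫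
        μ.app' (k := l + m + n - r + r) (by lia)) ≫ X.mapNat (by lia) := by
    rw [← tensorHom_comp_whiskerRight_assoc, 
      μ.mapNat_whiskerRight_app' (k' := l + m + n - r + r) _ (by lia) _ (by lia),
      Category.assoc]
  have base'' : (α_ T'' T' T).hom ≫ ((x'' ⊗ₘ (((x' ⊗ₘ x) ≫ μ.app' (k := m + l) le_rfl) ≫
      X.mapNat (m := m + l - r + 1) (by lia))) ≫ μ''.app' (k := l + m + n - r + 1) (by lia)) =
      ((((x'' ⊗ₘ x') ≫ μ'.app' (k := n + m) le_rfl) ⊗ₘ x) ≫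
        μ.app' (k := l + m + n - r + r) (by lia)) ≫ X.mapNat (by lia) := by
    rw [← tensorHom_comp_whiskerLeft_assoc,
      μ''.mapNat_whiskerLeft_app' (k' := l + m + n - r + r) _ (by lia) _ (by lia),
      ← tensorHom_comp_whiskerLeft_assoc, ← associator_naturality_assoc,
      ← tensorHom_comp_whiskerRight_assoc, Category.assoc, Category.assoc,
      reassoc_of% (hassoc.app' (s := n + m) (t := m + l)
        (f := l + m + n - r + r) (k := n) (m := m) (n := l) le_rfl le_rfl (by lia) (by lia))]
  have hu := hν.isPairMap_right (by lia) hq' hx₁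
  have hv := (hν''.isPairMap_left (by lia) hq hx₁'').precomp (α_ T'' T' T).hom
  rw [base] at hu
  rw [base''] at hv
  have cu := FilteredObject.mem_cycles_of_isPairMap hr hu
  have cv := FilteredObject.mem_cycles_of_isPairMap hr hv
  -- The criterion speaks of classes on `Σ ((T'' ⊗ T') ⊗ T)`; removing the canonical isomorphisms
  -- gives cycles on `Σ (T'' ⊗ T') ⊗ T` and `T'' ⊗ Σ (T' ⊗ T)`, where the page products live.
  rw [Functor.map_comp, Category.assoc] at cu
  rw [← Category.assoc, Functor.map_comp, Category.assoc] at cv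
  have cu' := FilteredObject.mem_cycles_of_comp_mem _ cu
  have cv' := FilteredObject.mem_cycles_of_comp_mem _ cv
  have layer {V : C} {Z : FilteredObject C} {f : ℤ} (q : V ⟶ Quo (Z.step f)) :
      ((toHo C).map q ≫ Z.quoToLayer f) ≫ (toHo C).map (cofibToQuo (Z.step f)) =
        (toHo C).map q := by
    rw [Category.assoc, FilteredObject.quoToLayer_cofibToQuo, Category.comp_id]
  -- the element of the Toda bracket
  let φ : DoubleCone ((T'' ⊗ T') ⊗ T) ⟶ X.obj (l + m + n - r) :=
    pushout.desc _ _ (hu.w.trans hv.w.symm)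
  let ζ : HoHom (Susp ((T'' ⊗ T') ⊗ T)) (X.obj (l + m + n - r)) :=
    inv ((toHo C).map (doubleConeToSusp _)) ≫ (toHo C).map φ
  refine ⟨.mk (ζ ≫ X.p _) (FilteredObject.comp_p_mem_cycles (by lia) ζ),
    ⟨b', b, _, _, _, _, ζ ≫ X.p _, μ'.isPageProd_mk hr rfl ax'' ax', hb',
      μ.isPageProd_mk hr rfl ax' ax, hb,
      ⟨.mk _ cu', ⟨_, _, _, bq', ax, ?_, FilteredObject.Page.mk_isClassOf _ _⟩,
        FilteredObject.Page.mk_isClassOf _ cu'⟩,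
      ⟨.mk _ cv', ⟨_, _, _, ax'', bq, ?_, FilteredObject.Page.mk_isClassOf _ _⟩,
        FilteredObject.Page.mk_isClassOf _ cv'⟩, ?_, FilteredObject.Page.mk_isClassOf _ _⟩,
    ζ ≫ (toHo C).map (X.toBase _), ?_, ζ, rfl, FilteredObject.Page.mk_isClassOf _ _⟩
  · exact μ.isLayerProd_of_isQuoPairing _ hν (layer q') (X.toHo_map_comp_p hx₁) (layer _)
  · exact μ''.isLayerProd_of_isQuoPairing _ hν'' (X''.toHo_map_comp_p hx₁'') (layer q) (layer _)
  · have key := hu.toHo_map_doubleCone hv φ (pushout.inl_desc _ _ _) (pushout.inr_desc _ _ _)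
    -- The sum condition says that the `b'`-term is the projection of `ζ` plus the `b`-term, so the
    -- projection must be the difference in this order: first cone minus second.
    rw [isSum_iff, ← sub_eq_iff_eq_add]
    apply X.layer_hom_ext
    rw [Preadditive.sub_comp, ← Category.assoc ((toHo C).map (suspTensorRight _ _)),
      ← Functor.map_comp, layer, ← Category.assoc ((toHo C).map (_ ≫ suspTensorLeft _ _)),
      ← Functor.map_comp, layer, Category.assoc (unitSusp C ◁ _), Category.assoc, Category.assoc,
      IsIso.eq_inv_comp]
    exact key.symm
  · refine ⟨x ≫ X.toBase _, x' ≫ X'.toBase _, x'' ≫ X''.toBase _, F ≫ X'.toBase _, G ≫ X.toBase _,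
      φ ≫ X.toBase _, hx, hx', hx'', ?_, ?_, ?_, ?_, ?_⟩
    · rw [reassoc_of% hF, ← Category.assoc, μ'.tensorHom_app'_toBase]
    · rw [reassoc_of% hG, ← Category.assoc, μ.tensorHom_app'_toBase]
    · rw [pushout.inl_desc_assoc, Category.assoc, μ.tensorHom_app'_toBase]
    · rw [pushout.inr_desc_assoc, Category.assoc, Category.assoc, μ''.tensorHom_app'_toBase]
    · rw [Functor.map_comp, Category.assoc, IsIso.hom_inv_id_assoc]
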